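/- Let $d\ge 1$ be an integer, $0<s<1$, $1\le p\le\infty$, $0<q\le\infty$ and $-1<\alpha<sp-1$ (for $p=\infty$ this means $-1<\alpha<\infty$); put $(\alpha+1)/p:=0$ if $p=\infty$. Then $\big(B^{s-(\alpha+1)/p}_{p,q}(\mathbb R^d),\,B^s_{p,q}(\mathbb R^{d+1}_+,\mu_\alpha)\big)$ is a Whitney trace-extension pair, in the following sense. *Dyadic cubes.* A dyadic cube of $\mathbb R^n$ is a set $Q=2^{-k}((0,1]^n+m)$ with $k\in\mathbb Z$, $m\in\mathbb Z^n$; its edge length is $\ell(Q)=2^{-k}$. Write $Q\sim Q'$ if $\frac12\le \ell(Q)/\ell(Q')\le 2$ and $\overline Q\cap\overline{Q'}\ne\emptyset$. *Spaces.* Let $\mathbb R^{d+1}_+=\mathbb R^d\times(0,\infty)$ and let $\mu_\alpha$ be the measure on it with density $\min(1,x_{d+1})^\alpha$ with respect to Lebesgue measure. For $(\Omega,\mu)=(\mathbb R^d,\text{Lebesgue measure})$ or $(\mathbb R^{d+1}_+,\mu_\alpha)$ and $0<\sigma<1$, the space $B^\sigma_{p,q}(\Omega,\mu)$ consists of the functions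 $f:\Omega\to\mathbb C$ that are $\mu$-integrable on bounded subsets of $\Omega$ and satisfy $$\|f\|_{B^\sigma_{p,q}(\Omega,\mu)}=\|f\|_{L^p(\Omega,\mu)}+\Big(\sum_{k=0}^\infty 2^{k\sigma q}\Big(\sum_{Q}\mu(Q)\sum_{Q'\sim Q}|f_{Q,\mu}-f_{Q',\mu}|^p\Big)^{q/p}\Big)^{1/q}<\infty ,$$ where $Q$ runs over the dyadic cubes with $Q\subset\Omega$ and $\ell(Q)=2^{-k}$, $Q'$ over the dyadic cubes with $Q'\subset\Omega$ and $Q'\sim Q$, and $f_{Q,\mu}=\mu(Q)^{-1}\int_Q f\,d\mu$ (with suprema in place of sums if $p=\infty$ or $q=\infty$, the factor $\mu(Q)$ being dropped if $p=\infty$). The Lebesgue measure is omitted from the notation. *Whitney extension.* For a dyadic cube $Q$ of $\mathbb R^d$ put $W(Q)=Q\times(\ell(Q),2\ell(Q)]$. Call a family $(\psi_Q)$, indexed by the dyadic cubes $Q$ of $\mathbb R^d$ with $\ell(Q)\le1$, admissible if every $\psi_Q:\mathbb R^{d+1}_+\to[0,1]$ is smooth and supported in $\{y:\operatorname{dist}(y,W(Q))<\ell(Q)/4\}$,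 there are constants $C,c>0$ such that for every $Q$ the function $\psi_Q$ is Lipschitz with constant $C/\ell(Q)$ and $\psi_Q\ge c$ on $W(Q)$, and $\sum_Q\psi_Q=1$ on $\bigcup_Q W(Q)$. Set $\mathcal E f(x)=\sum_Q\big(|Q|^{-1}\int_Q f\big)\psi_Q(x)$. *Claim.* Admissible families exist, and for every admissible family, writing $X=B^{s-(\alpha+1)/p}_{p,q}(\mathbb R^d)$ and $Y=B^s_{p,q}(\mathbb R^{d+1}_+,\mu_\alpha)$: 1. $\mathcal E$ maps $X$ into $Y$ and there is a finite constant $C$ with $\|\mathcal Ef\|_Y\le C\|f\|_X$ for all $f\in X$; 2. for every $f\in Y$ the limit $\mathcal Rf(x)=\lim_{r\to0^+}\mu_\alpha(B_r^+(x))^{-1}\int_{B_r^+(x)}f\,d\mu_\alpha$, with $B_r^+(x)=B((x,0),r)\cap\mathbb R^{d+1}_+$, exists for almost every $x\in\mathbb R^d$, and $\mathcal Rf$ is locally integrable; 3. $\mathcal R$ maps $Y$ into $X$ and there is a finite constant $C$ with $\|\mathcal Rf\|_X\le C\|f\|_Y$ for all $f\in Y$; 4. $\mathcal R(\mathcal Ef)=f$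 almost everywhere for all $f\in X$. -/

import Mathlib

open MeasureTheory Filter Topology
open scoped ENNReal NNReal

noncomputable section

namespace BesovTrace

/-- `ℝⁿ` with the Euclidean distance. -/
abbrev E (n : ℕ) : Type := EuclideanSpace ℝ (Fin n)

/-! ### Dyadic cubes -/

/-- Index of the semi-open dyadic cube `2^{-level} ((0,1]ⁿ + pos)`. -/
@[ext]
structure DyadicCube (n : ℕ) where
  level : ℤ
  pos : Fin n → ℤ

namespace DyadicCube

variable {n : ℕ}

/-- The edge length `2^{-level}`. -/
def len (Q : DyadicCube n) : ℝ := (2 : ℝ) ^ (-Q.level)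

/-- The cube `2^{-level} ((0,1]ⁿ + pos)` as a subset of `ℝⁿ`. -/
def toSet (Q : DyadicCube n) : Set (E n) :=
  {x | ∀ i, x i ∈ Set.Ioc (Q.len * Q.pos i) (Q.len * (Q.pos i + 1))}

/-- `Q ∼ Q'`: the edge lengths differ at most by a factor `2` and the closures intersect. -/
def Neighbor (Q Q' : DyadicCube n) : Prop :=
  1 / 2 ≤ Q.len / Q'.len ∧ Q.len / Q'.len ≤ 2 ∧
    (closure Q.toSet ∩ closure Q'.toSet).Nonempty

end DyadicCube

/-! ### Dyadic Besov spaces -/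

/-- The `k`-th dyadic energy
`(∑_{Q} μ(Q) ∑_{Q' ∼ Q} |f_{Q,μ} - f_{Q',μ}|^p)^{1/p}`, where `Q` runs over the dyadic cubes of
edge length `2^{-k}` contained in `Ω` and `Q'` over its neighbors contained in `Ω`;
for `p = ∞` it is the supremum of the differences. -/
def levelEnergy {n : ℕ} (Ω : Set (E n)) (μ : Measure (E n)) (p : ℝ≥0∞) (f : E n → ℂ)
    (k : ℕ) : ℝ≥0∞ :=
  if p = ∞ then
    ⨆ Q : {Q : DyadicCube n // Q.level = (k : ℤ) ∧ Q.toSet ⊆ Ω},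
      ⨆ Q' : {Q' : DyadicCube n // Q.1.Neighbor Q' ∧ Q'.toSet ⊆ Ω},
        ‖(⨍ x in Q.1.toSet, f x ∂μ) - ⨍ x in Q'.1.toSet, f x ∂μ‖ₑ
  else
    (∑' Q : {Q : DyadicCube n // Q.level = (k : ℤ) ∧ Q.toSet ⊆ Ω},
      μ Q.1.toSet * ∑' Q' : {Q' : DyadicCube n // Q.1.Neighbor Q' ∧ Q'.toSet ⊆ Ω},
        ‖(⨍ x in Q.1.toSet, f x ∂μ) - ⨍ x in Q'.1.toSet, f x ∂μ‖ₑ ^ p.toReal) ^ (1 / p.toReal)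

/-- The `ℓ^q` (quasi-)norm of a sequence in `[0,∞]`. -/
def ellNorm (q : ℝ≥0∞) (a : ℕ → ℝ≥0∞) : ℝ≥0∞ :=
  if q = ∞ then ⨆ k, a k else (∑' k, a k ^ q.toReal) ^ (1 / q.toReal)

/-- The dyadic Besov quasinorm of `B^s_{p,q}(Ω, μ)` (possibly `∞`), where `Ω` is the whole space
or a half-space. -/
def besovNorm {n : ℕ} (Ω : Set (E n)) (μ : Measure (E n)) (s : ℝ) (p q : ℝ≥0∞)
    (f : E n → ℂ) : ℝ≥0∞ :=
  eLpNorm f p (μ.restrict Ω) +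
    ellNorm q fun k => ENNReal.ofReal ((2 : ℝ) ^ ((k : ℝ) * s)) * levelEnergy Ω μ p f k

/-- `f` is `μ`-integrable on the bounded subsets of `Ω`. -/
def LocInt {n : ℕ} (Ω : Set (E n)) (μ : Measure (E n)) (f : E n → ℂ) : Prop :=
  ∀ B : Set (E n), Bornology.IsBounded B → IntegrableOn f (B ∩ Ω) μ

/-- The Besov space `B^s_{p,q}(Ω, μ)`, as a set of functions; only their values in `Ω` matter. -/
def besovSpace {n : ℕ} (Ω : Set (E n)) (μ : Measure (E n)) (s : ℝ) (p q : ℝ≥0∞) :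
    Set (E n → ℂ) :=
  {f | LocInt Ω μ f ∧ besovNorm Ω μ s p q f < ∞}

/-! ### The half-space and its weighted measure -/

/-- The half-space `ℝ^{d+1}_+ = ℝ^d × (0,∞)`. -/
def upperHalf (d : ℕ) : Set (E (d + 1)) := {x | 0 < x (Fin.last d)}

/-- The measure `μ_α` on `ℝ^{d+1}_+` with density `min(1, |x_{d+1}|)^α`. -/
def muAlpha (d : ℕ) (α : ℝ) : Measure (E (d + 1)) :=
  ((volume : Measure (E (d + 1))).restrict (upperHalf d)).withDensity
    fun x => ENNReal.ofReal ((min 1 |x (Fin.last d)|) ^ α)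

/-- The boundary point `(x, 0)`. -/
def bdry {d : ℕ} (x : E d) : E (d + 1) :=
  WithLp.toLp 2 (Fin.snoc (α := fun _ => ℝ) (fun i => x i) 0)

/-! ### Whitney extension -/

/-- The Whitney box `W(Q) = Q × (ℓ(Q), 2ℓ(Q)]` over a dyadic cube `Q` of `ℝ^d`. -/
def whitneyBox {d : ℕ} (Q : DyadicCube d) : Set (E (d + 1)) :=
  {x | (∀ i : Fin d, x i.castSucc ∈ Set.Ioc (Q.len * Q.pos i) (Q.len * (Q.pos i + 1))) ∧
    x (Fin.last d) ∈ Set.Ioc Q.len (2 * Q.len)}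

/-- The dyadic cubes of edge length at most `1`. -/
abbrev SmallCube (d : ℕ) : Type := {Q : DyadicCube d // 0 ≤ Q.level}

/-- Admissible families of bump functions for the Whitney extension. Each `ψ_Q` has its support
inside the half-space, so it is recorded as a function on `ℝ^{d+1}` vanishing outside it. -/
structure IsWhitneyPartition (d : ℕ) (ψ : SmallCube d → E (d + 1) → ℝ) : Prop where
  smooth : ∀ Q, ContDiff ℝ ((⊤ : ℕ∞) : WithTop ℕ∞) (ψ Q)
  mem_Icc : ∀ Q x, ψ Q x ∈ Set.Icc (0 : ℝ) 1
  lipschitz : ∃ C : ℝ≥0, ∀ Q, LipschitzWith (C / Q.1.len.toNNReal) (ψ Q)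
  lower_bound : ∃ c : ℝ, 0 < c ∧ ∀ Q, ∀ x ∈ whitneyBox Q.1, c ≤ ψ Q x
  support : ∀ Q, tsupport (ψ Q) ⊆ Metric.thickening (Q.1.len / 4) (whitneyBox Q.1)
  sum_eq_one : ∀ x ∈ ⋃ Q : SmallCube d, whitneyBox Q.1, ∑' Q, ψ Q x = 1

/-- The Whitney extension `𝓔 f = ∑_Q (⨍_Q f) ψ_Q` (a locally finite sum in the half-space). -/
def whitneyExt {d : ℕ} (ψ : SmallCube d → E (d + 1) → ℝ) (f : E d → ℂ) (x : E (d + 1)) : ℂ :=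
  ∑' Q : SmallCube d, (⨍ y in Q.1.toSet, f y) * (ψ Q x : ℂ)

/-! ### Traces -/

/-- `c` is the limit, as `r → 0+`, of the `μ`-averages of `f` over `B((x,0),r) ∩ ℝ^{d+1}_+`. -/
def HasTraceAt {d : ℕ} (μ : Measure (E (d + 1))) (f : E (d + 1) → ℂ) (x : E d) (c : ℂ) : Prop :=
  Tendsto (fun r : ℝ => ⨍ y in Metric.ball (bdry x) r ∩ upperHalf d, f y ∂μ) (𝓝[>] 0) (𝓝 c)

/-- The trace `𝓡 f`; its value at `x` is meaningful when the limit of averages at `x` exists. -/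
def trace {d : ℕ} (μ : Measure (E (d + 1))) (f : E (d + 1) → ℂ) (x : E d) : ℂ :=
  limUnder (𝓝[>] (0 : ℝ)) fun r => ⨍ y in Metric.ball (bdry x) r ∩ upperHalf d, f y ∂μ

/-- `(X, Y)` is a Whitney trace-extension pair, for the bump functions `ψ`; here `X` and `Y` are
sets of functions on `ℝ^d` and on `(ℝ^{d+1}_+, μ)` with quasinorms `NX` and `NY`. -/
structure IsWhitneyTraceExtensionPair {d : ℕ} (ψ : SmallCube d → E (d + 1) → ℝ)
    (μ : Measure (E (d + 1))) (X : Set (E d → ℂ)) (NX : (E d → ℂ) → ℝ≥0∞)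
    (Y : Set (E (d + 1) → ℂ)) (NY : (E (d + 1) → ℂ) → ℝ≥0∞) : Prop where
  ext_mem : ∀ f ∈ X, whitneyExt ψ f ∈ Y
  ext_bounded : ∃ C : ℝ≥0, ∀ f ∈ X, NY (whitneyExt ψ f) ≤ C * NX f
  trace_exists : ∀ f ∈ Y, ∀ᵐ x : E d, ∃ c : ℂ, HasTraceAt μ f x c
  trace_locInt : ∀ f ∈ Y, LocallyIntegrable (trace μ f) (volume : Measure (E d))
  trace_mem : ∀ f ∈ Y, trace μ f ∈ X
  trace_bounded : ∃ C : ℝ≥0, ∀ f ∈ Y, NX (trace μ f) ≤ C * NY f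
  trace_ext : ∀ f ∈ X, trace μ (whitneyExt ψ f) =ᵐ[volume] f

end BesovTrace

end

/-!
The proof reduces everything to estimates at a fixed dyadic scale, which hold on any space whose
dyadic cubes satisfy a doubling condition (`DyadicDoubling`). On such a space, the energy at level
`k` in the Besov norm is comparable with the `L^p` norm of the oscillation, that is, of the largest
difference between the average over the cube of level `k` at `x` and the averages over its
neighbors (`levelEnergy_le`, `eLpNorm_osc_le`), and replacing a function by its averages over
neighboring cubes is bounded on `L^p` (`eLpNorm_nbrSup_le`). Both the Lebesgue measure on `ℝ^d` and
the weighted measure on the half-space qualify, the latter because it is a product of the Lebesgue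
measure with the measure `min(1,t)^α dt`, which is doubling for `α > -1`.

The two spaces are linked by the weight of the layer of height `2^{-k}`, which is comparable with
`2^{-k(α+1)}`. For a function of the first `d` variables only, restriction to this layer multiplies
the `L^p` norm by about `2^{-kβ}`, where `β = (α+1)/p` (`exists_eLpNorm_layer_le`,
`exists_eLpNorm_boundaryCube_le`). This is the loss of smoothness from `s` to `s - β`, and the
hypothesis on `α` says that `s - β > 0`.

*Trace.* Consecutive averages of `u` over the boundary cubes `Q × (0, ℓ(Q)]` differ by an oscillation
of `u`. As `s - β > 0`, the `L^p` norms of these oscillations are summable, so the averages converge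
almost everywhere; averages over half-balls are compared with them by exhausting the half-ball by
dyadic cubes. This gives existence of the trace together with the bound of `trace_spec`, by which
the energies of the trace at level `k` are controlled by a sum of energies of `u` over the levels
`j ≥ k` (`exists_levelEnergy_trace_le`).

*Extension.* At level `k`, near the boundary the extension `F` of `f` is close to the average of `f`
over the cube below, with an error that telescopes over the finer levels (`extDev_le`). Far from the
boundary, at height about `2^{-j}` with `j ≤ k`, it is Lipschitz with a constant of order `2^j`
times an oscillation of `f` (`exists_enorm_whitneyExt_sub_le`), which gains the factor `2^{j-k}`.
Since `s > 0` and `s < 1` respectively, both contributions are discrete convolutions of the energies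
of `f` with a geometric sequence (`exists_levelEnergy_whitneyExt_le`). Such convolutions are bounded
on `ℓ^q` for every `q > 0` (`exists_ellNorm_conv_le`), and this settles both norm estimates.

The same control of the extension near the boundary shows that its averages over boundary cubes have
the same limits as the averages of `f`, so that Lebesgue's differentiation theorem yields
`trace_whitneyExt`. Finally, an admissible family is given by products of differences of smooth
steps, which telescope when summed over positions and levels (`isWhitneyPartition_whitneyBump`).
-/

namespace BesovTrace

section
/-! ### Geometry of dyadic cubes -/

/-- Left endpoint of the semi-open dyadic interval of length `2^{-k}` containing `t`. -/
noncomputable def lo (k : ℤ) (t : ℝ) : ℝ := (2 : ℝ) ^ (-k) * ((⌈(2 : ℝ) ^ k * t⌉ : ℝ) - 1)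

/-- Right endpoint of the semi-open dyadic interval of length `2^{-k}` containing `t`. -/
noncomputable def hi (k : ℤ) (t : ℝ) : ℝ := (2 : ℝ) ^ (-k) * (⌈(2 : ℝ) ^ k * t⌉ : ℝ)

lemma two_zpow_neg_mul (k : ℤ) (t : ℝ) : (2 : ℝ) ^ (-k) * ((2 : ℝ) ^ k * t) = t := by
  rw [← mul_assoc, ← zpow_add₀ two_ne_zero]; simp

lemma lo_lt (k : ℤ) (t : ℝ) : lo k t < t := by
  have h := Int.ceil_lt_add_one ((2 : ℝ) ^ k * t)
  have h2 : (0 : ℝ) < (2 : ℝ) ^ (-k) := by positivity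
  calc lo k t < (2 : ℝ) ^ (-k) * ((2 : ℝ) ^ k * t) := by unfold lo; gcongr; linarith
    _ = t := two_zpow_neg_mul k t

lemma le_hi (k : ℤ) (t : ℝ) : t ≤ hi k t := by
  have h := Int.le_ceil ((2 : ℝ) ^ k * t)
  have h2 : (0 : ℝ) < (2 : ℝ) ^ (-k) := by positivity
  calc t = (2 : ℝ) ^ (-k) * ((2 : ℝ) ^ k * t) := (two_zpow_neg_mul k t).symm
    _ ≤ hi k t := by unfold hi; gcongr

lemma hi_eq (k : ℤ) (t : ℝ) : hi k t = lo k t + (2 : ℝ) ^ (-k) := by unfold hi lo; ring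

lemma two_zpow_sub {j k : ℤ} (h : j ≤ k) :
    ∃ m : ℕ, (2 : ℝ) ^ k = (2 : ℝ) ^ j * ((2 ^ m : ℤ) : ℝ) := by
  refine ⟨(k - j).toNat, ?_⟩
  push_cast
  rw [← zpow_natCast, ← zpow_add₀ two_ne_zero]
  congr 1; omega

/-- Dyadic intervals are nested: the left endpoint increases with the level. -/
lemma lo_mono {j k : ℤ} (h : j ≤ k) (t : ℝ) : lo j t ≤ lo k t := by
  obtain ⟨m, hm⟩ := two_zpow_sub h
  have hj : (0 : ℝ) < (2 : ℝ) ^ j := by positivity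
  have h1 : (2 ^ m : ℤ) * (⌈(2 : ℝ) ^ j * t⌉ - 1) < ⌈(2 : ℝ) ^ k * t⌉ := by
    rw [Int.lt_ceil, hm]
    push_cast
    have := Int.ceil_lt_add_one ((2 : ℝ) ^ j * t)
    have h3 : (0 : ℝ) < (2 : ℝ) ^ m := by positivity
    nlinarith
  have h2 : (2 ^ m : ℤ) * (⌈(2 : ℝ) ^ j * t⌉ - 1) ≤ ⌈(2 : ℝ) ^ k * t⌉ - 1 := by omega
  have h4 : (2 : ℝ) ^ (-j) = (2 : ℝ) ^ (-k) * ((2 ^ m : ℤ) : ℝ) := by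
    rw [zpow_neg, zpow_neg, hm]; field_simp
  unfold lo
  rw [h4, mul_assoc]
  gcongr
  exact_mod_cast h2

lemma hi_anti {j k : ℤ} (h : j ≤ k) (t : ℝ) : hi k t ≤ hi j t := by
  obtain ⟨m, hm⟩ := two_zpow_sub h
  have hj : (0 : ℝ) < (2 : ℝ) ^ j := by positivity
  have h1 : ⌈(2 : ℝ) ^ k * t⌉ ≤ (2 ^ m : ℤ) * ⌈(2 : ℝ) ^ j * t⌉ := by
    rw [Int.ceil_le, hm]
    push_cast
    have := Int.le_ceil ((2 : ℝ) ^ j * t)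
    have h3 : (0 : ℝ) < (2 : ℝ) ^ m := by positivity
    nlinarith
  have h4 : (2 : ℝ) ^ (-j) = (2 : ℝ) ^ (-k) * ((2 ^ m : ℤ) : ℝ) := by
    rw [zpow_neg, zpow_neg, hm]; field_simp
  unfold hi
  rw [h4, mul_assoc]
  gcongr
  exact_mod_cast h1

lemma lo_nonneg {k : ℤ} {t : ℝ} (h0 : 0 < t) : 0 ≤ lo k t := by
  have hk : (0 : ℝ) < (2 : ℝ) ^ k := by positivity
  have : 0 < ⌈(2 : ℝ) ^ k * t⌉ := Int.ceil_pos.2 (by positivity)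
  have h2 : (1 : ℝ) ≤ ⌈(2 : ℝ) ^ k * t⌉ := by exact_mod_cast this
  unfold lo
  have : (0 : ℝ) ≤ (⌈(2 : ℝ) ^ k * t⌉ : ℝ) - 1 := by linarith
  positivity

/-- The endpoints of dyadic intervals of level at most `m` are multiples of `2^{-m}`, so an
inequality between them that holds up to an error less than `2^{-m}` holds exactly. -/
lemma lo_le_hi_of_lt {j k m : ℤ} (hj : j ≤ m) (hk : k ≤ m) {s t : ℝ}
    (h : lo j s < hi k t + (2 : ℝ) ^ (-m)) : lo j s ≤ hi k t := by
  obtain ⟨a, ha⟩ := two_zpow_sub hj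
  obtain ⟨b, hb⟩ := two_zpow_sub hk
  have h4 : (2 : ℝ) ^ (-j) = (2 : ℝ) ^ (-m) * ((2 ^ a : ℤ) : ℝ) := by
    rw [zpow_neg, zpow_neg, ha]; field_simp
  have h5 : (2 : ℝ) ^ (-k) = (2 : ℝ) ^ (-m) * ((2 ^ b : ℤ) : ℝ) := by
    rw [zpow_neg, zpow_neg, hb]; field_simp
  have hm : (0 : ℝ) < (2 : ℝ) ^ (-m) := by positivity
  unfold lo hi at *
  rw [h4, h5, mul_assoc, mul_assoc] at h
  have h6 : ((2 ^ a : ℤ) : ℝ) * ((⌈(2 : ℝ) ^ j * s⌉ : ℝ) - 1)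
      < ((2 ^ b : ℤ) : ℝ) * (⌈(2 : ℝ) ^ k * t⌉ : ℝ) + 1 := by
    have : (2 : ℝ) ^ (-m) * (((2 ^ a : ℤ) : ℝ) * ((⌈(2 : ℝ) ^ j * s⌉ : ℝ) - 1)) <
      (2 : ℝ) ^ (-m) * (((2 ^ b : ℤ) : ℝ) * (⌈(2 : ℝ) ^ k * t⌉ : ℝ) + 1) := by linarith
    exact lt_of_mul_lt_mul_left this hm.le
  have h7 : (2 ^ a : ℤ) * (⌈(2 : ℝ) ^ j * s⌉ - 1) < (2 ^ b : ℤ) * ⌈(2 : ℝ) ^ k * t⌉ + 1 := by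
    exact_mod_cast h6
  have h8 : (2 ^ a : ℤ) * (⌈(2 : ℝ) ^ j * s⌉ - 1) ≤ (2 ^ b : ℤ) * ⌈(2 : ℝ) ^ k * t⌉ := by omega
  rw [h4, h5, mul_assoc, mul_assoc]
  refine mul_le_mul_of_nonneg_left ?_ hm.le
  exact_mod_cast h8

variable {n : ℕ}

/-- The dyadic cube of level `k` containing `x`. -/
noncomputable def cubeAt (k : ℤ) (x : E n) : DyadicCube n :=
  ⟨k, fun i => ⌈(2 : ℝ) ^ k * x i⌉ - 1⟩

@[simp] lemma cubeAt_level (k : ℤ) (x : E n) : (cubeAt k x).level = k := rfl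

@[simp] lemma cubeAt_len (k : ℤ) (x : E n) : (cubeAt k x).len = (2 : ℝ) ^ (-k) := rfl

lemma cubeAt_lo (k : ℤ) (x : E n) (i : Fin n) :
    (cubeAt k x).len * (cubeAt k x).pos i = lo k (x i) := by
  simp [cubeAt, lo, DyadicCube.len]

lemma cubeAt_hi (k : ℤ) (x : E n) (i : Fin n) :
    (cubeAt k x).len * ((cubeAt k x).pos i + 1) = hi k (x i) := by
  simp [cubeAt, hi, DyadicCube.len]

namespace DyadicCube

lemma len_pos (Q : DyadicCube n) : 0 < Q.len := by unfold len; positivity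

lemma mem_toSet {Q : DyadicCube n} {x : E n} :
    x ∈ Q.toSet ↔ ∀ i, x i ∈ Set.Ioc (Q.len * Q.pos i) (Q.len * (Q.pos i + 1)) := Iff.rfl

/-- A point lies in `Q` exactly when `Q` is the cube of its level containing the point. -/
lemma mem_toSet_iff {Q : DyadicCube n} {x : E n} : x ∈ Q.toSet ↔ cubeAt Q.level x = Q := by
  constructor
  · intro h
    ext i
    · rfl
    · have hp : (0 : ℝ) < (2 : ℝ) ^ Q.level := by positivity
      have h1 := (h i).1
      have h2 := (h i).2
      have e : (2 : ℝ) ^ Q.level * Q.len = 1 := by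
        unfold len; rw [← zpow_add₀ two_ne_zero]; simp
      have h3 := mul_lt_mul_of_pos_left h1 hp
      have h4 := mul_le_mul_of_nonneg_left h2 hp.le
      rw [← mul_assoc, e, one_mul] at h3 h4
      have : ⌈(2 : ℝ) ^ Q.level * x i⌉ = Q.pos i + 1 := by
        rw [Int.ceil_eq_iff]; push_cast; exact ⟨by linarith, h4⟩
      simp [cubeAt, this]
  · intro h i
    rw [← h, cubeAt_lo, cubeAt_hi]
    exact ⟨lo_lt _ _, le_hi _ _⟩

lemma measurableSet_toSet (Q : DyadicCube n) : MeasurableSet Q.toSet := by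
  have : Q.toSet = ⋂ i, (fun x : E n => x i) ⁻¹'
      Set.Ioc (Q.len * Q.pos i) (Q.len * (Q.pos i + 1)) := by
    ext x; simp [mem_toSet]
  rw [this]
  exact MeasurableSet.iInter fun i => measurableSet_Ioc.preimage (by fun_prop)

lemma closure_toSet (Q : DyadicCube n) :
    closure Q.toSet = {x | ∀ i, x i ∈ Set.Icc (Q.len * Q.pos i) (Q.len * (Q.pos i + 1))} := by
  have h1 : Q.toSet = (EuclideanSpace.equiv (Fin n) ℝ).toHomeomorph ⁻¹'
      (Set.univ.pi fun i => Set.Ioc (Q.len * Q.pos i) (Q.len * (Q.pos i + 1))) := by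
    ext x; simp [mem_toSet]
  rw [h1, ← Homeomorph.preimage_closure, closure_pi_set]
  ext x
  have : ∀ i, closure (Set.Ioc (Q.len * Q.pos i) (Q.len * (Q.pos i + 1))) =
      Set.Icc (Q.len * Q.pos i) (Q.len * (Q.pos i + 1)) := fun i =>
    closure_Ioc (by have := Q.len_pos; nlinarith)
  simp only [this, Set.mem_preimage, Set.mem_univ_pi, Set.mem_ofPred_eq]
  exact Iff.rfl

/-- The upper corner of a cube, which belongs to it. -/
noncomputable def corner (Q : DyadicCube n) : E n :=
  WithLp.toLp 2 fun i => Q.len * (Q.pos i + 1)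

lemma corner_mem (Q : DyadicCube n) : Q.corner ∈ Q.toSet := by
  intro i
  have := Q.len_pos
  simp only [corner]
  exact ⟨by nlinarith, le_rfl⟩

lemma cubeAt_corner (Q : DyadicCube n) : cubeAt Q.level Q.corner = Q :=
  mem_toSet_iff.1 Q.corner_mem

/-- Neighborhood in terms of levels and of the coordinate intervals. -/
lemma neighbor_iff {Q Q' : DyadicCube n} :
    Q.Neighbor Q' ↔ (Q.level ≤ Q'.level + 1 ∧ Q'.level ≤ Q.level + 1) ∧
      ∀ i, Q.len * Q.pos i ≤ Q'.len * (Q'.pos i + 1) ∧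
        Q'.len * Q'.pos i ≤ Q.len * (Q.pos i + 1) := by
  have e : Q.len / Q'.len = (2 : ℝ) ^ (Q'.level - Q.level) := by
    unfold len; rw [← zpow_sub₀ two_ne_zero]; congr 1; ring
  have h1 : 1 / 2 ≤ Q.len / Q'.len ↔ Q.level ≤ Q'.level + 1 := by
    rw [e, show (1 / 2 : ℝ) = (2 : ℝ) ^ (-1 : ℤ) by norm_num,
      zpow_le_zpow_iff_right₀ one_lt_two]
    omega
  have h2 : Q.len / Q'.len ≤ 2 ↔ Q'.level ≤ Q.level + 1 := by
    rw [e]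
    nth_rewrite 2 [show (2 : ℝ) = (2 : ℝ) ^ (1 : ℤ) by norm_num]
    rw [zpow_le_zpow_iff_right₀ one_lt_two]
    omega
  unfold Neighbor
  rw [h1, h2, and_assoc]
  refine and_congr_right fun _ => and_congr_right fun _ => ?_
  rw [closure_toSet, closure_toSet]
  have hQ := Q.len_pos
  have hQ' := Q'.len_pos
  constructor
  · rintro ⟨x, hx, hx'⟩ i
    have a := hx i
    have b := hx' i
    exact ⟨a.1.trans b.2, b.1.trans a.2⟩
  · intro h
    refine ⟨WithLp.toLp 2 fun i => max (Q.len * Q.pos i) (Q'.len * Q'.pos i), ?_, ?_⟩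
    · intro i
      exact ⟨le_max_left _ _, max_le (by nlinarith) (h i).2⟩
    · intro i
      exact ⟨le_max_right _ _, max_le (h i).1 (by nlinarith)⟩

lemma Neighbor.symm {Q Q' : DyadicCube n} (h : Q.Neighbor Q') : Q'.Neighbor Q := by
  rw [neighbor_iff] at *
  exact ⟨⟨h.1.2, h.1.1⟩, fun i => ⟨(h.2 i).2, (h.2 i).1⟩⟩

lemma Neighbor.refl (Q : DyadicCube n) : Q.Neighbor Q := by
  rw [neighbor_iff]
  have := Q.len_pos
  exact ⟨⟨by omega, by omega⟩, fun i => ⟨by nlinarith, by nlinarith⟩⟩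

instance : Countable (DyadicCube n) := by
  have : Function.Injective fun Q : DyadicCube n => (Q.level, Q.pos) := by
    intro Q Q' h
    simp only [Prod.mk.injEq] at h
    exact DyadicCube.ext h.1 h.2
  exact this.countable

instance : MeasurableSpace (DyadicCube n) := ⊤

instance : DiscreteMeasurableSpace (DyadicCube n) := ⟨fun _ => trivial⟩

lemma volume_toSet (Q : DyadicCube n) : volume Q.toSet = ENNReal.ofReal Q.len ^ n := by
  have h1 : Q.toSet = WithLp.ofLp ⁻¹'
      (Set.univ.pi fun i => Set.Ioc (Q.len * Q.pos i) (Q.len * (Q.pos i + 1))) := by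
    ext x; simp [mem_toSet]
  rw [h1, (PiLp.volume_preserving_ofLp (Fin n)).measure_preimage
    (MeasurableSet.univ_pi fun i => measurableSet_Ioc).nullMeasurableSet, volume_pi_pi]
  have : ∀ i, Q.len * ((Q.pos i : ℝ) + 1) - Q.len * Q.pos i = Q.len := fun i => by ring
  simp [Real.volume_Ioc, this]

end DyadicCube

open DyadicCube

lemma mem_cubeAt (k : ℤ) (x : E n) : x ∈ (cubeAt k x).toSet := mem_toSet_iff.2 rfl

lemma mem_cubeAt_iff {k : ℤ} {x y : E n} : y ∈ (cubeAt k x).toSet ↔ cubeAt k y = cubeAt k x :=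
  mem_toSet_iff

lemma measurable_cubeAt (k : ℤ) : Measurable (cubeAt k : E n → DyadicCube n) := by
  refine measurable_to_countable' fun Q => ?_
  by_cases h : Q.level = k
  · subst h
    convert Q.measurableSet_toSet using 1
    ext x
    simp [mem_toSet_iff]
  · convert MeasurableSet.empty
    ext x
    simp only [Set.mem_preimage, Set.mem_singleton_iff, Set.mem_empty_iff_false, iff_false]
    rintro rfl
    exact h rfl

/-- Coarser cubes are determined by finer ones. -/
lemma cubeAt_eq_of_le {j k : ℤ} (h : j ≤ k) {x y : E n} (hxy : cubeAt k y = cubeAt k x) :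
    cubeAt j y = cubeAt j x := by
  rw [← mem_cubeAt_iff] at *
  intro i
  have := hxy i
  rw [cubeAt_lo, cubeAt_hi] at *
  exact ⟨(lo_mono h _).trans_lt this.1, this.2.trans (hi_anti h _)⟩

lemma cubeAt_subset_of_le {j k : ℤ} (h : j ≤ k) (x : E n) :
    (cubeAt k x).toSet ⊆ (cubeAt j x).toSet := fun y hy => by
  rw [mem_cubeAt_iff] at *
  exact cubeAt_eq_of_le h hy

lemma neighbor_cubeAt_iff {j k : ℤ} {x y : E n} :
    (cubeAt j x).Neighbor (cubeAt k y) ↔ (j ≤ k + 1 ∧ k ≤ j + 1) ∧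
      ∀ i, lo j (x i) ≤ hi k (y i) ∧ lo k (y i) ≤ hi j (x i) := by
  rw [neighbor_iff]
  simp only [cubeAt_lo, cubeAt_hi, cubeAt_level]

lemma neighbor_cubeAt_self {j k : ℤ} (h1 : j ≤ k + 1) (h2 : k ≤ j + 1) (x : E n) :
    (cubeAt j x).Neighbor (cubeAt k x) :=
  neighbor_cubeAt_iff.2 ⟨⟨h1, h2⟩, fun _ =>
    ⟨(lo_lt _ _).le.trans (le_hi _ _), (lo_lt _ _).le.trans (le_hi _ _)⟩⟩

/-- Ancestors of neighboring cubes are neighbors if their levels differ at most by one. -/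
lemma neighbor_ancestor {j j' k k' : ℤ} {x y : E n} (h : (cubeAt k x).Neighbor (cubeAt k' y))
    (hj : j ≤ k) (hj' : j' ≤ k') (h1 : j ≤ j' + 1) (h2 : j' ≤ j + 1) :
    (cubeAt j x).Neighbor (cubeAt j' y) := by
  rw [neighbor_cubeAt_iff] at *
  exact ⟨⟨h1, h2⟩, fun i =>
    ⟨((lo_mono hj _).trans (h.2 i).1).trans (hi_anti hj' _),
      ((lo_mono hj' _).trans (h.2 i).2).trans (hi_anti hj _)⟩⟩

/-- Points of neighboring cubes are close to each other. -/
lemma abs_sub_le_of_neighbor {k k' : ℤ} {x y : E n} (h : (cubeAt k x).Neighbor (cubeAt k' y))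
    (i : Fin n) : |x i - y i| ≤ 3 * (2 : ℝ) ^ (-k) := by
  rw [neighbor_cubeAt_iff] at h
  have h1 := (h.2 i).1
  have h2 := (h.2 i).2
  have h3 : (2 : ℝ) ^ (-k') ≤ 2 * (2 : ℝ) ^ (-k) := by
    have : (2 : ℝ) ^ (1 - k) = 2 * (2 : ℝ) ^ (-k) := by
      rw [sub_eq_add_neg, zpow_add₀ two_ne_zero]; simp
    rw [← this]
    exact zpow_le_zpow_right₀ one_le_two (by omega)
  have a1 := lo_lt k (x i)
  have a2 := le_hi k (x i)
  have b1 := lo_lt k' (y i)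
  have b2 := le_hi k' (y i)
  rw [hi_eq] at h1 h2 a2 b2
  rw [abs_le]
  constructor <;> linarith

/-- A bound for the number of neighbors of a dyadic cube of `ℝⁿ`: there are three possible levels,
and on each of them at most seven possible positions for every coordinate. -/
def nbrCount (n : ℕ) : ℕ := 3 * 7 ^ n

lemma exists_finset_neighbor (Q : DyadicCube n) :
    ∃ s : Finset (DyadicCube n), s.card ≤ nbrCount n ∧ ∀ Q', Q.Neighbor Q' → Q' ∈ s := by
  classical
  let b : ℤ → Fin n → ℤ := fun l i => ⌊(2 : ℝ) ^ (l - Q.level) * Q.pos i⌋ - 2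
  let F : ℤ × (Fin n → ℤ) → DyadicCube n := fun a =>
    ⟨Q.level + a.1, fun i => b (Q.level + a.1) i + a.2 i⟩
  refine ⟨(Finset.Icc (-1 : ℤ) 1 ×ˢ
    Fintype.piFinset fun _ : Fin n => Finset.Ico (0 : ℤ) 7).image F, ?_, ?_⟩
  · refine Finset.card_image_le.trans ?_
    rw [Finset.card_product]
    simp [nbrCount]
  · intro Q' h
    rw [neighbor_iff] at h
    rw [Finset.mem_image]
    refine ⟨(Q'.level - Q.level, fun i => Q'.pos i - b Q'.level i), ?_, ?_⟩
    · simp only [Finset.mem_product, Finset.mem_Icc, Fintype.mem_piFinset, Finset.mem_Ico]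
      refine ⟨by omega, fun i => ?_⟩
      have hl : Q.len = (2 : ℝ) ^ (Q'.level - Q.level) * Q'.len := by
        unfold len; rw [← zpow_add₀ two_ne_zero]; congr 1; ring
      have h1 := (h.2 i).1
      have h2 := (h.2 i).2
      rw [hl] at h1 h2
      have hp := Q'.len_pos
      have hr : (2 : ℝ) ^ (Q'.level - Q.level) ≤ 2 := by
        calc (2 : ℝ) ^ (Q'.level - Q.level) ≤ (2 : ℝ) ^ (1 : ℤ) :=
              zpow_le_zpow_right₀ one_le_two (by omega)
          _ = 2 := by norm_num
      set r := (2 : ℝ) ^ (Q'.level - Q.level) with hrdef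
      have h1' : r * Q.pos i ≤ Q'.pos i + 1 := by
        refine le_of_mul_le_mul_left ?_ hp
        calc Q'.len * (r * Q.pos i) = r * Q'.len * Q.pos i := by ring
          _ ≤ _ := h1
      have h2' : (Q'.pos i : ℝ) ≤ r * Q.pos i + 2 := by
        refine le_of_mul_le_mul_left ?_ hp
        calc Q'.len * (Q'.pos i : ℝ) ≤ r * Q'.len * (Q.pos i + 1) := h2
          _ = Q'.len * (r * Q.pos i) + Q'.len * r := by ring
          _ ≤ Q'.len * (r * Q.pos i) + Q'.len * 2 := by gcongr
          _ = _ := by ring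
      have f1 := Int.floor_le (r * Q.pos i)
      have f2 := Int.lt_floor_add_one (r * Q.pos i)
      have g1 : ⌊r * (Q.pos i : ℝ)⌋ ≤ Q'.pos i + 1 := by
        have : ((⌊r * (Q.pos i : ℝ)⌋ : ℤ) : ℝ) ≤ ((Q'.pos i + 1 : ℤ) : ℝ) := by push_cast; linarith
        exact_mod_cast this
      have g2 : Q'.pos i < ⌊r * (Q.pos i : ℝ)⌋ + 3 := by
        have : (Q'.pos i : ℝ) < ((⌊r * (Q.pos i : ℝ)⌋ + 3 : ℤ) : ℝ) := by push_cast; linarith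
        exact_mod_cast this
      simp only [b, ← hrdef]
      constructor <;> omega
    · ext i
      · simp [F]
      · simp [F]

/-- A sum over cubes of terms bounded by `M` and vanishing away from the neighbors of one cube. -/
lemma tsum_neighbor_le {ι : Type*} (f : ι → DyadicCube n) (hf : Function.Injective f)
    (Q : DyadicCube n) (g : ι → ℝ≥0∞) (M : ℝ≥0∞) (hM : ∀ i, g i ≤ M)
    (h0 : ∀ i, g i ≠ 0 → Q.Neighbor (f i)) : ∑' i, g i ≤ nbrCount n * M := by
  classical
  obtain ⟨s, hs, hs'⟩ := exists_finset_neighbor Q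
  have h1 : ∑' i, g i ≤ ∑' R : DyadicCube n, if R ∈ s then M else 0 := by
    refine (ENNReal.tsum_le_tsum fun i => ?_).trans (ENNReal.tsum_comp_le_tsum_of_injective hf _)
    by_cases h : g i = 0
    · simp [h]
    · simp [hs' _ (h0 i h), hM i]
  refine h1.trans ?_
  rw [tsum_eq_sum (s := s) (fun R hR => by simp [hR])]
  rw [Finset.sum_congr rfl (fun R hR => if_pos hR), Finset.sum_const, nsmul_eq_mul]
  gcongr

end

section
/-! ### Lebesgue norms of extended nonnegative functions -/

section Lp

variable {α : Type*} [MeasurableSpace α] {μ : Measure α} {p : ℝ≥0∞}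

lemma toReal_one_le (hp : 1 ≤ p) (hp' : p ≠ ∞) : 1 ≤ p.toReal := by
  rw [← ENNReal.toReal_one]; exact ENNReal.toReal_mono hp' hp

lemma ae_le_eLpNorm_top (g : α → ℝ≥0∞) : ∀ᵐ x ∂μ, g x ≤ eLpNorm g ∞ μ := by
  simpa using ae_le_eLpNormEssSup (f := g) (μ := μ)

lemma eLpNorm_top_le {g : α → ℝ≥0∞} {M : ℝ≥0∞} (h : ∀ᵐ x ∂μ, g x ≤ M) : eLpNorm g ∞ μ ≤ M := by
  rw [eLpNorm_exponent_top]
  exact essSup_le_of_ae_le _ (by filter_upwards [h] with x hx using by simpa using hx)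

lemma eLpNorm_eq_lintegral {g : α → ℝ≥0∞} (hp : 1 ≤ p) (hp' : p ≠ ∞) :
    eLpNorm g p μ = (∫⁻ x, g x ^ p.toReal ∂μ) ^ (1 / p.toReal) := by
  simpa using eLpNorm_eq_lintegral_rpow_enorm_toReal (f := g) (μ := μ)
    (zero_lt_one.trans_le hp).ne' hp'

/-- Minkowski's inequality for a series of nonnegative functions. -/
lemma eLpNorm_tsum_le {g : ℕ → α → ℝ≥0∞} (hg : ∀ i, AEMeasurable (g i) μ) (hp : 1 ≤ p) :
    eLpNorm (fun x => ∑' i, g i x) p μ ≤ ∑' i, eLpNorm (g i) p μ := by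
  by_cases hp' : p = ∞
  · subst hp'
    refine eLpNorm_top_le ?_
    have : ∀ᵐ x ∂μ, ∀ i, g i x ≤ eLpNorm (g i) ∞ μ := ae_all_iff.2 fun i => ae_le_eLpNorm_top _
    filter_upwards [this] with x hx
    exact ENNReal.tsum_le_tsum hx
  · have hq := toReal_one_le hp hp'
    have hq0 : 0 < p.toReal := by linarith
    rw [eLpNorm_eq_lintegral hp hp', one_div, ENNReal.rpow_inv_le_iff hq0]
    have h1 : ∀ x, (∑' i, g i x) ^ p.toReal =
        ⨆ N : ℕ, (∑ i ∈ Finset.range N, g i x) ^ p.toReal := by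
      intro x
      rw [ENNReal.tsum_eq_iSup_nat]
      exact (ENNReal.orderIsoRpow p.toReal hq0).map_iSup _
    simp_rw [h1]
    rw [lintegral_iSup']
    · refine iSup_le fun N => ?_
      rw [← ENNReal.rpow_inv_le_iff hq0, ← one_div, ← eLpNorm_eq_lintegral hp hp']
      have h2 := eLpNorm_sum_le (s := Finset.range N) (f := g) (μ := μ) (p := p)
        (fun i _ => (hg i).aestronglyMeasurable) hp
      have h3 : (fun x => ∑ i ∈ Finset.range N, g i x) = ∑ i ∈ Finset.range N, g i := by
        ext x; simp
      rw [h3]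
      exact h2.trans (ENNReal.sum_le_tsum _)
    · exact fun N => (Finset.aemeasurable_fun_sum _ fun i _ => hg i).pow_const _
    · refine Eventually.of_forall fun x => fun a b hab => ?_
      dsimp only
      gcongr

lemma eLpNorm_const_mul_le (c : ℝ≥0) (g : α → ℝ≥0∞) (hp : 1 ≤ p) :
    eLpNorm (fun x => (c : ℝ≥0∞) * g x) p μ ≤ c * eLpNorm g p μ := by
  by_cases hp' : p = ∞
  · subst hp'
    refine eLpNorm_top_le ?_
    filter_upwards [ae_le_eLpNorm_top (μ := μ) g] with x hx
    gcongr
  · have hq := toReal_one_le hp hp'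
    have hq0 : 0 < p.toReal := by linarith
    rw [eLpNorm_eq_lintegral hp hp', eLpNorm_eq_lintegral hp hp']
    simp_rw [ENNReal.mul_rpow_of_nonneg _ _ hq0.le]
    rw [lintegral_const_mul' _ _ (by finiteness), ENNReal.mul_rpow_of_nonneg _ _ (by positivity),
      ← ENNReal.rpow_mul, mul_one_div_cancel hq0.ne', ENNReal.rpow_one]

lemma eLpNorm_mono_ennreal {g h : α → ℝ≥0∞} (H : ∀ x, g x ≤ h x) :
    eLpNorm g p μ ≤ eLpNorm h p μ := eLpNorm_mono_enorm (by simpa using H)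

lemma eLpNorm_add_le_ennreal {g h : α → ℝ≥0∞} (hg : AEMeasurable g μ) (hh : AEMeasurable h μ)
    (hp : 1 ≤ p) : eLpNorm (fun x => g x + h x) p μ ≤ eLpNorm g p μ + eLpNorm h p μ :=
  eLpNorm_add_le hg.aestronglyMeasurable hh.aestronglyMeasurable hp

lemma ae_lt_top_of_eLpNorm_ne_top {g : α → ℝ≥0∞} (hg : AEMeasurable g μ) (hp : 1 ≤ p)
    (h : eLpNorm g p μ ≠ ∞) : ∀ᵐ x ∂μ, g x < ∞ := by
  by_cases hp' : p = ∞
  · subst hp'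
    filter_upwards [ae_le_eLpNorm_top (μ := μ) g] with x hx
    exact hx.trans_lt h.lt_top
  · have hq := toReal_one_le hp hp'
    have hq0 : 0 < p.toReal := by linarith
    rw [eLpNorm_eq_lintegral hp hp'] at h
    have h2 : ∫⁻ x, g x ^ p.toReal ∂μ ≠ ∞ := by
      intro h3; rw [h3, ENNReal.top_rpow_of_pos (by positivity)] at h; exact h rfl
    filter_upwards [ae_lt_top' (hg.pow_const _) h2] with x hx
    by_contra h4
    rw [not_lt, top_le_iff] at h4
    rw [h4, ENNReal.top_rpow_of_pos hq0] at hx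
    exact hx.ne rfl

/-- Nonnegative functions with summable norms tend to zero almost everywhere. -/
lemma ae_tendsto_zero_of_tsum_eLpNorm {g : ℕ → α → ℝ≥0∞} (hg : ∀ i, AEMeasurable (g i) μ)
    (hp : 1 ≤ p) (h : ∑' i, eLpNorm (g i) p μ ≠ ∞) :
    ∀ᵐ x ∂μ, Tendsto (fun i => g i x) atTop (𝓝 0) := by
  have h1 := ae_lt_top_of_eLpNorm_ne_top (AEMeasurable.tsum hg) hp
    (ne_top_of_le_ne_top h (eLpNorm_tsum_le hg hp))
  filter_upwards [h1] with x hx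
  exact ENNReal.tendsto_atTop_zero_of_tsum_ne_top hx.ne

/-- Jensen's inequality for averages. -/
lemma measure_mul_laverage_rpow_le {r : ℝ} (hr : 1 ≤ r) {P : Set α} (h0 : μ P ≠ 0)
    (h1 : μ P ≠ ∞) {h : α → ℝ≥0∞} (hh : AEMeasurable h (μ.restrict P)) :
    μ P * (⨍⁻ x in P, h x ∂μ) ^ r ≤ ∫⁻ x in P, h x ^ r ∂μ := by
  have hr0 : 0 < r := by linarith
  have hp : (1 : ℝ≥0∞) ≤ ENNReal.ofReal r := by simpa using hr
  have h2 := eLpNorm_le_eLpNorm_mul_rpow_measure_univ (p := 1) (q := ENNReal.ofReal r) hp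
    hh.aestronglyMeasurable
  rw [eLpNorm_eq_lintegral le_rfl (by simp), eLpNorm_eq_lintegral hp (by simp)] at h2
  simp only [ENNReal.toReal_one, ENNReal.toReal_ofReal hr0.le, ENNReal.rpow_one,
    Measure.restrict_apply MeasurableSet.univ, Set.univ_inter, div_one] at h2
  rw [setLAverage_eq]
  have h3 := ENNReal.rpow_le_rpow h2 hr0.le
  rw [ENNReal.mul_rpow_of_nonneg _ _ hr0.le, ← ENNReal.rpow_mul, ← ENNReal.rpow_mul,
    one_div_mul_cancel hr0.ne', ENNReal.rpow_one] at h3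
  rw [ENNReal.div_rpow_of_nonneg _ _ hr0.le]
  have h4 : (1 - 1 / r) * r = r - 1 := by field_simp
  rw [h4] at h3
  have h5 : μ P ^ r ≠ 0 := by simp [h0, h1]
  have h6 : μ P ^ r ≠ ∞ := by simp [h0, h1]
  rw [← ENNReal.mul_comm_div, mul_comm]
  calc (∫⁻ a in P, h a ∂μ) ^ r * (μ P / μ P ^ r)
      ≤ ((∫⁻ x in P, h x ^ r ∂μ) * μ P ^ (r - 1)) * (μ P / μ P ^ r) := by gcongr
    _ = (∫⁻ x in P, h x ^ r ∂μ) * (μ P ^ (r - 1) * (μ P / μ P ^ r)) := by ring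
    _ = ∫⁻ x in P, h x ^ r ∂μ := by
      rw [ENNReal.rpow_sub _ _ h0 h1, ENNReal.rpow_one]
      have : μ P ^ r / μ P * (μ P / μ P ^ r) = 1 := by
        calc μ P ^ r / μ P * (μ P / μ P ^ r)
            = (μ P ^ r * (μ P ^ r)⁻¹) * (μ P * (μ P)⁻¹) := by
              rw [div_eq_mul_inv, div_eq_mul_inv]; ring
          _ = 1 := by rw [ENNReal.mul_inv_cancel h5 h6, ENNReal.mul_inv_cancel h0 h1, one_mul]
      rw [this, mul_one]

variable {F : Type*} [NormedAddCommGroup F] [NormedSpace ℝ F] [CompleteSpace F]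

lemma enorm_setAverage_sub {P : Set α} (h0 : μ P ≠ 0) (h1 : μ P ≠ ∞) {g : α → F}
    (hg : IntegrableOn g P μ) (c : F) :
    ‖(⨍ x in P, g x ∂μ) - c‖ₑ = (μ P)⁻¹ * ‖∫ x in P, (g x - c) ∂μ‖ₑ := by
  have hc : IntegrableOn (fun _ => c) P μ := integrableOn_const h1
  have h2 : (⨍ x in P, g x ∂μ) - c = ⨍ x in P, (g x - c) ∂μ := by
    conv_lhs => rw [← setAverage_const h0 h1 c]
    rw [setAverage_eq, setAverage_eq, setAverage_eq, ← smul_sub, integral_sub hg hc]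
  rw [h2, setAverage_eq, enorm_smul]
  congr 1
  rw [Real.enorm_eq_ofReal (by positivity), Measure.real, ENNReal.ofReal_inv_of_pos
    (ENNReal.toReal_pos h0 h1), ENNReal.ofReal_toReal h1]

lemma enorm_setAverage_sub_le {P : Set α} (h0 : μ P ≠ 0) (h1 : μ P ≠ ∞) {g : α → F}
    (hg : IntegrableOn g P μ) (c : F) :
    ‖(⨍ x in P, g x ∂μ) - c‖ₑ ≤ ⨍⁻ x in P, ‖g x - c‖ₑ ∂μ := by
  rw [enorm_setAverage_sub h0 h1 hg, setLAverage_eq, ENNReal.div_eq_inv_mul]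
  gcongr
  exact enorm_integral_le_lintegral_enorm _

lemma enorm_setAverage_sub_le_of_forall {P : Set α} (hP : MeasurableSet P) (h0 : μ P ≠ 0)
    (h1 : μ P ≠ ∞) {g : α → F} (hg : IntegrableOn g P μ) {c : F} {M : ℝ≥0∞}
    (hM : ∀ x ∈ P, ‖g x - c‖ₑ ≤ M) : ‖(⨍ x in P, g x ∂μ) - c‖ₑ ≤ M := by
  refine (enorm_setAverage_sub_le h0 h1 hg c).trans ?_
  rw [setLAverage_eq]
  refine ENNReal.div_le_of_le_mul ?_
  exact (setLIntegral_mono' hP hM).trans (by simp)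

end Lp

/-! ### Oscillation and averages over neighboring cubes -/

variable {n : ℕ}

/-- The properties of `(Ω, μ)` on which the dyadic estimates rest: `Ω` is a union of dyadic cubes of
each level, the cubes have positive and finite measure, and the union of the cubes of a given level
that are neighbors of a cube has measure comparable to that of the cube. -/
structure DyadicDoubling (Ω : Set (E n)) (μ : Measure (E n)) (C : ℝ≥0) : Prop where
  measurableSet : MeasurableSet Ω
  cube_subset : ∀ x ∈ Ω, ∀ k, (cubeAt k x).toSet ⊆ Ω
  measure_ne_zero : ∀ Q : DyadicCube n, Q.toSet ⊆ Ω → μ Q.toSet ≠ 0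
  measure_ne_top : ∀ Q : DyadicCube n, μ Q.toSet ≠ ∞
  doubling : ∀ (k : ℤ) (P : DyadicCube n), P.toSet ⊆ Ω →
    μ (Ω ∩ {x | (cubeAt k x).Neighbor P}) ≤ C * μ P.toSet

/-- The oscillation of `u` at the cube `Q`: the largest difference between the averages over `Q`
and over a neighbor of `Q` in `Ω`. -/
noncomputable def osc (Ω : Set (E n)) (μ : Measure (E n)) (u : E n → ℂ) (Q : DyadicCube n) :
    ℝ≥0∞ :=
  ⨆ Q' : {Q' : DyadicCube n // Q.Neighbor Q' ∧ Q'.toSet ⊆ Ω},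
    ‖(⨍ x in Q.toSet, u x ∂μ) - ⨍ x in Q'.1.toSet, u x ∂μ‖ₑ

/-- The largest average of `h` over a neighbor of `Q` in `Ω`. -/
noncomputable def nbrSup (Ω : Set (E n)) (μ : Measure (E n)) (h : E n → ℝ≥0∞)
    (Q : DyadicCube n) : ℝ≥0∞ :=
  ⨆ Q' : {Q' : DyadicCube n // Q.Neighbor Q' ∧ Q'.toSet ⊆ Ω}, ⨍⁻ x in Q'.1.toSet, h x ∂μ

lemma le_osc {Ω : Set (E n)} {μ : Measure (E n)} {u : E n → ℂ} {Q Q' : DyadicCube n}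
    (h : Q.Neighbor Q') (h' : Q'.toSet ⊆ Ω) :
    ‖(⨍ x in Q.toSet, u x ∂μ) - ⨍ x in Q'.toSet, u x ∂μ‖ₑ ≤ osc Ω μ u Q :=
  le_iSup (fun Q' : {Q' : DyadicCube n // Q.Neighbor Q' ∧ Q'.toSet ⊆ Ω} =>
    ‖(⨍ x in Q.toSet, u x ∂μ) - ⨍ x in Q'.1.toSet, u x ∂μ‖ₑ) ⟨Q', h, h'⟩

lemma le_nbrSup {Ω : Set (E n)} {μ : Measure (E n)} {h : E n → ℝ≥0∞} {Q Q' : DyadicCube n}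
    (hQ : Q.Neighbor Q') (h' : Q'.toSet ⊆ Ω) :
    ⨍⁻ x in Q'.toSet, h x ∂μ ≤ nbrSup Ω μ h Q :=
  le_iSup (fun Q' : {Q' : DyadicCube n // Q.Neighbor Q' ∧ Q'.toSet ⊆ Ω} =>
    ⨍⁻ x in Q'.1.toSet, h x ∂μ) ⟨Q', hQ, h'⟩

lemma measurable_comp_cubeAt {β : Type*} [MeasurableSpace β] (φ : DyadicCube n → β) (k : ℤ) :
    Measurable fun x : E n => φ (cubeAt k x) :=
  (Measurable.of_discrete (f := φ)).comp (measurable_cubeAt k)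

/-- Decomposition of the integral over `Ω` into the integrals over the cubes of level `k`. -/
lemma lintegral_eq_tsum_cubes {Ω : Set (E n)} {μ : Measure (E n)}
    (hΩ : ∀ x ∈ Ω, ∀ k, (cubeAt k x).toSet ⊆ Ω) (k : ℤ) (h : E n → ℝ≥0∞) :
    ∫⁻ x in Ω, h x ∂μ =
      ∑' Q : {Q : DyadicCube n // Q.level = k ∧ Q.toSet ⊆ Ω}, ∫⁻ x in Q.1.toSet, h x ∂μ := by
  rw [← lintegral_iUnion (fun Q => Q.1.measurableSet_toSet)]
  · congr 2
    refine Set.Subset.antisymm (fun x hx => ?_) (Set.iUnion_subset fun Q => Q.2.2)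
    exact Set.mem_iUnion.2 ⟨⟨cubeAt k x, rfl, hΩ x hx k⟩, mem_cubeAt k x⟩
  · rintro ⟨Q, hQ, _⟩ ⟨Q', hQ', _⟩ hne
    refine Set.disjoint_left.2 fun x hx hx' => hne ?_
    rw [DyadicCube.mem_toSet_iff] at hx hx'
    rw [Subtype.mk.injEq]
    dsimp only at hx hx'
    rw [← hx, ← hx', hQ, hQ']

lemma nbrCount_pos (n : ℕ) : 1 ≤ nbrCount n := by
  unfold nbrCount; have := Nat.one_le_pow n 7 (by norm_num); omega

lemma rpow_one_div_le_self {c : ℝ≥0∞} (hc : 1 ≤ c) {r : ℝ} (hr : 1 ≤ r) : c ^ (1 / r) ≤ c := by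
  conv_rhs => rw [← ENNReal.rpow_one c]
  exact ENNReal.rpow_le_rpow_of_exponent_le hc (by rw [div_le_one (by linarith)]; exact hr)

/-- The level energy is controlled by the `L^p` norm of any majorant of the differences. -/
lemma levelEnergy_le {Ω : Set (E n)} {μ : Measure (E n)} {C : ℝ≥0} (hD : DyadicDoubling Ω μ C)
    {p : ℝ≥0∞} (hp : 1 ≤ p) {u : E n → ℂ} {k : ℕ} {g : E n → ℝ≥0∞}
    (hg : ∀ x ∈ Ω, ∀ Q' : DyadicCube n, (cubeAt k x).Neighbor Q' → Q'.toSet ⊆ Ω →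
      ‖(⨍ y in (cubeAt k x).toSet, u y ∂μ) - ⨍ y in Q'.toSet, u y ∂μ‖ₑ ≤ g x) :
    levelEnergy Ω μ p u k ≤ nbrCount n * eLpNorm g p (μ.restrict Ω) := by
  have hg' : ∀ Q : DyadicCube n, Q.level = k → Q.toSet ⊆ Ω → ∀ x ∈ Q.toSet,
      ∀ Q' : DyadicCube n, Q.Neighbor Q' → Q'.toSet ⊆ Ω →
      ‖(⨍ y in Q.toSet, u y ∂μ) - ⨍ y in Q'.toSet, u y ∂μ‖ₑ ≤ g x := by
    intro Q hQ hQΩ x hx Q' h h'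
    have e := DyadicCube.mem_toSet_iff.1 hx
    rw [hQ] at e
    have := hg x (hQΩ hx) Q'
    rw [e] at this
    exact this h h'
  have hN : (1 : ℝ≥0∞) ≤ nbrCount n := by exact_mod_cast nbrCount_pos n
  unfold levelEnergy
  split_ifs with hp'
  · subst hp'
    refine iSup_le fun Q => iSup_le fun Q' => ?_
    have h1 : ∀ᵐ x ∂(μ.restrict Q.1.toSet), g x ≤ eLpNorm g ∞ (μ.restrict Ω) :=
      ae_mono (Measure.restrict_mono_set μ Q.2.2) (ae_le_eLpNorm_top g)
    have : (μ.restrict Q.1.toSet) ≠ 0 := by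
      rw [Ne, Measure.restrict_eq_zero]; exact hD.measure_ne_zero _ Q.2.2
    have : NeBot (ae (μ.restrict Q.1.toSet)) := ae_neBot.2 this
    obtain ⟨x, hx, hx'⟩ := (h1.and (ae_restrict_mem Q.1.measurableSet_toSet)).exists
    calc _ ≤ g x := hg' Q.1 Q.2.1 Q.2.2 x hx' Q'.1 Q'.2.1 Q'.2.2
      _ ≤ eLpNorm g ∞ (μ.restrict Ω) := hx
      _ ≤ _ := le_mul_of_one_le_left' hN
  · have hq := toReal_one_le hp hp'
    have hq0 : 0 < p.toReal := by linarith
    have key : (∑' Q : {Q : DyadicCube n // Q.level = (k : ℤ) ∧ Q.toSet ⊆ Ω},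
      μ Q.1.toSet * ∑' Q' : {Q' : DyadicCube n // Q.1.Neighbor Q' ∧ Q'.toSet ⊆ Ω},
        ‖(⨍ x in Q.1.toSet, u x ∂μ) - ⨍ x in Q'.1.toSet, u x ∂μ‖ₑ ^ p.toReal) ≤
        nbrCount n * ∫⁻ x in Ω, g x ^ p.toReal ∂μ := by
      rw [lintegral_eq_tsum_cubes hD.cube_subset k, ← ENNReal.tsum_mul_left]
      refine ENNReal.tsum_le_tsum fun Q => ?_
      have h1 : ∀ x ∈ Q.1.toSet,
          (∑' Q' : {Q' : DyadicCube n // Q.1.Neighbor Q' ∧ Q'.toSet ⊆ Ω},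
        ‖(⨍ x in Q.1.toSet, u x ∂μ) - ⨍ x in Q'.1.toSet, u x ∂μ‖ₑ ^ p.toReal) ≤
          nbrCount n * g x ^ p.toReal := by
        intro x hx
        refine tsum_neighbor_le (fun Q' : {Q' : DyadicCube n // Q.1.Neighbor Q' ∧ Q'.toSet ⊆ Ω} =>
          Q'.1) Subtype.val_injective Q.1 _ _ (fun Q' => ?_) (fun Q' _ => Q'.2.1)
        gcongr
        exact hg' Q.1 Q.2.1 Q.2.2 x hx Q'.1 Q'.2.1 Q'.2.2
      rw [← lintegral_const_mul' _ _ (by finiteness), mul_comm]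
      calc _ = ∫⁻ x in Q.1.toSet, _ ∂μ := (setLIntegral_const _ _).symm
        _ ≤ _ := setLIntegral_mono' Q.1.measurableSet_toSet h1
    calc _ ≤ (nbrCount n * ∫⁻ x in Ω, g x ^ p.toReal ∂μ) ^ (1 / p.toReal) := by gcongr
      _ = (nbrCount n : ℝ≥0∞) ^ (1 / p.toReal) * eLpNorm g p (μ.restrict Ω) := by
        rw [ENNReal.mul_rpow_of_nonneg _ _ (by positivity), eLpNorm_eq_lintegral hp hp']
      _ ≤ _ := by gcongr; exact rpow_one_div_le_self hN hq

lemma iSup_rpow_le_tsum {ι : Type*} (a : ι → ℝ≥0∞) {r : ℝ} (hr : 0 < r) :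
    (⨆ i, a i) ^ r ≤ ∑' i, a i ^ r := by
  rw [← ENNReal.le_rpow_inv_iff hr]
  refine iSup_le fun i => ?_
  rw [ENNReal.le_rpow_inv_iff hr]
  exact ENNReal.le_tsum i

/-- The level energy dominates the `L^p` norm of the oscillation. -/
lemma eLpNorm_osc_le {Ω : Set (E n)} {μ : Measure (E n)} {C : ℝ≥0} (hD : DyadicDoubling Ω μ C)
    {p : ℝ≥0∞} (hp : 1 ≤ p) (u : E n → ℂ) (k : ℕ) :
    eLpNorm (fun x => osc Ω μ u (cubeAt k x)) p (μ.restrict Ω) ≤ levelEnergy Ω μ p u k := by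
  unfold levelEnergy
  split_ifs with hp'
  · subst hp'
    refine eLpNorm_top_le ?_
    filter_upwards [ae_restrict_mem hD.measurableSet] with x hx
    exact le_iSup (fun Q : {Q : DyadicCube n // Q.level = (k : ℤ) ∧ Q.toSet ⊆ Ω} =>
      osc Ω μ u Q.1) ⟨cubeAt k x, rfl, hD.cube_subset x hx k⟩
  · have hq := toReal_one_le hp hp'
    have hq0 : 0 < p.toReal := by linarith
    rw [eLpNorm_eq_lintegral hp hp']
    gcongr
    rw [lintegral_eq_tsum_cubes hD.cube_subset k]
    refine ENNReal.tsum_le_tsum fun Q => ?_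
    rw [mul_comm, ← setLIntegral_const]
    refine setLIntegral_mono' Q.1.measurableSet_toSet fun x hx => ?_
    have e := DyadicCube.mem_toSet_iff.1 hx
    rw [Q.2.1] at e
    rw [e]
    exact iSup_rpow_le_tsum _ hq0

/-- The averages over neighboring cubes are bounded on `L^p`. -/
lemma eLpNorm_nbrSup_le {Ω : Set (E n)} {μ : Measure (E n)} {C : ℝ≥0} (hD : DyadicDoubling Ω μ C)
    {p : ℝ≥0∞} (hp : 1 ≤ p) {h : E n → ℝ≥0∞} (hh : AEMeasurable h (μ.restrict Ω)) (k : ℤ) :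
    eLpNorm (fun x => nbrSup Ω μ h (cubeAt k x)) p (μ.restrict Ω) ≤
      (3 * (C + 1) : ℝ≥0) * eLpNorm h p (μ.restrict Ω) := by
  classical
  have hC : (1 : ℝ≥0∞) ≤ (3 * (C + 1) : ℝ≥0) := by
    have : (1 : ℝ≥0) ≤ 3 * (C + 1) := by
      have : (0 : ℝ≥0) ≤ C := zero_le
      calc (1 : ℝ≥0) ≤ 3 * (0 + 1) := by norm_num
        _ ≤ _ := by gcongr
    exact_mod_cast this
  by_cases hp' : p = ∞
  · subst hp'
    refine (eLpNorm_top_le (Eventually.of_forall fun x => ?_)).trans (le_mul_of_one_le_left' hC)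
    refine iSup_le fun Q => ?_
    rw [setLAverage_eq]
    refine ENNReal.div_le_of_le_mul ?_
    calc ∫⁻ y in Q.1.toSet, h y ∂μ ≤ ∫⁻ y in Q.1.toSet, eLpNorm h ∞ (μ.restrict Ω) ∂μ :=
          lintegral_mono_ae (ae_mono (Measure.restrict_mono_set μ Q.2.2) (ae_le_eLpNorm_top h))
      _ = _ := by simp
  · have hq := toReal_one_le hp hp'
    have hq0 : 0 < p.toReal := by linarith
    let a : DyadicCube n → ℝ≥0∞ := fun Q => (⨍⁻ y in Q.toSet, h y ∂μ) ^ p.toReal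
    let S : DyadicCube n → Set (E n) := fun Q => {x | (cubeAt k x).Neighbor Q}
    have hS : ∀ Q, MeasurableSet (S Q) := fun Q =>
      (measurable_cubeAt k) (MeasurableSet.of_discrete (s := {R : DyadicCube n | R.Neighbor Q}))
    have h1 : ∀ x, nbrSup Ω μ h (cubeAt k x) ^ p.toReal ≤
        ∑' Q : {Q : DyadicCube n // Q.toSet ⊆ Ω}, (S Q.1).indicator (fun _ => a Q.1) x := by
      intro x
      refine (iSup_rpow_le_tsum _ hq0).trans ?_
      let f : {Q' : DyadicCube n // (cubeAt k x).Neighbor Q' ∧ Q'.toSet ⊆ Ω} →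
        {Q : DyadicCube n // Q.toSet ⊆ Ω} := fun Q' => ⟨Q'.1, Q'.2.2⟩
      have hf : Function.Injective f := by
        intro A B hAB
        exact Subtype.ext (by simpa [f] using hAB)
      refine le_trans (ENNReal.tsum_le_tsum fun Q' => ?_)
        (ENNReal.tsum_comp_le_tsum_of_injective hf _)
      have : x ∈ S (f Q').1 := Q'.2.1
      rw [Set.indicator_of_mem this]
    have hlev : ∀ Q : DyadicCube n, (S Q).Nonempty → Q.level ∈ Finset.Icc (k - 1) (k + 1) := by
      rintro Q ⟨x, hx⟩
      have := (DyadicCube.neighbor_iff.1 hx).1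
      simp only [cubeAt_level] at this
      rw [Finset.mem_Icc]; omega
    have key : ∫⁻ x in Ω, nbrSup Ω μ h (cubeAt k x) ^ p.toReal ∂μ ≤
        (3 * (C + 1) : ℝ≥0) * ∫⁻ x in Ω, h x ^ p.toReal ∂μ := by
      calc ∫⁻ x in Ω, nbrSup Ω μ h (cubeAt k x) ^ p.toReal ∂μ
          ≤ ∫⁻ x in Ω, ∑' Q : {Q : DyadicCube n // Q.toSet ⊆ Ω},
              (S Q.1).indicator (fun _ => a Q.1) x ∂μ := lintegral_mono h1
        _ = ∑' Q : {Q : DyadicCube n // Q.toSet ⊆ Ω}, a Q.1 * μ (Ω ∩ S Q.1) := by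
          rw [lintegral_tsum fun Q => (measurable_const.indicator (hS _)).aemeasurable]
          congr 1; ext Q
          rw [lintegral_indicator_const (hS _), Measure.restrict_apply (hS _), Set.inter_comm]
        _ ≤ ∑' Q : {Q : DyadicCube n // Q.toSet ⊆ Ω}, ∑ l ∈ Finset.Icc (k - 1) (k + 1),
              if Q.1.level = l then C * ∫⁻ x in Q.1.toSet, h x ^ p.toReal ∂μ else 0 := by
          refine ENNReal.tsum_le_tsum fun Q => ?_
          by_cases hne : (S Q.1).Nonempty
          · rw [Finset.sum_ite_eq, if_pos (hlev _ hne)]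
            calc a Q.1 * μ (Ω ∩ S Q.1) ≤ a Q.1 * (C * μ Q.1.toSet) := by
                  gcongr; exact hD.doubling k Q.1 Q.2
              _ = C * (μ Q.1.toSet * a Q.1) := by ring
              _ ≤ _ := by
                gcongr
                exact measure_mul_laverage_rpow_le hq (hD.measure_ne_zero _ Q.2)
                  (hD.measure_ne_top _) (hh.mono_measure (Measure.restrict_mono_set μ Q.2))
          · rw [Set.not_nonempty_iff_eq_empty.1 hne]; simp
        _ = ∑ l ∈ Finset.Icc (k - 1) (k + 1), ∑' Q : {Q : DyadicCube n // Q.toSet ⊆ Ω},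
              if Q.1.level = l then C * ∫⁻ x in Q.1.toSet, h x ^ p.toReal ∂μ else 0 :=
          Summable.tsum_finsetSum fun _ _ => ENNReal.summable
        _ ≤ ∑ l ∈ Finset.Icc (k - 1) (k + 1), C * ∫⁻ x in Ω, h x ^ p.toReal ∂μ := by
          refine Finset.sum_le_sum fun l _ => ?_
          rw [lintegral_eq_tsum_cubes hD.cube_subset l, ← ENNReal.tsum_mul_left]
          let f : {Q : DyadicCube n // Q.level = l ∧ Q.toSet ⊆ Ω} →
            {Q : DyadicCube n // Q.toSet ⊆ Ω} := fun Q' => ⟨Q'.1, Q'.2.2⟩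
          have hf : Function.Injective f := by
            intro A B hAB
            exact Subtype.ext (by simpa [f] using hAB)
          refine le_of_eq ?_
          rw [← hf.tsum_eq]
          · refine tsum_congr fun Q => ?_
            simp [f, Q.2.1]
          · intro Q hQ
            have : Q.1.level = l := by
              by_contra hne; simp [hne] at hQ
            exact ⟨⟨Q.1, this, Q.2⟩, rfl⟩
        _ = 3 * (C * ∫⁻ x in Ω, h x ^ p.toReal ∂μ) := by
          rw [Finset.sum_const, Int.card_Icc, show (k + 1 + 1 - (k - 1)).toNat = 3 by omega]
          simp
        _ ≤ _ := by
          rw [← mul_assoc]; push_cast; gcongr; exact le_self_add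
    rw [eLpNorm_eq_lintegral hp hp', eLpNorm_eq_lintegral hp hp']
    calc _ ≤ ((3 * (C + 1) : ℝ≥0) * ∫⁻ x in Ω, h x ^ p.toReal ∂μ) ^ (1 / p.toReal) := by gcongr
      _ = ((3 * (C + 1) : ℝ≥0) : ℝ≥0∞) ^ (1 / p.toReal) *
          (∫⁻ x in Ω, h x ^ p.toReal ∂μ) ^ (1 / p.toReal) := by
        rw [ENNReal.mul_rpow_of_nonneg _ _ (by positivity)]
      _ ≤ _ := by gcongr; exact rpow_one_div_le_self hC hq

end

section
/-! ### Sequence quasinorms -/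

lemma add_rpow_le_two_rpow {r : ℝ} (hr : 0 ≤ r) (a b : ℝ≥0∞) :
    (a + b) ^ r ≤ 2 ^ r * (a ^ r + b ^ r) := by
  have h1 : a + b ≤ 2 * max a b := by
    rw [two_mul]; gcongr
    · exact le_max_left _ _
    · exact le_max_right _ _
  calc (a + b) ^ r ≤ (2 * max a b) ^ r := by gcongr
    _ = 2 ^ r * max a b ^ r := ENNReal.mul_rpow_of_nonneg _ _ hr
    _ ≤ _ := by
      gcongr
      rcases le_total a b with h | h
      · rw [max_eq_right h]; exact le_add_self
      · rw [max_eq_left h]; exact le_self_add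

lemma le_ellNorm {q : ℝ≥0∞} (hq : 0 < q) (a : ℕ → ℝ≥0∞) (k : ℕ) : a k ≤ ellNorm q a := by
  unfold ellNorm
  split_ifs with h
  · exact le_iSup a k
  · have hq0 : 0 < q.toReal := ENNReal.toReal_pos hq.ne' h
    rw [one_div, ENNReal.le_rpow_inv_iff hq0]
    exact ENNReal.le_tsum (f := fun k => a k ^ q.toReal) k

lemma ellNorm_const_mul {q : ℝ≥0∞} (hq : 0 < q) (c : ℝ≥0∞) (a : ℕ → ℝ≥0∞) :
    ellNorm q (fun k => c * a k) = c * ellNorm q a := by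
  unfold ellNorm
  split_ifs with h
  · rw [ENNReal.mul_iSup]
  · have hq0 : 0 < q.toReal := ENNReal.toReal_pos hq.ne' h
    simp_rw [ENNReal.mul_rpow_of_nonneg _ _ hq0.le]
    rw [ENNReal.tsum_mul_left, ENNReal.mul_rpow_of_nonneg _ _ (by positivity),
      ← ENNReal.rpow_mul, mul_one_div_cancel hq0.ne', ENNReal.rpow_one]

lemma ellNorm_single {q : ℝ≥0∞} (hq : 0 < q) (D : ℝ≥0∞) :
    ellNorm q (fun k => if k = 0 then D else 0) ≤ D := by
  unfold ellNorm
  split_ifs with h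
  · exact iSup_le fun k => by dsimp only; split_ifs <;> simp
  · have hq0 : 0 < q.toReal := ENNReal.toReal_pos hq.ne' h
    rw [tsum_eq_single 0 (fun k hk => by simp [hk, hq0])]
    simp only [if_true]
    rw [← ENNReal.rpow_mul, mul_one_div_cancel hq0.ne', ENNReal.rpow_one]

lemma exists_ellNorm_add_le {q : ℝ≥0∞} (hq : 0 < q) :
    ∃ C : ℝ≥0, ∀ a b : ℕ → ℝ≥0∞,
      ellNorm q (fun k => a k + b k) ≤ C * (ellNorm q a + ellNorm q b) := by
  by_cases h : q = ∞
  · refine ⟨1, fun a b => ?_⟩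
    simp only [ellNorm, if_pos h, ENNReal.coe_one, one_mul]
    exact iSup_le fun k => add_le_add (le_iSup a k) (le_iSup b k)
  · have hq0 : 0 < q.toReal := ENNReal.toReal_pos hq.ne' h
    refine ⟨2 * 2 ^ (1 / q.toReal), fun a b => ?_⟩
    simp only [ellNorm, if_neg h]
    calc (∑' k, (a k + b k) ^ q.toReal) ^ (1 / q.toReal)
        ≤ (∑' k, 2 ^ q.toReal * (a k ^ q.toReal + b k ^ q.toReal)) ^ (1 / q.toReal) := by
          gcongr with k
          exact add_rpow_le_two_rpow hq0.le _ _
      _ = 2 * (∑' k, a k ^ q.toReal + ∑' k, b k ^ q.toReal) ^ (1 / q.toReal) := by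
          rw [ENNReal.tsum_mul_left, ENNReal.mul_rpow_of_nonneg _ _ (by positivity),
            ← ENNReal.rpow_mul, mul_one_div_cancel hq0.ne', ENNReal.rpow_one, ENNReal.tsum_add]
      _ ≤ 2 * (2 ^ (1 / q.toReal) * ((∑' k, a k ^ q.toReal) ^ (1 / q.toReal) +
            (∑' k, b k ^ q.toReal) ^ (1 / q.toReal))) := by
          gcongr
          exact add_rpow_le_two_rpow (by positivity) _ _
      _ = _ := by
          rw [ENNReal.coe_mul, ENNReal.coe_rpow_of_nonneg _ (by positivity), mul_assoc]
          simp

/-- The two-sided geometric kernel has uniformly bounded row sums. -/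
lemma tsum_pow_dist_le (r : ℝ≥0∞) (k : ℕ) :
    ∑' j : ℕ, r ^ ((j - k) + (k - j)) ≤ (1 + r) * (1 - r)⁻¹ := by
  have h1 : ∑ j ∈ Finset.range k, r ^ ((j - k) + (k - j)) ≤ r * ∑' i : ℕ, r ^ i := by
    rw [← Finset.sum_range_reflect, ← ENNReal.tsum_mul_left]
    refine le_trans (Finset.sum_le_sum fun i hi => ?_) (ENNReal.sum_le_tsum (Finset.range k))
    rw [Finset.mem_range] at hi
    apply le_of_eq
    rw [← pow_succ']
    congr 1; omega
  have h2 : ∑' i : ℕ, r ^ ((i + k - k) + (k - (i + k))) = ∑' i : ℕ, r ^ i :=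
    tsum_congr fun i => by congr 1; omega
  have h3 := Summable.sum_add_tsum_nat_add' (f := fun j : ℕ => r ^ ((j - k) + (k - j))) (k := k)
    ENNReal.summable
  calc ∑' j : ℕ, r ^ ((j - k) + (k - j))
      = ∑ j ∈ Finset.range k, r ^ ((j - k) + (k - j)) +
          ∑' i : ℕ, r ^ ((i + k - k) + (k - (i + k))) :=
        h3.symm
    _ ≤ r * ∑' i : ℕ, r ^ i + ∑' i : ℕ, r ^ i := add_le_add h1 h2.le
    _ = (1 + r) * (1 - r)⁻¹ := by rw [ENNReal.tsum_geometric]; ring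

/-- Discrete convolution with a geometric kernel is bounded on `ℓ^q`, for every `q ∈ (0, ∞]`: half
of the decay of the kernel makes the sum comparable to a supremum, and the `q`-th power of a
supremum is at most the sum of the `q`-th powers. -/
lemma exists_ellNorm_conv_le {q : ℝ≥0∞} (hq : 0 < q) {r : ℝ≥0∞} (hr : r < 1) :
    ∃ C : ℝ≥0, ∀ a b : ℕ → ℝ≥0∞, (∀ k, a k ≤ ∑' j : ℕ, r ^ ((j - k) + (k - j)) * b j) →
      ellNorm q a ≤ C * ellNorm q b := by
  set ρ : ℝ≥0∞ := r ^ (1 / 2 : ℝ) with hρ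
  have hρ1 : ρ < 1 := ENNReal.rpow_lt_one hr (by norm_num)
  have hρr : ∀ i : ℕ, r ^ i = ρ ^ i * ρ ^ i := by
    intro i
    rw [← mul_pow, hρ, ← ENNReal.rpow_add_of_nonneg _ _ (by norm_num) (by norm_num)]
    norm_num
  have hfin : ∀ x : ℝ≥0∞, x < 1 → (1 + x) * (1 - x)⁻¹ ≠ ∞ := by
    intro x hx
    refine ENNReal.mul_ne_top (by simp [(hx.trans ENNReal.one_lt_top).ne]) ?_
    rw [Ne, ENNReal.inv_eq_top, tsub_eq_zero_iff_le, not_le]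
    exact hx
  set S := (1 + ρ) * (1 - ρ)⁻¹ with hS
  have key : ∀ a b : ℕ → ℝ≥0∞, (∀ k, a k ≤ ∑' j : ℕ, r ^ ((j - k) + (k - j)) * b j) → ∀ k,
      a k ≤ S * ⨆ j, ρ ^ ((j - k) + (k - j)) * b j := by
    intro a b hab k
    calc a k ≤ ∑' j : ℕ, r ^ ((j - k) + (k - j)) * b j := hab k
      _ ≤ ∑' j : ℕ, ρ ^ ((j - k) + (k - j)) * ⨆ j, ρ ^ ((j - k) + (k - j)) * b j := by
        refine ENNReal.tsum_le_tsum fun j => ?_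
        rw [hρr, mul_assoc]
        gcongr
        exact le_iSup (fun j => ρ ^ ((j - k) + (k - j)) * b j) j
      _ = (∑' j : ℕ, ρ ^ ((j - k) + (k - j))) * ⨆ j, ρ ^ ((j - k) + (k - j)) * b j :=
        ENNReal.tsum_mul_right
      _ ≤ _ := by gcongr; exact tsum_pow_dist_le ρ k
  have hSf : S ≠ ∞ := hfin ρ hρ1
  clear_value S
  by_cases h : q = ∞
  · refine ⟨S.toNNReal, fun a b hab => ?_⟩
    rw [ENNReal.coe_toNNReal hSf]
    simp only [ellNorm, if_pos h]
    refine iSup_le fun k => (key a b hab k).trans ?_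
    gcongr with j
    exact mul_le_of_le_one_left' (pow_le_one₀ zero_le hρ1.le)
  · have hq0 : 0 < q.toReal := ENNReal.toReal_pos hq.ne' h
    set S' := (1 + ρ ^ q.toReal) * (1 - ρ ^ q.toReal)⁻¹ with hS'
    have hS'f : S' ≠ ∞ := hfin _ (ENNReal.rpow_lt_one hρ1 hq0)
    refine ⟨(S * S' ^ (1 / q.toReal)).toNNReal, fun a b hab => ?_⟩
    rw [ENNReal.coe_toNNReal (ENNReal.mul_ne_top hSf
      (ENNReal.rpow_ne_top_of_nonneg (by positivity) hS'f))]
    simp only [ellNorm, if_neg h]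
    have h1 : ∑' k, a k ^ q.toReal ≤ S ^ q.toReal * (S' * ∑' j, b j ^ q.toReal) := by
      calc ∑' k, a k ^ q.toReal
          ≤ ∑' k, S ^ q.toReal * ∑' j, (ρ ^ q.toReal) ^ ((j - k) + (k - j)) * b j ^ q.toReal := by
            refine ENNReal.tsum_le_tsum fun k => ?_
            calc a k ^ q.toReal ≤ (S * ⨆ j, ρ ^ ((j - k) + (k - j)) * b j) ^ q.toReal := by
                  gcongr; exact key a b hab k
              _ = S ^ q.toReal * (⨆ j, ρ ^ ((j - k) + (k - j)) * b j) ^ q.toReal :=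
                  ENNReal.mul_rpow_of_nonneg _ _ hq0.le
              _ ≤ S ^ q.toReal * ∑' j, (ρ ^ ((j - k) + (k - j)) * b j) ^ q.toReal := by
                  gcongr; exact iSup_rpow_le_tsum _ hq0
              _ = _ := by
                  congr 2; ext j
                  rw [ENNReal.mul_rpow_of_nonneg _ _ hq0.le, ← ENNReal.rpow_natCast,
                    ← ENNReal.rpow_mul, mul_comm (Nat.cast _), ENNReal.rpow_mul,
                    ENNReal.rpow_natCast]
        _ = S ^ q.toReal * ∑' j, (∑' k, (ρ ^ q.toReal) ^ ((j - k) + (k - j))) * b j ^ q.toReal := by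
            rw [ENNReal.tsum_mul_left, ENNReal.tsum_comm]
            simp_rw [ENNReal.tsum_mul_right]
        _ ≤ S ^ q.toReal * ∑' j, S' * b j ^ q.toReal := by
            gcongr with j
            refine le_trans (le_of_eq ?_) (tsum_pow_dist_le (ρ ^ q.toReal) j)
            refine tsum_congr fun k => ?_
            rw [add_comm]
        _ = _ := by rw [ENNReal.tsum_mul_left]
    calc (∑' k, a k ^ q.toReal) ^ (1 / q.toReal)
        ≤ (S ^ q.toReal * (S' * ∑' j, b j ^ q.toReal)) ^ (1 / q.toReal) := by gcongr
      _ = _ := by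
        rw [ENNReal.mul_rpow_of_nonneg _ _ (by positivity), ENNReal.mul_rpow_of_nonneg _ _
          (by positivity), ← ENNReal.rpow_mul, mul_one_div_cancel hq0.ne', ENNReal.rpow_one,
          mul_assoc]

end

section
/-! ### The weighted half-space as a product -/

/-- The projection `ℝ^{d+1} → ℝ^d` forgetting the last coordinate. -/
def proj {d : ℕ} (x : E (d + 1)) : E d := WithLp.toLp 2 fun i => x i.castSucc

/-- The height of a point above the boundary, that is, its last coordinate. -/
def ht {d : ℕ} (x : E (d + 1)) : ℝ := x (Fin.last d)

@[simp] lemma proj_apply {d : ℕ} (x : E (d + 1)) (i : Fin d) : proj x i = x i.castSucc := rfl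

lemma measurable_proj {d : ℕ} : Measurable (proj : E (d + 1) → E d) := by
  unfold proj
  refine (WithLp.measurable_toLp 2 _).comp ?_
  fun_prop

lemma measurable_ht {d : ℕ} : Measurable (ht : E (d + 1) → ℝ) := by
  unfold ht; fun_prop

/-- The measure on `ℝ` with density `min(1,t)^α` on `(0,∞)`. -/
noncomputable def nuAlpha (α : ℝ) : Measure ℝ :=
  (volume.restrict (Set.Ioi 0)).withDensity fun t => ENNReal.ofReal ((min 1 |t|) ^ α)

lemma measurable_weight (α : ℝ) : Measurable fun t : ℝ => ENNReal.ofReal ((min 1 |t|) ^ α) := by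
  fun_prop

lemma measurePreserving_proj_ht (d : ℕ) :
    MeasurePreserving (fun x : E (d + 1) => (proj x, ht x)) volume (volume.prod volume) := by
  have h1 := PiLp.volume_preserving_ofLp (Fin (d + 1))
  have h2 := volume_preserving_piFinSuccAbove (fun _ : Fin (d + 1) => ℝ) (Fin.last d)
  have h3 : MeasurePreserving (Prod.swap : ℝ × (Fin d → ℝ) → _) (volume.prod volume)
    (volume.prod volume) := Measure.measurePreserving_swap
  have h4 := (PiLp.volume_preserving_toLp (Fin d)).prod
    (MeasurePreserving.id (volume : Measure ℝ))
  have h5 := h4.comp (h3.comp (h2.comp h1))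
  have e : (fun x : E (d + 1) => (proj x, ht x)) = Prod.map (WithLp.toLp 2) id ∘ Prod.swap ∘
      MeasurableEquiv.piFinSuccAbove (fun _ => ℝ) (Fin.last d) ∘ WithLp.ofLp := by
    funext x
    refine Prod.ext ?_ ?_
    · ext i
      simp [proj, MeasurableEquiv.piFinSuccAbove, Fin.init]
    · simp [ht, MeasurableEquiv.piFinSuccAbove]
  rw [e]
  exact h5

lemma measurableSet_upperHalf (d : ℕ) : MeasurableSet (upperHalf d) :=
  measurableSet_Ioi.preimage (measurable_ht (d := d))

/-- On cylinders, the weighted measure is a product of the Lebesgue measure on `ℝ^d` and of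
`nuAlpha`. -/
lemma muAlpha_cylinder (d : ℕ) (α : ℝ) {B : Set (E d)} (hB : MeasurableSet B) {I : Set ℝ}
    (hI : MeasurableSet I) :
    muAlpha d α (proj ⁻¹' B ∩ ht ⁻¹' I) = volume B * nuAlpha α I := by
  have hm : MeasurableSet (proj ⁻¹' B ∩ ht ⁻¹' I : Set (E (d + 1))) :=
    (hB.preimage measurable_proj).inter (hI.preimage measurable_ht)
  unfold muAlpha nuAlpha
  rw [withDensity_apply _ hm, withDensity_apply _ hI, Measure.restrict_restrict hm,
    Measure.restrict_restrict hI]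
  have e : (proj ⁻¹' B ∩ ht ⁻¹' I ∩ upperHalf d : Set (E (d + 1))) =
      (fun x => (proj x, ht x)) ⁻¹' (B ×ˢ (I ∩ Set.Ioi 0)) := by
    ext x; simp [upperHalf, ht, and_assoc]
  rw [e]
  have h := (measurePreserving_proj_ht d).setLIntegral_comp_preimage
    (hB.prod (hI.inter (measurableSet_Ioi (a := (0 : ℝ)))))
    (f := fun z => ENNReal.ofReal ((min 1 |z.2|) ^ α))
    ((measurable_weight α).comp measurable_snd)
  refine h.trans ?_
  rw [← Measure.prod_restrict]
  have := lintegral_prod_mul (μ := volume.restrict B) (ν := volume.restrict (I ∩ Set.Ioi 0))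
    (f := fun _ => 1) (g := fun t : ℝ => ENNReal.ofReal ((min 1 |t|) ^ α))
    aemeasurable_const (measurable_weight α).aemeasurable
  simpa using this

lemma muAlpha_restrict_upperHalf (d : ℕ) (α : ℝ) :
    (muAlpha d α).restrict (upperHalf d) = muAlpha d α := by
  unfold muAlpha
  rw [restrict_withDensity (measurableSet_upperHalf d), Measure.restrict_restrict
    (measurableSet_upperHalf d), Set.inter_self]

lemma map_proj_restrict (d : ℕ) (α : ℝ) {I : Set ℝ} (hI : MeasurableSet I) :
    Measure.map proj ((muAlpha d α).restrict (ht ⁻¹' I)) = nuAlpha α I • volume := by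
  ext B hB
  rw [Measure.map_apply measurable_proj hB, Measure.restrict_apply (hB.preimage measurable_proj),
    muAlpha_cylinder d α hB hI]
  simp [mul_comm]

/-- The `L^p` norm over a layer `{x | x_{d+1} ∈ I}` of a function of the first `d` variables. -/
lemma eLpNorm_layer (d : ℕ) (α : ℝ) {I : Set ℝ} (hI : MeasurableSet I) (hν : nuAlpha α I ≠ 0)
    {p : ℝ≥0∞} {g : E d → ℝ≥0∞} (hg : AEMeasurable g) :
    eLpNorm ((ht ⁻¹' I).indicator fun x => g (proj x)) p ((muAlpha d α).restrict (upperHalf d)) =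
      nuAlpha α I ^ (1 / p).toReal * eLpNorm g p := by
  rw [muAlpha_restrict_upperHalf, eLpNorm_indicator_eq_eLpNorm_restrict
    (hI.preimage measurable_ht)]
  have hg' : AEStronglyMeasurable g (Measure.map proj ((muAlpha d α).restrict (ht ⁻¹' I))) := by
    rw [map_proj_restrict d α hI]
    exact (hg.smul_measure _).aestronglyMeasurable
  have h := eLpNorm_map_measure (p := p) hg' measurable_proj.aemeasurable
  rw [map_proj_restrict d α hI, eLpNorm_smul_measure_of_ne_zero hν, smul_eq_mul] at h
  exact h.symm

/-! ### The weight -/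

lemma rpow_le_of_comparable {K a b : ℝ} (hK : 1 ≤ K) (ha : 0 < a) (hb : 0 < b) (h1 : a ≤ K * b)
    (h2 : b ≤ K * a) (α : ℝ) : a ^ α ≤ K ^ |α| * b ^ α := by
  have hK0 : 0 < K := by linarith
  rcases le_or_gt 0 α with h | h
  · rw [abs_of_nonneg h, ← Real.mul_rpow hK0.le hb.le]
    exact Real.rpow_le_rpow ha.le h1 h
  · rw [abs_of_neg h]
    have h3 : b / K ≤ a := by rw [div_le_iff₀ hK0]; linarith
    calc a ^ α ≤ (b / K) ^ α := Real.rpow_le_rpow_of_nonpos (by positivity) h3 h.le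
      _ = K ^ (-α) * b ^ α := by
        rw [Real.div_rpow hb.le hK0.le, Real.rpow_neg hK0.le]; field_simp

lemma min_one_le_mul {K a b : ℝ} (hK : 1 ≤ K) (h1 : a ≤ K * b) :
    min 1 a ≤ K * min 1 b := by
  rcases le_total 1 b with h | h
  · rw [min_eq_left h]; exact (min_le_left _ _).trans (by linarith)
  · rw [min_eq_right h]; exact (min_le_right _ _).trans h1

lemma weight_le_of_comparable {K a b : ℝ} (hK : 1 ≤ K) (ha : 0 < a) (hb : 0 < b) (h1 : a ≤ K * b)
    (h2 : b ≤ K * a) (α : ℝ) : (min 1 a) ^ α ≤ K ^ |α| * (min 1 b) ^ α :=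
  rpow_le_of_comparable hK (by positivity) (by positivity) (min_one_le_mul hK h1)
    (min_one_le_mul hK h2) α

lemma nuAlpha_apply (α : ℝ) {I : Set ℝ} (hI : MeasurableSet I) :
    nuAlpha α I = ∫⁻ t in I ∩ Set.Ioi 0, ENNReal.ofReal ((min 1 |t|) ^ α) := by
  rw [nuAlpha, withDensity_apply _ hI, Measure.restrict_restrict hI]

lemma Ioc_inter_Ioi_zero {a b : ℝ} (ha : 0 ≤ a) : Set.Ioc a b ∩ Set.Ioi 0 = Set.Ioc a b :=
  Set.inter_eq_left.2 fun _ ht => ha.trans_lt ht.1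

/-- Integrability of the weight at the boundary, `α > -1`, enters through this bound. -/
lemma nuAlpha_Ioc_zero_le {α : ℝ} (hα : -1 < α) :
    ∃ C : ℝ≥0, ∀ b : ℝ, 0 < b →
      nuAlpha α (Set.Ioc 0 b) ≤ C * ENNReal.ofReal (b * (min 1 b) ^ α) := by
  have hα' : 0 < α + 1 := by linarith
  have key : ∀ b : ℝ, 0 < b → b ≤ 1 →
      nuAlpha α (Set.Ioc 0 b) = ENNReal.ofReal (b ^ (α + 1) / (α + 1)) := by
    intro b hb hb1
    rw [nuAlpha_apply α measurableSet_Ioc, Ioc_inter_Ioi_zero le_rfl]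
    have h1 : ∫ t in (0 : ℝ)..b, t ^ α = b ^ (α + 1) / (α + 1) := by
      rw [integral_rpow (Or.inl hα), Real.zero_rpow hα'.ne', sub_zero]
    have h2 : IntegrableOn (fun t : ℝ => t ^ α) (Set.Ioc 0 b) := by
      have := intervalIntegral.intervalIntegrable_rpow' (a := 0) (b := b) hα
      rwa [intervalIntegrable_iff_integrableOn_Ioc_of_le hb.le] at this
    rw [← h1, intervalIntegral.integral_of_le hb.le, ofReal_integral_eq_lintegral_ofReal h2]
    · refine setLIntegral_congr_fun measurableSet_Ioc fun t ht => ?_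
      rw [abs_of_pos ht.1, min_eq_right (ht.2.trans hb1)]
    · refine (ae_restrict_iff' measurableSet_Ioc).2 (Eventually.of_forall fun t ht => ?_)
      exact Real.rpow_nonneg ht.1.le _
  refine ⟨Real.toNNReal (1 + 1 / (α + 1)), fun b hb => ?_⟩
  change _ ≤ ENNReal.ofReal (1 + 1 / (α + 1)) * _
  rw [← ENNReal.ofReal_mul (by positivity)]
  rcases le_or_gt b 1 with h | h
  · rw [key b hb h]
    refine ENNReal.ofReal_le_ofReal ?_
    rw [min_eq_right h, Real.rpow_add hb, Real.rpow_one, mul_comm (b ^ α) b, div_eq_mul_one_div,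
      mul_comm]
    have : 0 ≤ b * b ^ α := by positivity
    nlinarith
  · have e : Set.Ioc 0 b = Set.Ioc 0 1 ∪ Set.Ioc 1 b :=
      (Set.Ioc_union_Ioc_eq_Ioc zero_le_one h.le).symm
    have h1 : nuAlpha α (Set.Ioc 1 b) ≤ ENNReal.ofReal (b - 1) := by
      rw [nuAlpha_apply α measurableSet_Ioc, ← Real.volume_Ioc, ← setLIntegral_one]
      refine (lintegral_mono_set Set.inter_subset_left).trans ?_
      refine setLIntegral_mono' measurableSet_Ioc fun t ht => ?_
      rw [min_eq_left (ht.1.le.trans (le_abs_self t))]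
      simp
    rw [e]
    refine (measure_union_le _ _).trans ?_
    rw [key 1 one_pos le_rfl]
    refine (add_le_add le_rfl h1).trans ?_
    rw [← ENNReal.ofReal_add (by positivity) (by linarith)]
    refine ENNReal.ofReal_le_ofReal ?_
    rw [min_eq_left h.le, Real.one_rpow, Real.one_rpow]
    have : 0 ≤ 1 / (α + 1) := by positivity
    nlinarith

/-- The lower bound comes from the upper half of the interval, where the weight is comparable with
its value at the right endpoint. -/
lemma le_nuAlpha_Ioc (α : ℝ) {a l : ℝ} (ha : 0 ≤ a) (hl : 0 < l) :
    ENNReal.ofReal (l * (min 1 (a + l)) ^ α) ≤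
      ENNReal.ofReal (2 * 2 ^ |α|) * nuAlpha α (Set.Ioc a (a + l)) := by
  have hal : 0 < a + l := by linarith
  have h1 : ENNReal.ofReal ((2 ^ |α|)⁻¹ * (min 1 (a + l)) ^ α) * ENNReal.ofReal (l / 2) ≤
      nuAlpha α (Set.Ioc a (a + l)) := by
    rw [nuAlpha_apply α measurableSet_Ioc, Ioc_inter_Ioi_zero ha]
    have e : l / 2 = (a + l) - (a + l / 2) := by ring
    rw [e, ← Real.volume_Ioc, ← setLIntegral_const]
    refine (setLIntegral_mono' measurableSet_Ioc fun t ht => ?_).trans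
      (lintegral_mono_set (Set.Ioc_subset_Ioc_left (by linarith)))
    have ht0 : 0 < t := by have := ht.1; linarith
    refine ENNReal.ofReal_le_ofReal ?_
    rw [abs_of_pos ht0, inv_mul_le_iff₀ (by positivity)]
    exact weight_le_of_comparable one_le_two hal ht0 (by have := ht.1; linarith)
      (by have := ht.2; linarith) α
  refine le_trans (le_of_eq ?_) (mul_le_mul_right h1 _)
  rw [← ENNReal.ofReal_mul (by positivity), ← ENNReal.ofReal_mul (by positivity)]
  congr 1
  have : (0 : ℝ) < 2 ^ |α| := by positivity
  field_simp

lemma nuAlpha_Ioc_ne_zero (α : ℝ) {a l : ℝ} (ha : 0 ≤ a) (hl : 0 < l) :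
    nuAlpha α (Set.Ioc a (a + l)) ≠ 0 := by
  intro h
  have := le_nuAlpha_Ioc α ha hl
  rw [h, mul_zero, nonpos_iff_eq_zero, ENNReal.ofReal_eq_zero] at this
  have h2 : 0 < l * (min 1 (a + l)) ^ α := by positivity
  linarith

lemma nuAlpha_Ioc_ne_top {α : ℝ} (hα : -1 < α) (a b : ℝ) : nuAlpha α (Set.Ioc a b) ≠ ∞ := by
  obtain ⟨C, hC⟩ := nuAlpha_Ioc_zero_le hα
  have h1 : nuAlpha α (Set.Ioc a b) ≤ nuAlpha α (Set.Ioc 0 (max b 1)) := by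
    rw [nuAlpha_apply α measurableSet_Ioc, nuAlpha_apply α measurableSet_Ioc]
    exact lintegral_mono_set fun t ht => ⟨⟨ht.2, ht.1.2.trans (le_max_left _ _)⟩, ht.2⟩
  exact ne_top_of_le_ne_top (by finiteness) (h1.trans (hC _ (by positivity)))

/-- The measure `min(1,t)^α dt` on `(0,∞)` is doubling. -/
lemma nuAlpha_doubling {α : ℝ} (hα : -1 < α) :
    ∃ C : ℝ≥0, ∀ a l : ℝ, 0 ≤ a → 0 < l →
      nuAlpha α (Set.Ioc (a - 2 * l) (a + 3 * l)) ≤ C * nuAlpha α (Set.Ioc a (a + l)) := by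
  obtain ⟨C, hC⟩ := nuAlpha_Ioc_zero_le hα
  -- Both cases compare with the model quantity `l * min(1, a + l)^α`.
  obtain ⟨C', hC'⟩ : ∃ C' : ℝ≥0, ∀ a l : ℝ, 0 ≤ a → 0 < l →
      nuAlpha α (Set.Ioc (a - 2 * l) (a + 3 * l)) ≤
        C' * ENNReal.ofReal (l * (min 1 (a + l)) ^ α) := by
    refine ⟨C * Real.toNNReal (6 * 6 ^ |α|) + Real.toNNReal (5 * 4 ^ |α|), fun a l ha hl => ?_⟩
    have hal : 0 < a + l := by linarith
    -- Either the interval stays away from zero, and the weight is essentially constant on it, or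
    -- the interval is comparable with one that starts at zero.
    rcases le_or_gt (3 * l) a with h | h
    · have h1 : nuAlpha α (Set.Ioc (a - 2 * l) (a + 3 * l)) ≤
          ENNReal.ofReal (5 * 4 ^ |α|) * ENNReal.ofReal (l * (min 1 (a + l)) ^ α) := by
        rw [nuAlpha_apply α measurableSet_Ioc]
        calc _ ≤ ∫⁻ t in Set.Ioc (a - 2 * l) (a + 3 * l),
              ENNReal.ofReal (4 ^ |α| * (min 1 (a + l)) ^ α) := by
              refine (lintegral_mono_set Set.inter_subset_left).trans
                (setLIntegral_mono' measurableSet_Ioc fun t ht => ENNReal.ofReal_le_ofReal ?_)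
              have h2 := ht.1
              have h3 := ht.2
              have ht0 : 0 < t := by linarith
              rw [abs_of_pos ht0]
              exact weight_le_of_comparable (by norm_num) ht0 hal (by linarith) (by linarith) α
          _ = _ := by
              rw [setLIntegral_const, Real.volume_Ioc, ← ENNReal.ofReal_mul (by positivity),
                ← ENNReal.ofReal_mul (by positivity)]
              congr 1; ring
      refine h1.trans ?_
      gcongr
      push_cast
      exact le_add_self
    · have h1 : nuAlpha α (Set.Ioc (a - 2 * l) (a + 3 * l)) ≤ nuAlpha α (Set.Ioc 0 (6 * l)) := by
        rw [nuAlpha_apply α measurableSet_Ioc, nuAlpha_apply α measurableSet_Ioc]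
        exact lintegral_mono_set fun t ht => ⟨⟨ht.2, by have := ht.1.2; linarith⟩, ht.2⟩
      refine h1.trans ((hC _ (by linarith)).trans ?_)
      have h2 : ENNReal.ofReal (6 * l * (min 1 (6 * l)) ^ α) ≤
          ENNReal.ofReal (6 * 6 ^ |α|) * ENNReal.ofReal (l * (min 1 (a + l)) ^ α) := by
        rw [← ENNReal.ofReal_mul (by positivity)]
        refine ENNReal.ofReal_le_ofReal ?_
        have := weight_le_of_comparable (K := 6) (a := 6 * l) (b := a + l) (by norm_num)
          (by linarith) hal (by linarith) (by linarith) α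
        calc 6 * l * (min 1 (6 * l)) ^ α ≤ 6 * l * (6 ^ |α| * (min 1 (a + l)) ^ α) := by gcongr
          _ = _ := by ring
      calc _ ≤ (C : ℝ≥0∞) *
            (ENNReal.ofReal (6 * 6 ^ |α|) * ENNReal.ofReal (l * (min 1 (a + l)) ^ α)) := by gcongr
        _ ≤ _ := by
          rw [← mul_assoc]
          gcongr
          push_cast
          exact le_self_add
  refine ⟨C' * Real.toNNReal (2 * 2 ^ |α|), fun a l ha hl => (hC' a l ha hl).trans ?_⟩
  rw [ENNReal.coe_mul, mul_assoc]
  gcongr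
  exact le_nuAlpha_Ioc α ha hl

/-! ### The doubling property of the two measure spaces -/

variable {n d : ℕ}

/-- A neighbor of `P` has edge length at most `2 ℓ(P)`, so it lies within the concentric box of side
`5 ℓ(P)`. -/
lemma mem_Ioc_of_neighbor {k : ℤ} {P : DyadicCube n} {x : E n} (h : (cubeAt k x).Neighbor P)
    (i : Fin n) :
    x i ∈ Set.Ioc (P.len * P.pos i - 2 * P.len) (P.len * P.pos i + 3 * P.len) := by
  rw [DyadicCube.neighbor_iff] at h
  have h1 := (h.2 i).1
  have h2 := (h.2 i).2
  rw [cubeAt_lo] at h1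
  rw [cubeAt_hi] at h2
  have h3 : (2 : ℝ) ^ (-k) ≤ 2 * P.len := by
    have : (2 : ℝ) ^ (1 - P.level) = 2 * P.len := by
      rw [sub_eq_add_neg, zpow_add₀ two_ne_zero]; simp [DyadicCube.len]
    rw [← this]
    have := h.1.2
    rw [cubeAt_level] at this
    exact zpow_le_zpow_right₀ one_le_two (by omega)
  have a1 := lo_lt k (x i)
  have a2 := le_hi k (x i)
  rw [hi_eq] at *
  constructor <;> linarith

/-- The box of side `5 ℓ(P)` concentric with `P`. -/
def bigBox (P : DyadicCube n) : Set (E n) :=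
  {x | ∀ i, x i ∈ Set.Ioc (P.len * P.pos i - 2 * P.len) (P.len * P.pos i + 3 * P.len)}

lemma bigBox_eq (P : DyadicCube n) : bigBox P = WithLp.ofLp ⁻¹' (Set.univ.pi fun i =>
    Set.Ioc (P.len * P.pos i - 2 * P.len) (P.len * P.pos i + 3 * P.len)) := by
  ext x; simp [bigBox]

lemma measurableSet_bigBox (P : DyadicCube n) : MeasurableSet (bigBox P) := by
  rw [bigBox_eq]
  exact (MeasurableSet.univ_pi fun i => measurableSet_Ioc).preimage (WithLp.measurable_ofLp 2 _)

lemma volume_bigBox (P : DyadicCube n) : volume (bigBox P) = 5 ^ n * volume P.toSet := by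
  rw [bigBox_eq, (PiLp.volume_preserving_ofLp (Fin n)).measure_preimage
    (MeasurableSet.univ_pi fun i => measurableSet_Ioc).nullMeasurableSet, volume_pi_pi,
    P.volume_toSet, ← mul_pow]
  have : ∀ i, P.len * (P.pos i : ℝ) + 3 * P.len - (P.len * P.pos i - 2 * P.len) = 5 * P.len :=
    fun i => by ring
  simp [Real.volume_Ioc, this, ENNReal.ofReal_mul]

lemma volume_toSet_ne_zero (Q : DyadicCube n) : volume Q.toSet ≠ 0 := by
  rw [Q.volume_toSet]
  exact pow_ne_zero _ (by simpa using Q.len_pos)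

lemma volume_toSet_ne_top (Q : DyadicCube n) : volume Q.toSet ≠ ∞ := by
  rw [Q.volume_toSet]; finiteness

lemma dyadicDoubling_volume (n : ℕ) :
    DyadicDoubling (Set.univ : Set (E n)) volume (5 ^ n : ℝ≥0) where
  measurableSet := MeasurableSet.univ
  cube_subset _ _ _ := Set.subset_univ _
  measure_ne_zero Q _ := volume_toSet_ne_zero Q
  measure_ne_top := volume_toSet_ne_top
  doubling k P _ := by
    push_cast
    rw [← volume_bigBox]
    exact measure_mono fun x hx i => mem_Ioc_of_neighbor hx.2 i

/-- The projection of a cube of `ℝ^{d+1}` to `ℝ^d`. -/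
def baseCube (P : DyadicCube (d + 1)) : DyadicCube d := ⟨P.level, fun i => P.pos i.castSucc⟩

lemma baseCube_cubeAt (k : ℤ) (x : E (d + 1)) : baseCube (cubeAt k x) = cubeAt k (proj x) := rfl

lemma toSet_eq_cylinder (P : DyadicCube (d + 1)) :
    P.toSet = proj ⁻¹' (baseCube P).toSet ∩ ht ⁻¹' Set.Ioc (P.len * P.pos (Fin.last d))
      (P.len * P.pos (Fin.last d) + P.len) := by
  ext x
  simp only [DyadicCube.mem_toSet, Set.mem_inter_iff, Set.mem_preimage, Fin.forall_fin_succ',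
    mul_add, mul_one]
  rfl

lemma muAlpha_toSet (α : ℝ) (P : DyadicCube (d + 1)) :
    muAlpha d α P.toSet = volume (baseCube P).toSet *
      nuAlpha α (Set.Ioc (P.len * P.pos (Fin.last d)) (P.len * P.pos (Fin.last d) + P.len)) := by
  rw [toSet_eq_cylinder, muAlpha_cylinder d α (baseCube P).measurableSet_toSet measurableSet_Ioc]

lemma pos_last_nonneg {P : DyadicCube (d + 1)} (h : P.toSet ⊆ upperHalf d) :
    0 ≤ P.pos (Fin.last d) := by
  have h1 : 0 < P.len * (P.pos (Fin.last d) + 1) := h P.corner_mem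
  have h2 : (0 : ℝ) < P.pos (Fin.last d) + 1 := by
    have := P.len_pos
    by_contra h3
    nlinarith
  have h3 : 0 < P.pos (Fin.last d) + 1 := by exact_mod_cast h2
  omega

lemma cubeAt_subset_upperHalf {x : E (d + 1)} (hx : 0 < ht x) (k : ℤ) :
    (cubeAt k x).toSet ⊆ upperHalf d := by
  intro y hy
  have := (hy (Fin.last d)).1
  rw [cubeAt_lo] at this
  exact (lo_nonneg hx).trans_lt this

lemma dyadicDoubling_muAlpha (d : ℕ) {α : ℝ} (hα : -1 < α) :
    ∃ C : ℝ≥0, DyadicDoubling (upperHalf d) (muAlpha d α) C := by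
  obtain ⟨C, hC⟩ := nuAlpha_doubling hα
  refine ⟨5 ^ d * C, measurableSet_upperHalf d, fun x hx k => cubeAt_subset_upperHalf hx k,
    fun Q hQ => ?_, fun Q => ?_, fun k P hP => ?_⟩
  · rw [muAlpha_toSet]
    refine mul_ne_zero (volume_toSet_ne_zero _) (nuAlpha_Ioc_ne_zero α ?_ Q.len_pos)
    exact mul_nonneg Q.len_pos.le (by exact_mod_cast pos_last_nonneg hQ)
  · rw [muAlpha_toSet]
    exact ENNReal.mul_ne_top (volume_toSet_ne_top _) (nuAlpha_Ioc_ne_top hα _ _)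
  · have h1 : upperHalf d ∩ {x | (cubeAt k x).Neighbor P} ⊆
        proj ⁻¹' (bigBox (baseCube P)) ∩ ht ⁻¹' Set.Ioc (P.len * P.pos (Fin.last d) - 2 * P.len)
          (P.len * P.pos (Fin.last d) + 3 * P.len) := fun x hx =>
      ⟨fun i => mem_Ioc_of_neighbor hx.2 i.castSucc, mem_Ioc_of_neighbor hx.2 (Fin.last d)⟩
    refine (measure_mono h1).trans ?_
    rw [muAlpha_cylinder d α (measurableSet_bigBox _) measurableSet_Ioc, volume_bigBox,
      muAlpha_toSet]
    have h2 := hC (P.len * P.pos (Fin.last d)) P.len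
      (mul_nonneg P.len_pos.le (by exact_mod_cast pos_last_nonneg hP)) P.len_pos
    calc _ ≤ 5 ^ d * volume (baseCube P).toSet * (C * nuAlpha α (Set.Ioc
          (P.len * P.pos (Fin.last d)) (P.len * P.pos (Fin.last d) + P.len))) := by gcongr
      _ = _ := by push_cast; ring

end

section
/-! ### Powers of two -/

/-- The power `2^x` as an extended nonnegative number. -/
noncomputable def pw (x : ℝ) : ℝ≥0∞ := ENNReal.ofReal ((2 : ℝ) ^ x)

lemma pw_add (x y : ℝ) : pw (x + y) = pw x * pw y := by
  unfold pw
  rw [Real.rpow_add two_pos, ENNReal.ofReal_mul (by positivity)]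

lemma pw_ne_top (x : ℝ) : pw x ≠ ∞ := ENNReal.ofReal_ne_top

lemma pw_zero : pw 0 = 1 := by simp [pw]

lemma pw_mono {x y : ℝ} (h : x ≤ y) : pw x ≤ pw y :=
  ENNReal.ofReal_le_ofReal (Real.rpow_le_rpow_of_exponent_le one_le_two h)

lemma pw_rpow (x : ℝ) {e : ℝ} (he : 0 ≤ e) : pw x ^ e = pw (x * e) := by
  unfold pw
  rw [ENNReal.ofReal_rpow_of_nonneg (by positivity) he, ← Real.rpow_mul two_pos.le]

lemma pw_mul_natCast (x : ℝ) (i : ℕ) : pw (x * i) = pw x ^ i := by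
  rw [← pw_rpow x (Nat.cast_nonneg i), ENNReal.rpow_natCast]

lemma pw_lt_one {x : ℝ} (h : x < 0) : pw x < 1 := by
  unfold pw
  rw [ENNReal.ofReal_lt_one]
  exact Real.rpow_lt_one_of_one_lt_of_neg one_lt_two h

lemma zpow_neg_natCast_eq_rpow (k : ℕ) : (2 : ℝ) ^ (-(k : ℤ)) = (2 : ℝ) ^ (-(k : ℝ)) := by
  rw [← Real.rpow_intCast]; push_cast; rfl

/-! ### Layers near the boundary -/

lemma one_div_toReal_nonneg (p : ℝ≥0∞) : 0 ≤ (1 / p).toReal := ENNReal.toReal_nonneg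

/-- The size of a layer of height `4 * 2^{-i}`. -/
lemma exists_nuAlpha_layer_le {α : ℝ} (hα : -1 < α) (p : ℝ≥0∞) :
    ∃ C : ℝ≥0, ∀ i : ℕ,
      nuAlpha α (Set.Ioc 0 (4 * (2 : ℝ) ^ (-(i : ℤ)))) ^ (1 / p).toReal ≤
        C * pw (-(i * ((α + 1) * (1 / p).toReal))) := by
  obtain ⟨C, hC⟩ := nuAlpha_Ioc_zero_le hα
  have he := one_div_toReal_nonneg p
  set D := (C : ℝ≥0∞) * ENNReal.ofReal (4 * 4 ^ |α|) with hD
  have h1 : ∀ i : ℕ, nuAlpha α (Set.Ioc 0 (4 * (2 : ℝ) ^ (-(i : ℤ)))) ≤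
      D * pw (-(i * (α + 1))) := by
    intro i
    refine (hC _ (by positivity)).trans ?_
    rw [hD, mul_assoc (C : ℝ≥0∞), pw, ← ENNReal.ofReal_mul (by positivity)]
    refine mul_le_mul_right (ENNReal.ofReal_le_ofReal ?_) _
    have h2 : (0 : ℝ) < (2 : ℝ) ^ (-(i : ℤ)) := by positivity
    have h3 := weight_le_of_comparable (K := 4) (a := 4 * (2 : ℝ) ^ (-(i : ℤ)))
      (b := (2 : ℝ) ^ (-(i : ℤ))) (by norm_num) (by positivity) h2 le_rfl (by linarith) α
    rw [min_eq_right (a := (1 : ℝ)) (zpow_le_one_of_nonpos₀ one_le_two (by simp))] at h3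
    calc _ ≤ 4 * (2 : ℝ) ^ (-(i : ℤ)) * (4 ^ |α| * ((2 : ℝ) ^ (-(i : ℤ))) ^ α) := by gcongr
      _ = 4 * 4 ^ |α| * ((2 : ℝ) ^ (-(i : ℝ)) * ((2 : ℝ) ^ (-(i : ℝ))) ^ α) := by
        rw [zpow_neg_natCast_eq_rpow]; ring
      _ = _ := by
        rw [← Real.rpow_mul two_pos.le, ← Real.rpow_add two_pos]; congr 2; ring
  refine ⟨(D ^ (1 / p).toReal).toNNReal, fun i => ?_⟩
  rw [ENNReal.coe_toNNReal (ENNReal.rpow_ne_top_of_nonneg he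
    (ENNReal.mul_ne_top (by simp) ENNReal.ofReal_ne_top))]
  refine (ENNReal.rpow_le_rpow (h1 i) he).trans (le_of_eq ?_)
  rw [ENNReal.mul_rpow_of_nonneg _ _ he, pw_rpow _ he]
  congr 2; ring

/-- A lower bound for the weight of the layer of height `2^{-k}`. -/
lemma exists_one_le_nuAlpha_layer (α : ℝ) (p : ℝ≥0∞) :
    ∃ C : ℝ≥0, ∀ k : ℕ,
      1 ≤ C * pw (k * ((α + 1) * (1 / p).toReal)) *
        nuAlpha α (Set.Ioc 0 ((2 : ℝ) ^ (-(k : ℤ)))) ^ (1 / p).toReal := by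
  have he := one_div_toReal_nonneg p
  set D := ENNReal.ofReal (2 * 2 ^ |α|) with hD
  refine ⟨(D ^ (1 / p).toReal).toNNReal, fun k => ?_⟩
  rw [ENNReal.coe_toNNReal (ENNReal.rpow_ne_top_of_nonneg he ENNReal.ofReal_ne_top)]
  have h1 := le_nuAlpha_Ioc α (a := 0) (l := (2 : ℝ) ^ (-(k : ℤ))) le_rfl (by positivity)
  rw [zero_add, min_eq_right (zpow_le_one_of_nonpos₀ one_le_two (by simp)),
    zpow_neg_natCast_eq_rpow, ← Real.rpow_mul two_pos.le, ← Real.rpow_add two_pos] at h1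
  have h2 : pw (-(k * (α + 1))) ≤ D * nuAlpha α (Set.Ioc 0 ((2 : ℝ) ^ (-(k : ℤ)))) := by
    rw [zpow_neg_natCast_eq_rpow]
    refine le_trans (le_of_eq ?_) h1
    rw [pw]; congr 2; ring
  have h3 := ENNReal.rpow_le_rpow h2 he
  rw [pw_rpow _ he, ENNReal.mul_rpow_of_nonneg _ _ he] at h3
  calc (1 : ℝ≥0∞) = pw (k * ((α + 1) * (1 / p).toReal)) * pw (-(k * (α + 1)) * (1 / p).toReal) := by
        rw [← pw_add, ← pw_zero]; congr 1; ring
    _ ≤ pw (k * ((α + 1) * (1 / p).toReal)) * (D ^ (1 / p).toReal *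
          nuAlpha α (Set.Ioc 0 ((2 : ℝ) ^ (-(k : ℤ)))) ^ (1 / p).toReal) := by gcongr
    _ = _ := by ring

variable {d : ℕ}

/-- The layer `{0 < x_{d+1} ≤ b}`. -/
def layer (d : ℕ) (b : ℝ) : Set (E (d + 1)) := ht ⁻¹' Set.Ioc 0 b

lemma mem_layer {b : ℝ} {x : E (d + 1)} : x ∈ layer d b ↔ 0 < ht x ∧ ht x ≤ b := Iff.rfl

lemma measurableSet_layer (b : ℝ) : MeasurableSet (layer d b) :=
  measurableSet_Ioc.preimage measurable_ht

/-- Restricting a function of the first `d` variables to a layer of height `4 * 2^{-i}` gains the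
factor `2^{-iβ}`, where `β = (α+1)/p`. -/
lemma exists_eLpNorm_layer_le (d : ℕ) {α : ℝ} (hα : -1 < α) (p : ℝ≥0∞) :
    ∃ C : ℝ≥0, ∀ (i : ℕ) (g : E d → ℝ≥0∞), AEMeasurable g →
      eLpNorm ((layer d (4 * (2 : ℝ) ^ (-(i : ℤ)))).indicator fun x => g (proj x)) p
        ((muAlpha d α).restrict (upperHalf d)) ≤
          C * pw (-(i * ((α + 1) * (1 / p).toReal))) * eLpNorm g p := by
  obtain ⟨C, hC⟩ := exists_nuAlpha_layer_le hα p
  refine ⟨C, fun i g hg => ?_⟩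
  unfold layer
  rw [eLpNorm_layer d α measurableSet_Ioc _ hg]
  · gcongr
    exact hC i
  · simpa using nuAlpha_Ioc_ne_zero α (a := 0) (l := 4 * (2 : ℝ) ^ (-(i : ℤ))) le_rfl (by positivity)

/-- The cube `Q × (0, ℓ(Q)]` over `Q`. -/
def boundaryCube (Q : DyadicCube d) : DyadicCube (d + 1) :=
  ⟨Q.level, Fin.snoc (α := fun _ => ℤ) Q.pos 0⟩

@[simp] lemma boundaryCube_level (Q : DyadicCube d) : (boundaryCube Q).level = Q.level := rfl

@[simp] lemma boundaryCube_len (Q : DyadicCube d) : (boundaryCube Q).len = Q.len := rfl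

@[simp] lemma boundaryCube_pos_castSucc (Q : DyadicCube d) (i : Fin d) :
    (boundaryCube Q).pos i.castSucc = Q.pos i := by simp [boundaryCube]

@[simp] lemma boundaryCube_pos_last (Q : DyadicCube d) :
    (boundaryCube Q).pos (Fin.last d) = 0 := by simp [boundaryCube]

lemma baseCube_boundaryCube (Q : DyadicCube d) : baseCube (boundaryCube Q) = Q := by
  ext i <;> simp [baseCube]

lemma mem_boundaryCube {Q : DyadicCube d} {x : E (d + 1)} :
    x ∈ (boundaryCube Q).toSet ↔ proj x ∈ Q.toSet ∧ 0 < ht x ∧ ht x ≤ Q.len := by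
  rw [toSet_eq_cylinder, baseCube_boundaryCube]
  simp

lemma boundaryCube_subset (Q : DyadicCube d) : (boundaryCube Q).toSet ⊆ upperHalf d :=
  fun _ hx => (mem_boundaryCube.1 hx).2.1

lemma cubeAt_eq_boundaryCube {k : ℤ} {x : E (d + 1)} (hx : 0 < ht x)
    (hx' : ht x ≤ (2 : ℝ) ^ (-k)) : cubeAt k x = boundaryCube (cubeAt k (proj x)) :=
  DyadicCube.mem_toSet_iff.1 (mem_boundaryCube.2 ⟨mem_cubeAt k (proj x), hx, hx'⟩)

lemma boundaryCube_neighbor {Q Q' : DyadicCube d} (h : Q.Neighbor Q') :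
    (boundaryCube Q).Neighbor (boundaryCube Q') := by
  rw [DyadicCube.neighbor_iff] at *
  refine ⟨h.1, fun i => ?_⟩
  induction i using Fin.lastCases with
  | last =>
    have := Q.len_pos
    have := Q'.len_pos
    simp only [boundaryCube_len, boundaryCube_pos_last, Int.cast_zero]
    constructor <;> linarith
  | cast i => simpa using h.2 i

lemma muAlpha_boundaryCube (α : ℝ) (Q : DyadicCube d) :
    muAlpha d α (boundaryCube Q).toSet = volume Q.toSet * nuAlpha α (Set.Ioc 0 Q.len) := by
  rw [muAlpha_toSet, baseCube_boundaryCube]; simp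

/-- The `L^p(ℝ^d)` norm of a function of the boundary cubes is controlled by the norm over the
half-space of the same function of all cubes. -/
lemma exists_eLpNorm_boundaryCube_le (d : ℕ) (α : ℝ) (p : ℝ≥0∞) :
    ∃ C : ℝ≥0, ∀ (k : ℕ) (φ : DyadicCube (d + 1) → ℝ≥0∞),
      eLpNorm (fun x : E d => φ (boundaryCube (cubeAt k x))) p ≤
        C * pw (k * ((α + 1) * (1 / p).toReal)) *
          eLpNorm ((layer d ((2 : ℝ) ^ (-(k : ℤ)))).indicator fun x => φ (cubeAt k x)) p
            ((muAlpha d α).restrict (upperHalf d)) := by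
  obtain ⟨C, hC⟩ := exists_one_le_nuAlpha_layer α p
  refine ⟨C, fun k φ => ?_⟩
  set g : E d → ℝ≥0∞ := fun x : E d => φ (boundaryCube (cubeAt k x)) with hg
  have hgm : Measurable g := measurable_comp_cubeAt (fun Q => φ (boundaryCube Q)) k
  have h1 : (layer d ((2 : ℝ) ^ (-(k : ℤ)))).indicator (fun x => φ (cubeAt k x)) =
      (layer d ((2 : ℝ) ^ (-(k : ℤ)))).indicator (fun x => g (proj x)) := by
    refine Set.indicator_congr fun x hx => ?_
    rw [cubeAt_eq_boundaryCube hx.1 hx.2]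
  rw [h1]
  unfold layer
  rw [eLpNorm_layer d α measurableSet_Ioc _ hgm.aemeasurable, ← mul_assoc]
  · exact le_mul_of_one_le_left' (hC k)
  · simpa using nuAlpha_Ioc_ne_zero α (a := 0) (l := (2 : ℝ) ^ (-(k : ℤ))) le_rfl (by positivity)

/-! ### Integrals over sets exhausted by dyadic cubes -/

variable {n : ℕ}

lemma dist_le_of_forall_abs_le {x y : E n} {ε : ℝ} (hε : 0 ≤ ε) (h : ∀ i, |x i - y i| ≤ ε) :
    dist x y ≤ n * ε := by
  rw [EuclideanSpace.dist_eq]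
  refine Real.sqrt_le_iff.2 ⟨by positivity, ?_⟩
  calc ∑ i, dist (x i) (y i) ^ 2 ≤ ∑ _i : Fin n, ε ^ 2 := by
        gcongr with i
        exact h i
    _ = n * ε ^ 2 := by simp
    _ ≤ (n * ε) ^ 2 := by
      rw [mul_pow]
      gcongr
      rcases Nat.eq_zero_or_pos n with rfl | hn
      · simp
      · have : (1 : ℝ) ≤ n := by exact_mod_cast hn
        nlinarith

lemma abs_sub_le_dist (x y : E n) (i : Fin n) : |x i - y i| ≤ dist x y := by
  rw [EuclideanSpace.dist_eq]
  refine Real.le_sqrt_of_sq_le ?_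
  rw [sq_abs]
  have := Finset.single_le_sum (f := fun i => dist (x i) (y i) ^ 2)
    (fun i _ => sq_nonneg _) (Finset.mem_univ i)
  simpa [Real.dist_eq, sq_abs] using this

lemma dist_le_of_mem_cubeAt {k : ℤ} {x y : E n} (h : y ∈ (cubeAt k x).toSet) :
    dist y x ≤ n * (2 : ℝ) ^ (-k) := by
  refine dist_le_of_forall_abs_le (by positivity) fun i => ?_
  have h1 := h i
  rw [cubeAt_lo, cubeAt_hi] at h1
  have a1 := lo_lt k (x i)
  have a2 := le_hi k (x i)
  have := h1.1
  have := h1.2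
  rw [hi_eq] at *
  rw [abs_le]; constructor <;> linarith

/-- Small cubes around a point of an open set are contained in it. -/
lemma exists_cubeAt_subset {U : Set (E n)} (hU : IsOpen U) {x : E n} (hx : x ∈ U) :
    ∃ j0 : ℕ, ∀ j : ℕ, j0 ≤ j → (cubeAt j x).toSet ⊆ U := by
  obtain ⟨ε, hε, h⟩ := Metric.isOpen_iff.1 hU x hx
  obtain ⟨j0, hj0⟩ := exists_pow_lt_of_lt_one (show 0 < ε / (n + 1) by positivity)
    (show (1 / 2 : ℝ) < 1 by norm_num)
  refine ⟨j0, fun j hj y hy => h ?_⟩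
  rw [Metric.mem_ball]
  have h1 : (2 : ℝ) ^ (-(j : ℤ)) < ε / (n + 1) := by
    calc (2 : ℝ) ^ (-(j : ℤ)) ≤ (2 : ℝ) ^ (-(j0 : ℤ)) :=
          zpow_le_zpow_right₀ one_le_two (by omega)
      _ = (1 / 2 : ℝ) ^ j0 := by simp
      _ < _ := hj0
  calc dist y x ≤ n * (2 : ℝ) ^ (-(j : ℤ)) := dist_le_of_mem_cubeAt hy
    _ ≤ (n + 1) * (2 : ℝ) ^ (-(j : ℤ)) := by gcongr; linarith
    _ < (n + 1) * (ε / (n + 1)) := by gcongr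
    _ = ε := by field_simp

/-- If the averages of `f` over the cubes of high level inside `B` are close to `c`, then so is the
integral of `f - c` over `B`. Only averages of `f` enter, and the set `B` is exhausted by the
unions of the cubes of level `j` that it contains. -/
lemma enorm_setIntegral_sub_le {μ : Measure (E n)} (hfin : ∀ Q : DyadicCube n, μ Q.toSet ≠ ∞)
    {B : Set (E n)} (hB : ∀ y ∈ B, ∃ j0 : ℕ, ∀ j : ℕ, j0 ≤ j → (cubeAt j y).toSet ⊆ B)
    (hBfin : μ B ≠ ∞) {f : E n → ℂ} (hf : IntegrableOn f B μ) {c : ℂ} {g : E n → ℝ≥0∞} (k : ℕ)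
    (hg : ∀ j : ℕ, k ≤ j → ∀ y, (cubeAt j y).toSet ⊆ B →
      ‖(⨍ z in (cubeAt j y).toSet, f z ∂μ) - c‖ₑ ≤ g y) :
    ‖∫ y in B, (f y - c) ∂μ‖ₑ ≤ ∫⁻ y in B, g y ∂μ := by
  let S : ℕ → Set (E n) := fun j => {y | (cubeAt j y).toSet ⊆ B}
  have hSm : ∀ j, MeasurableSet (S j) := fun j =>
    (measurable_cubeAt (n := n) j) (MeasurableSet.of_discrete (s := {R : DyadicCube n | R.toSet ⊆ B}))
  have hmono : Monotone S := by
    intro i j hij y hy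
    exact (cubeAt_subset_of_le (by exact_mod_cast hij) y).trans hy
  have hSB : ∀ j, S j ⊆ B := fun j y hy => hy (mem_cubeAt j y)
  have hU : ⋃ j, S j = B := by
    refine Set.Subset.antisymm (Set.iUnion_subset hSB) fun y hy => ?_
    obtain ⟨j0, hj0⟩ := hB y hy
    exact Set.mem_iUnion.2 ⟨j0, hj0 j0 le_rfl⟩
  have hfc : IntegrableOn (fun y => f y - c) B μ := hf.sub (integrableOn_const hBfin)
  have hlim := tendsto_setIntegral_of_monotone hSm hmono (by rw [hU]; exact hfc)
  rw [hU] at hlim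
  refine le_of_tendsto (hlim.enorm) ?_
  filter_upwards [eventually_ge_atTop k] with j hj
  have hdec : S j = ⋃ Q : {Q : DyadicCube n // Q.level = (j : ℤ) ∧ Q.toSet ⊆ B}, Q.1.toSet := by
    ext y
    rw [Set.mem_iUnion]
    constructor
    · intro hy
      exact ⟨⟨cubeAt j y, rfl, hy⟩, mem_cubeAt j y⟩
    · rintro ⟨Q, hQ⟩
      have := DyadicCube.mem_toSet_iff.1 hQ
      rw [Q.2.1] at this
      change (cubeAt j y).toSet ⊆ B
      rw [this]; exact Q.2.2
  have hdisj : Pairwise (Function.onFun Disjoint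
      fun Q : {Q : DyadicCube n // Q.level = (j : ℤ) ∧ Q.toSet ⊆ B} => Q.1.toSet) := by
    rintro ⟨Q, hQ, _⟩ ⟨Q', hQ', _⟩ hne
    refine Set.disjoint_left.2 fun x hx hx' => hne ?_
    rw [DyadicCube.mem_toSet_iff] at hx hx'
    rw [Subtype.mk.injEq]
    dsimp only at hx hx'
    rw [← hx, ← hx', hQ, hQ']
  refine le_trans ?_ (lintegral_mono_set (hSB j))
  have hmeas := fun Q : {Q : DyadicCube n // Q.level = (j : ℤ) ∧ Q.toSet ⊆ B} =>
    Q.1.measurableSet_toSet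
  have hI : IntegrableOn (fun y => f y - c) (S j) μ := hfc.mono_set (hSB j)
  rw [hdec] at hI ⊢
  rw [integral_iUnion hmeas hdisj hI, lintegral_iUnion hmeas hdisj]
  refine enorm_tsum_le_tsum_enorm.trans (ENNReal.tsum_le_tsum fun Q => ?_)
  have hfQ : IntegrableOn f Q.1.toSet μ := hf.mono_set Q.2.2
  have h1 : ∫ y in Q.1.toSet, (f y - c) ∂μ =
      μ.real Q.1.toSet • ((⨍ y in Q.1.toSet, f y ∂μ) - c) := by
    rw [integral_sub hfQ (integrableOn_const (hfin _)), smul_sub, setIntegral_const,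
      measure_smul_setAverage _ (hfin _)]
  rw [h1, enorm_smul, Real.enorm_eq_ofReal (by positivity), Measure.real,
    ENNReal.ofReal_toReal (hfin _), mul_comm, ← setLIntegral_const]
  refine setLIntegral_mono' Q.1.measurableSet_toSet fun y hy => ?_
  have e := DyadicCube.mem_toSet_iff.1 hy
  rw [Q.2.1] at e
  have := hg j hj y (by rw [e]; exact Q.2.2)
  rwa [e] at this

end

section
/-! ### Averages over boundary cubes and over half-balls -/

variable {d : ℕ}

/-- The average of `u` over the boundary cube of level `k` above `x`. -/
noncomputable def bdryAvg (α : ℝ) (u : E (d + 1) → ℂ) (k : ℤ) (x : E d) : ℂ :=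
  ⨍ y in (boundaryCube (cubeAt k x)).toSet, u y ∂(muAlpha d α)

/-- The oscillation of `u` at the boundary cube of level `k` above `x`. -/
noncomputable def bdryOsc (α : ℝ) (u : E (d + 1) → ℂ) (k : ℤ) (x : E d) : ℝ≥0∞ :=
  osc (upperHalf d) (muAlpha d α) u (boundaryCube (cubeAt k x))

/-- The sum of the oscillations at the boundary cubes of level at least `k` above `x`. -/
noncomputable def bdryTail (α : ℝ) (u : E (d + 1) → ℂ) (k : ℕ) (x : E d) : ℝ≥0∞ :=
  ∑' i : ℕ, bdryOsc α u ((k + i : ℕ) : ℤ) x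

/-- The sum of the oscillations at the cubes of level at least `k` containing `y`. -/
noncomputable def oscTail (α : ℝ) (u : E (d + 1) → ℂ) (k : ℕ) (y : E (d + 1)) : ℝ≥0∞ :=
  ∑' i : ℕ, osc (upperHalf d) (muAlpha d α) u (cubeAt ((k + i : ℕ) : ℤ) y)

lemma measurable_bdryOsc (α : ℝ) (u : E (d + 1) → ℂ) (k : ℤ) : Measurable (bdryOsc α u k) :=
  measurable_comp_cubeAt (fun Q => osc (upperHalf d) (muAlpha d α) u (boundaryCube Q)) k

lemma measurable_bdryTail (α : ℝ) (u : E (d + 1) → ℂ) (k : ℕ) : Measurable (bdryTail α u k) :=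
  Measurable.tsum fun _ => measurable_bdryOsc α u _

lemma measurable_oscTail (α : ℝ) (u : E (d + 1) → ℂ) (k : ℕ) : Measurable (oscTail α u k) :=
  Measurable.tsum fun _ => measurable_comp_cubeAt (osc (upperHalf d) (muAlpha d α) u) _

lemma measurable_bdryAvg (α : ℝ) (u : E (d + 1) → ℂ) (k : ℤ) : Measurable (bdryAvg α u k) :=
  measurable_comp_cubeAt
    (fun Q => ⨍ y in (boundaryCube Q).toSet, u y ∂(muAlpha d α)) k

lemma bdryOsc_le_bdryTail (α : ℝ) (u : E (d + 1) → ℂ) (k : ℕ) (x : E d) :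
    bdryOsc α u k x ≤ bdryTail α u k x := by
  have := ENNReal.le_tsum (f := fun i : ℕ => bdryOsc α u ((k + i : ℕ) : ℤ) x) 0
  simpa [bdryTail] using this

lemma enorm_bdryAvg_sub_le (α : ℝ) (u : E (d + 1) → ℂ) {k k' : ℤ} (h1 : k ≤ k' + 1)
    (h2 : k' ≤ k + 1) (x : E d) :
    ‖bdryAvg α u k x - bdryAvg α u k' x‖ₑ ≤ bdryOsc α u k x :=
  le_osc (boundaryCube_neighbor (neighbor_cubeAt_self h1 h2 x)) (boundaryCube_subset _)

lemma enorm_avg_sub_le_oscTail (α : ℝ) (u : E (d + 1) → ℂ) {k j : ℕ} (hkj : k ≤ j)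
    {y : E (d + 1)} (hy : 0 < ht y) :
    ‖(⨍ z in (cubeAt j y).toSet, u z ∂(muAlpha d α)) -
      ⨍ z in (cubeAt k y).toSet, u z ∂(muAlpha d α)‖ₑ ≤ oscTail α u k y := by
  obtain ⟨i, rfl⟩ := Nat.exists_eq_add_of_le hkj
  let f : ℕ → ℂ := fun i => ⨍ z in (cubeAt ((k + i : ℕ) : ℤ) y).toSet, u z ∂(muAlpha d α)
  have h := edist_le_range_sum_of_edist_le (f := f)
    (d := fun i => osc (upperHalf d) (muAlpha d α) u (cubeAt ((k + i : ℕ) : ℤ) y)) i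
    (fun {m} _ => by
      rw [edist_eq_enorm_sub]
      exact le_osc (neighbor_cubeAt_self (by push_cast; omega) (by push_cast; omega) y)
        (cubeAt_subset_upperHalf hy _))
  rw [edist_eq_enorm_sub, enorm_sub_rev] at h
  exact h.trans (ENNReal.sum_le_tsum _)

lemma isOpen_upperHalf (d : ℕ) : IsOpen (upperHalf d) :=
  isOpen_lt continuous_const (by fun_prop)

@[simp] lemma bdry_castSucc (x : E d) (i : Fin d) : bdry x i.castSucc = x i := by simp [bdry]

@[simp] lemma bdry_last (x : E d) : bdry x (Fin.last d) = 0 := by simp [bdry]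

lemma neighbor_of_mem_ball {x : E d} {y : E (d + 1)} {r : ℝ} {k : ℤ}
    (hy : y ∈ Metric.ball (bdry x) r) (hr : r ≤ (2 : ℝ) ^ (-k)) :
    (cubeAt k x).Neighbor (cubeAt k (proj y)) := by
  rw [neighbor_cubeAt_iff]
  refine ⟨⟨by omega, by omega⟩, fun i => ?_⟩
  have h1 := (abs_sub_le_dist y (bdry x) i.castSucc).trans_lt (Metric.mem_ball.1 hy)
  rw [bdry_castSucc, abs_lt] at h1
  have a1 := lo_lt k (x i)
  have a2 := le_hi k (x i)
  have b1 := lo_lt k (proj y i)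
  have b2 := le_hi k (proj y i)
  rw [proj_apply] at *
  exact ⟨lo_le_hi_of_lt le_rfl le_rfl (by linarith), lo_le_hi_of_lt le_rfl le_rfl (by linarith)⟩

lemma ht_le_of_mem_ball {x : E d} {y : E (d + 1)} {r : ℝ} (hy : y ∈ Metric.ball (bdry x) r) :
    ht y ≤ r := by
  have h1 := (abs_sub_le_dist y (bdry x) (Fin.last d)).trans_lt (Metric.mem_ball.1 hy)
  rw [bdry_last, sub_zero] at h1
  exact (le_abs_self _).trans h1.le

lemma boundaryCube_subset_ball (x : E d) {k : ℤ} {r : ℝ} (hr : (d + 1) * (2 : ℝ) ^ (-k) < r) :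
    (boundaryCube (cubeAt k x)).toSet ⊆ Metric.ball (bdry x) r ∩ upperHalf d := by
  intro y hy
  refine ⟨?_, boundaryCube_subset _ hy⟩
  obtain ⟨h1, h2, h3⟩ := mem_boundaryCube.1 hy
  rw [Metric.mem_ball]
  refine lt_of_le_of_lt (dist_le_of_forall_abs_le (ε := (2 : ℝ) ^ (-k)) (by positivity)
    fun i => ?_) (by push_cast; exact hr)
  induction i using Fin.lastCases with
  | last => rw [bdry_last, sub_zero]; exact (abs_of_pos h2).le.trans h3
  | cast i =>
    have h4 := h1 i
    rw [cubeAt_lo, cubeAt_hi, proj_apply] at h4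
    have a1 := lo_lt k (x i)
    have a2 := le_hi k (x i)
    have := h4.1
    have := h4.2
    rw [bdry_castSucc]
    rw [hi_eq] at *
    rw [abs_le]; constructor <;> linarith

/-- Iterated doubling: the boundary cube `m` levels below still has comparable measure. -/
lemma measure_boundaryCube_le {α : ℝ} {C : ℝ≥0}
    (hD : DyadicDoubling (upperHalf d) (muAlpha d α) C) (x : E d) (k : ℤ) (m : ℕ) :
    muAlpha d α (boundaryCube (cubeAt k x)).toSet ≤
      C ^ m * muAlpha d α (boundaryCube (cubeAt (k + m) x)).toSet := by
  induction m with
  | zero => simp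
  | succ m ih =>
    refine ih.trans ?_
    rw [pow_succ, mul_assoc]
    gcongr
    refine le_trans (measure_mono fun y hy => ?_) (hD.doubling (k + m) _ (boundaryCube_subset _))
    refine ⟨boundaryCube_subset _ hy, ?_⟩
    have h1 := DyadicCube.mem_toSet_iff.1 hy
    simp only [boundaryCube_level, cubeAt_level] at h1
    change (cubeAt (k + m) y).Neighbor _
    rw [h1]
    exact boundaryCube_neighbor (neighbor_cubeAt_self (by push_cast; omega) (by push_cast; omega) x)

/-- The averages over the half-balls are close to those over the boundary cubes. -/
lemma exists_enorm_ballAvg_sub_le {α : ℝ} {C : ℝ≥0}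
    (hD : DyadicDoubling (upperHalf d) (muAlpha d α) C) :
    ∃ K : ℝ≥0, ∀ u : E (d + 1) → ℂ, LocInt (upperHalf d) (muAlpha d α) u →
      ∀ (k : ℕ) (r : ℝ), 0 < r → r ≤ (2 : ℝ) ^ (-(k : ℤ)) → (2 : ℝ) ^ (-(k : ℤ)) ≤ 2 * r →
      ∀ x : E d,
        ‖(⨍ y in Metric.ball (bdry x) r ∩ upperHalf d, u y ∂(muAlpha d α)) - bdryAvg α u k x‖ₑ ≤
          K * nbrSup (upperHalf d) (muAlpha d α) (oscTail α u k) (boundaryCube (cubeAt k x)) +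
            bdryOsc α u k x := by
  refine ⟨nbrCount d * C ^ (d + 2), fun u hu k r hr0 hr1 hr2 x => ?_⟩
  set μ := muAlpha d α with hμ
  set Ω := upperHalf d with hΩ
  set B := Metric.ball (bdry x) r ∩ Ω with hB
  set P := boundaryCube (cubeAt k x) with hP
  set G := nbrSup Ω μ (oscTail α u k) P with hG
  have hint : IntegrableOn u B μ := hu _ Metric.isBounded_ball
  -- A boundary cube `d + 2` levels finer fits into the half-ball, as `d + 1 < 2^(d+1)` and
  -- `2^{-k} ≤ 2r`. Hence the measure of the half-ball is comparable with that of `P`.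
  have hsub : (boundaryCube (cubeAt (k + (d + 2 : ℕ)) x)).toSet ⊆ B := by
    refine boundaryCube_subset_ball x ?_
    have h1 : ((d + 1 : ℕ) : ℝ) < (2 : ℝ) ^ (d + 1) := by exact_mod_cast Nat.lt_two_pow_self
    have h2 : (2 : ℝ) ^ (-((k : ℤ) + (d + 2 : ℕ))) =
        (2 : ℝ) ^ (-(k : ℤ)) * ((2 : ℝ) ^ (d + 2))⁻¹ := by
      rw [neg_add, zpow_add₀ two_ne_zero, zpow_neg, zpow_neg, zpow_natCast, zpow_natCast]
    rw [h2]
    have h3 : (0 : ℝ) < (2 : ℝ) ^ (-(k : ℤ)) := by positivity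
    push_cast at h1
    calc ((d : ℝ) + 1) * ((2 : ℝ) ^ (-(k : ℤ)) * ((2 : ℝ) ^ (d + 2))⁻¹)
        < (2 : ℝ) ^ (d + 1) * ((2 : ℝ) ^ (-(k : ℤ)) * ((2 : ℝ) ^ (d + 2))⁻¹) := by gcongr
      _ = (2 : ℝ) ^ (-(k : ℤ)) / 2 := by
        rw [pow_succ (2 : ℝ) (d + 1)]; field_simp
      _ ≤ r := by linarith
  have hPB : μ P.toSet ≤ C ^ (d + 2) * μ B :=
    (measure_boundaryCube_le hD x k (d + 2)).trans (by gcongr)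
  have hB0 : μ B ≠ 0 := by
    intro h
    have := hD.measure_ne_zero (boundaryCube (cubeAt (k + (d + 2 : ℕ)) x)) (boundaryCube_subset _)
    exact this (measure_mono_null hsub h)
  -- The half-ball is covered by the boundary cubes neighboring `P`.
  have hcov : ∀ y ∈ B, y ∈ (boundaryCube (cubeAt k (proj y))).toSet ∧
      cubeAt k y = boundaryCube (cubeAt k (proj y)) ∧
      (cubeAt k x).Neighbor (cubeAt k (proj y)) := by
    intro y hy
    have h1 : 0 < ht y := hy.2
    have h2 := (ht_le_of_mem_ball hy.1).trans hr1
    have h3 := cubeAt_eq_boundaryCube h1 h2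
    exact ⟨h3 ▸ mem_cubeAt _ y, h3, neighbor_of_mem_ball hy.1 hr1⟩
  let ι := {Q : DyadicCube d // Q.level = (k : ℤ) ∧ (cubeAt k x).Neighbor Q}
  have hBsub : B ⊆ ⋃ Q : ι, (boundaryCube Q.1).toSet := fun y hy =>
    Set.mem_iUnion.2 ⟨⟨cubeAt k (proj y), rfl, (hcov y hy).2.2⟩, (hcov y hy).1⟩
  -- All boundary cubes of one level have the same measure.
  have hμQ : ∀ Q : ι, μ (boundaryCube Q.1).toSet = μ P.toSet := by
    intro Q
    have : Q.1.len = (cubeAt (k : ℤ) x).len := by simp [DyadicCube.len, Q.2.1]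
    rw [hμ, hP, muAlpha_boundaryCube, muAlpha_boundaryCube, Q.1.volume_toSet,
      (cubeAt (k : ℤ) x).volume_toSet, this]
  have hθ : ∫⁻ y in B, oscTail α u k y ∂μ ≤ nbrCount d * (μ P.toSet * G) := by
    refine (lintegral_mono_set hBsub).trans ((lintegral_iUnion_le _ _).trans ?_)
    refine tsum_neighbor_le (fun Q : ι => Q.1) Subtype.val_injective (cubeAt k x) _ _
      (fun Q => ?_) (fun Q _ => Q.2.2)
    have h1 : ⨍⁻ y in (boundaryCube Q.1).toSet, oscTail α u k y ∂μ ≤ G :=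
      le_nbrSup (boundaryCube_neighbor Q.2.2) (boundaryCube_subset _)
    rw [← measure_mul_setLAverage _ (hD.measure_ne_top _), hμQ Q]
    gcongr
  have hBfin : μ B ≠ ∞ := by
    refine ne_top_of_le_ne_top ?_ ((measure_mono hBsub).trans ((measure_iUnion_le _).trans
      (tsum_neighbor_le (fun Q : ι => Q.1) Subtype.val_injective (cubeAt k x) _ (μ P.toSet)
        (fun Q => (hμQ Q).le) (fun Q _ => Q.2.2))))
    exact ENNReal.mul_ne_top (by simp) (hD.measure_ne_top _)
  -- On a cube of `B` of level `j ≥ k`, the average of `u` is compared with that over its ancestor of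
  -- level `k`, which is a boundary cube neighboring `P`.
  have hmain : ‖∫ y in B, (u y - bdryAvg α u k x) ∂μ‖ₑ ≤
      ∫⁻ y in B, (oscTail α u k y + bdryOsc α u k x) ∂μ := by
    refine enorm_setIntegral_sub_le hD.measure_ne_top (fun y hy => ?_) hBfin hint k
      (fun j hj y hy => ?_)
    · exact exists_cubeAt_subset (Metric.isOpen_ball.inter (isOpen_upperHalf d)) hy
    · have hyB := hy (mem_cubeAt _ y)
      obtain ⟨-, h2, h3⟩ := hcov y hyB
      have e1 := enorm_avg_sub_le_oscTail α u hj (y := y) hyB.2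
      have e2 : ‖(⨍ z in (cubeAt k y).toSet, u z ∂μ) - bdryAvg α u k x‖ₑ ≤ bdryOsc α u k x := by
        rw [enorm_sub_rev, h2]
        exact le_osc (boundaryCube_neighbor h3) (boundaryCube_subset _)
      refine le_trans ?_ (add_le_add e1 e2)
      rw [← edist_eq_enorm_sub, ← edist_eq_enorm_sub, ← edist_eq_enorm_sub]
      exact edist_triangle _ _ _
  rw [enorm_setAverage_sub hB0 hBfin hint]
  rw [lintegral_add_left (measurable_oscTail α u k), setLIntegral_const] at hmain
  calc (μ B)⁻¹ * ‖∫ y in B, (u y - bdryAvg α u k x) ∂μ‖ₑ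
      ≤ (μ B)⁻¹ * (nbrCount d * (C ^ (d + 2) * μ B * G) + bdryOsc α u k x * μ B) := by
        gcongr
        refine hmain.trans (add_le_add (hθ.trans ?_) le_rfl)
        gcongr
    _ = ((μ B)⁻¹ * μ B) * (nbrCount d * C ^ (d + 2) * G + bdryOsc α u k x) := by ring
    _ = _ := by rw [ENNReal.inv_mul_cancel hB0 hBfin, one_mul]; push_cast; ring

/-- Convergence along `r → 0+` from estimates at the dyadic scales comparable with `r`. -/
lemma tendsto_of_dyadic_bound {F : ℝ → ℂ} {c : ℂ} {a : ℕ → ℝ≥0∞} (ha : Tendsto a atTop (𝓝 0))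
    (h : ∀ (k : ℕ) (r : ℝ), 0 < r → r ≤ (2 : ℝ) ^ (-(k : ℤ)) → (2 : ℝ) ^ (-(k : ℤ)) ≤ 2 * r →
      ‖F r - c‖ₑ ≤ a k) : Tendsto F (𝓝[>] 0) (𝓝 c) := by
  rw [EMetric.tendsto_nhds]
  intro ε hε
  obtain ⟨N, hN⟩ := eventually_atTop.1 (ha.eventually_lt_const hε)
  have h0 : (0 : ℝ) < (1 / 2) ^ (N + 1) := by positivity
  filter_upwards [Ioo_mem_nhdsGT h0] with r hr
  have hr1 : r < 1 := hr.2.trans_le (pow_le_one₀ (by norm_num) (by norm_num))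
  obtain ⟨k, hk1, hk2⟩ := exists_nat_pow_near_of_lt_one hr.1 hr1.le (y := (1 / 2 : ℝ))
    (by norm_num) (by norm_num)
  have e : (2 : ℝ) ^ (-(k : ℤ)) = (1 / 2 : ℝ) ^ k := by simp
  have hNk : N ≤ k := by
    by_contra hlt
    have : (1 / 2 : ℝ) ^ (N + 1) ≤ (1 / 2) ^ (k + 1) :=
      pow_le_pow_of_le_one (by norm_num) (by norm_num) (by omega)
    have := hr.2
    linarith
  rw [edist_eq_enorm_sub]
  refine (h k r hr.1 (by rw [e]; exact hk2) ?_).trans_lt (hN k hNk)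
  rw [e]
  rw [pow_succ] at hk1
  linarith

end

section
/-! ### The trace -/

variable {d : ℕ}

lemma tsum_pw_ne_top {ε : ℝ} (hε : 0 < ε) : ∑' k : ℕ, pw (-(k * ε)) ≠ ∞ := by
  have : ∀ k : ℕ, pw (-(k * ε)) = pw (-ε) ^ k := fun k => by
    rw [← pw_mul_natCast]; congr 1; ring
  simp_rw [this]
  rw [ENNReal.tsum_geometric, Ne, ENNReal.inv_eq_top, tsub_eq_zero_iff_le, not_le]
  exact pw_lt_one (by linarith)

lemma pw_mul_levelEnergy_le {n : ℕ} {Ω : Set (E n)} {μ : Measure (E n)} {s : ℝ} {p q : ℝ≥0∞}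
    (hq : 0 < q) (u : E n → ℂ) (k : ℕ) :
    pw (k * s) * levelEnergy Ω μ p u k ≤ besovNorm Ω μ s p q u :=
  (le_ellNorm hq (fun k : ℕ => pw (k * s) * levelEnergy Ω μ p u k) k).trans le_add_self

lemma levelEnergy_le_pw_mul {n : ℕ} {Ω : Set (E n)} {μ : Measure (E n)} {s : ℝ} {p q : ℝ≥0∞}
    (hq : 0 < q) (u : E n → ℂ) (k : ℕ) :
    levelEnergy Ω μ p u k ≤ pw (-(k * s)) * besovNorm Ω μ s p q u := by
  calc levelEnergy Ω μ p u k = pw (-(k * s)) * (pw (k * s) * levelEnergy Ω μ p u k) := by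
        rw [← mul_assoc, ← pw_add, neg_add_cancel, pw_zero, one_mul]
    _ ≤ _ := by gcongr; exact pw_mul_levelEnergy_le hq u k

lemma exists_eLpNorm_bdryOsc_le {α : ℝ} (hα : -1 < α) {p : ℝ≥0∞} (hp : 1 ≤ p) :
    ∃ C : ℝ≥0, ∀ (u : E (d + 1) → ℂ) (k : ℕ),
      eLpNorm (bdryOsc α u k) p ≤ C * pw (k * ((α + 1) * (1 / p).toReal)) *
        levelEnergy (upperHalf d) (muAlpha d α) p u k := by
  obtain ⟨C, hC⟩ := exists_eLpNorm_boundaryCube_le d α p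
  obtain ⟨D, hD⟩ := dyadicDoubling_muAlpha d hα
  refine ⟨C, fun u k => (hC k (osc (upperHalf d) (muAlpha d α) u)).trans ?_⟩
  gcongr
  refine le_trans (eLpNorm_mono_ennreal fun x => ?_) (eLpNorm_osc_le hD hp u k)
  exact Set.indicator_le_self _ _ x

lemma exists_eLpNorm_bdry_nbrSup_le {α : ℝ} (hα : -1 < α) {p : ℝ≥0∞} (hp : 1 ≤ p) :
    ∃ C : ℝ≥0, ∀ (k : ℕ) (h : E (d + 1) → ℝ≥0∞), AEMeasurable h (muAlpha d α) →
      eLpNorm (fun x : E d => nbrSup (upperHalf d) (muAlpha d α) h (boundaryCube (cubeAt k x))) p ≤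
        C * pw (k * ((α + 1) * (1 / p).toReal)) *
          eLpNorm h p ((muAlpha d α).restrict (upperHalf d)) := by
  obtain ⟨C, hC⟩ := exists_eLpNorm_boundaryCube_le d α p
  obtain ⟨D, hD⟩ := dyadicDoubling_muAlpha d hα
  refine ⟨C * (3 * (D + 1)), fun k h hh =>
    (hC k (nbrSup (upperHalf d) (muAlpha d α) h)).trans ?_⟩
  have h1 := eLpNorm_nbrSup_le hD hp (h := h) hh.restrict k
  calc _ ≤ C * pw (k * ((α + 1) * (1 / p).toReal)) *
        ((3 * (D + 1) : ℝ≥0) * eLpNorm h p ((muAlpha d α).restrict (upperHalf d))) := by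
        gcongr
        exact le_trans (eLpNorm_mono_ennreal fun x => Set.indicator_le_self _ _ x) h1
    _ = _ := by push_cast; ring

lemma exists_eLpNorm_bdryTail_le {α : ℝ} (hα : -1 < α) {p : ℝ≥0∞} (hp : 1 ≤ p) :
    ∃ C : ℝ≥0, ∀ (u : E (d + 1) → ℂ) (k : ℕ),
      eLpNorm (bdryTail α u k) p ≤ C * ∑' i : ℕ, pw ((k + i : ℕ) * ((α + 1) * (1 / p).toReal)) *
        levelEnergy (upperHalf d) (muAlpha d α) p u (k + i) := by
  obtain ⟨C, hC⟩ := exists_eLpNorm_bdryOsc_le (d := d) hα hp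
  refine ⟨C, fun u k => ?_⟩
  refine (eLpNorm_tsum_le (fun i => (measurable_bdryOsc α u _).aemeasurable) hp).trans ?_
  rw [← ENNReal.tsum_mul_left]
  refine ENNReal.tsum_le_tsum fun i => (hC u (k + i)).trans (le_of_eq ?_)
  rw [mul_assoc]

/-- For a function of the weighted Besov space, almost everywhere the averages over half-balls and
over boundary cubes converge to the trace, with a quantitative bound for the latter. -/
lemma trace_spec {α : ℝ} (hα : -1 < α) {p q : ℝ≥0∞} (hp : 1 ≤ p) (hq : 0 < q) {s : ℝ}
    (hs : (α + 1) * (1 / p).toReal < s) {u : E (d + 1) → ℂ}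
    (hu : u ∈ besovSpace (upperHalf d) (muAlpha d α) s p q) :
    ∀ᵐ x : E d, HasTraceAt (muAlpha d α) u x (trace (muAlpha d α) u x) ∧
      Tendsto (fun k : ℕ => bdryAvg α u k x) atTop (𝓝 (trace (muAlpha d α) u x)) ∧
      ∀ k : ℕ, ‖bdryAvg α u k x - trace (muAlpha d α) u x‖ₑ ≤ bdryTail α u k x := by
  set μ := muAlpha d α with hμ
  set Ω := upperHalf d with hΩ
  set β := (α + 1) * (1 / p).toReal with hβ
  set N := besovNorm Ω μ s p q u with hN
  have hβ0 : 0 ≤ β := mul_nonneg (by linarith) (one_div_toReal_nonneg p)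
  have hNtop : N ≠ ∞ := hu.2.ne
  obtain ⟨C₁, hC₁⟩ := exists_eLpNorm_bdryOsc_le (d := d) hα hp
  obtain ⟨C₂, hC₂⟩ := exists_eLpNorm_bdry_nbrSup_le (d := d) hα hp
  obtain ⟨D, hD⟩ := dyadicDoubling_muAlpha d hα
  obtain ⟨K, hK⟩ := exists_enorm_ballAvg_sub_le hD
  have hE : ∀ k, levelEnergy Ω μ p u k ≤ pw (-(k * s)) * N := levelEnergy_le_pw_mul hq u
  have hσ : ∑' k : ℕ, pw (-(k * (s - β))) ≠ ∞ := tsum_pw_ne_top (by linarith)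
  have hs' : ∑' k : ℕ, pw (-(k * s)) ≠ ∞ := tsum_pw_ne_top (by linarith)
  -- Passing to boundary cubes of level `k` costs `2^{kβ}`, so the sums below are dominated by
  -- geometric series of ratio `2^{-(s-β)}`.
  have hsum1 : ∑' k : ℕ, eLpNorm (bdryOsc α u k) p ≠ ∞ := by
    refine ne_top_of_le_ne_top ?_ (ENNReal.tsum_le_tsum fun k => (hC₁ u k).trans
      (mul_le_mul_right (hE k) _))
    have : ∀ k : ℕ, C₁ * pw (k * β) * (pw (-(k * s)) * N) = (C₁ * N) * pw (-(k * (s - β))) := by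
      intro k
      rw [show -(k * (s - β)) = k * β + -(k * s) by ring, pw_add]; ring
    refine (tsum_congr this).trans_ne ?_
    rw [ENNReal.tsum_mul_left]
    exact ENNReal.mul_ne_top (ENNReal.mul_ne_top (by simp) hNtop) hσ
  have hθ : ∀ k : ℕ, eLpNorm (oscTail α u k) p (μ.restrict Ω) ≤
      pw (-(k * s)) * (N * ∑' i : ℕ, pw (-(i * s))) := by
    intro k
    refine (eLpNorm_tsum_le (fun i => (measurable_comp_cubeAt (osc Ω μ u) _).aemeasurable)
      hp).trans ?_
    rw [← ENNReal.tsum_mul_left, ← ENNReal.tsum_mul_left]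
    refine ENNReal.tsum_le_tsum fun i => (eLpNorm_osc_le hD hp u (k + i)).trans
      ((hE (k + i)).trans (le_of_eq ?_))
    rw [show -(((k + i : ℕ) : ℝ) * s) = -(k * s) + -(i * s) by push_cast; ring, pw_add]
    ring
  have hsum2 : ∑' k : ℕ, eLpNorm (fun x : E d =>
      nbrSup Ω μ (oscTail α u k) (boundaryCube (cubeAt k x))) p ≠ ∞ := by
    refine ne_top_of_le_ne_top ?_ (ENNReal.tsum_le_tsum fun k =>
      (hC₂ k _ (measurable_oscTail α u k).aemeasurable).trans (mul_le_mul_right (hθ k) _))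
    have : ∀ k : ℕ, C₂ * pw (k * β) * (pw (-(k * s)) * (N * ∑' i : ℕ, pw (-(i * s)))) =
        (C₂ * (N * ∑' i : ℕ, pw (-(i * s)))) * pw (-(k * (s - β))) := by
      intro k
      rw [show -(k * (s - β)) = k * β + -(k * s) by ring, pw_add]; ring
    refine (tsum_congr this).trans_ne ?_
    rw [ENNReal.tsum_mul_left]
    exact ENNReal.mul_ne_top (ENNReal.mul_ne_top (by simp) (ENNReal.mul_ne_top hNtop hs')) hσ
  have hae1 : ∀ᵐ x : E d, ∑' k : ℕ, bdryOsc α u k x < ∞ :=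
    ae_lt_top_of_eLpNorm_ne_top
      (AEMeasurable.tsum fun k => (measurable_bdryOsc α u k).aemeasurable) hp
      (ne_top_of_le_ne_top hsum1 (eLpNorm_tsum_le
        (fun k : ℕ => (measurable_bdryOsc α u k).aemeasurable) hp))
  have hae2 := ae_tendsto_zero_of_tsum_eLpNorm (fun k : ℕ => (measurable_comp_cubeAt
    (fun Q => nbrSup Ω μ (oscTail α u k) (boundaryCube Q)) k).aemeasurable) hp hsum2
  filter_upwards [hae1, hae2] with x hx1 hx2
  have hstep : ∀ k : ℕ, edist (bdryAvg α u k x) (bdryAvg α u (k + 1 : ℕ) x) ≤ bdryOsc α u k x := by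
    intro k
    rw [edist_eq_enorm_sub]
    exact enorm_bdryAvg_sub_le α u (by push_cast; omega) (by push_cast; omega) x
  obtain ⟨c, hc⟩ := cauchySeq_tendsto_of_complete
    (cauchySeq_of_edist_le_of_tsum_ne_top (f := fun k : ℕ => bdryAvg α u k x) _ hstep hx1.ne)
  have htrace : HasTraceAt μ u x c := by
    have h0 : Tendsto (fun k : ℕ => bdryOsc α u k x) atTop (𝓝 0) :=
      ENNReal.tendsto_atTop_zero_of_tsum_ne_top hx1.ne
    have h1 : Tendsto (fun k : ℕ => ‖bdryAvg α u k x - c‖ₑ) atTop (𝓝 0) := by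
      simp_rw [← edist_eq_enorm_sub]
      exact tendsto_iff_edist_tendsto_0.1 hc
    have h2 := ENNReal.Tendsto.const_mul (a := (K : ℝ≥0∞)) hx2 (Or.inr (by simp))
    have h3 := (h2.add h0).add h1
    simp only [mul_zero, add_zero] at h3
    refine tendsto_of_dyadic_bound h3 fun k r hr0 hr1 hr2 => ?_
    refine le_trans ?_ (add_le_add (hK u hu.1 k r hr0 hr1 hr2 x) le_rfl)
    rw [← edist_eq_enorm_sub, ← edist_eq_enorm_sub, ← edist_eq_enorm_sub]
    exact edist_triangle _ _ _
  have heq : trace μ u x = c := htrace.limUnder_eq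
  rw [heq]
  refine ⟨htrace, hc, fun k => ?_⟩
  have := edist_le_tsum_of_edist_le_of_tendsto (f := fun k : ℕ => bdryAvg α u k x)
    (fun k : ℕ => bdryOsc α u k x) hstep hc k
  rw [edist_eq_enorm_sub] at this
  exact this

lemma eLpNorm_enorm_eq {γ : Type*} [MeasurableSpace γ] {μ : Measure γ} (p : ℝ≥0∞) (f : γ → ℂ) :
    eLpNorm (fun x => ‖f x‖ₑ) p μ = eLpNorm f p μ :=
  le_antisymm (eLpNorm_mono_enorm (by simp)) (eLpNorm_mono_enorm (by simp))

lemma integrableOn_of_isBounded {n : ℕ} {f : E n → ℂ} (hf : LocallyIntegrable f) {B : Set (E n)}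
    (hB : Bornology.IsBounded B) : IntegrableOn f B :=
  (hf.integrableOn_isCompact hB.isCompact_closure).mono_set subset_closure

lemma isBounded_toSet {n : ℕ} (Q : DyadicCube n) : Bornology.IsBounded Q.toSet := by
  rw [← Q.cubeAt_corner]
  exact Metric.isBounded_closedBall.subset fun y hy => Metric.mem_closedBall.2
    (dist_le_of_mem_cubeAt hy)

lemma exists_eLpNorm_trace_le {α : ℝ} (hα : -1 < α) {p q : ℝ≥0∞} (hp : 1 ≤ p) (hq : 0 < q) {s : ℝ}
    (hs : (α + 1) * (1 / p).toReal < s) :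
    ∃ C : ℝ≥0, ∀ u ∈ besovSpace (upperHalf d) (muAlpha d α) s p q,
      eLpNorm (trace (muAlpha d α) u) p volume ≤
        C * besovNorm (upperHalf d) (muAlpha d α) s p q u := by
  obtain ⟨C₁, hC₁⟩ := exists_eLpNorm_bdryTail_le (d := d) hα hp
  obtain ⟨C₂, hC₂⟩ := exists_eLpNorm_bdry_nbrSup_le (d := d) hα hp
  obtain ⟨D, hD⟩ := dyadicDoubling_muAlpha d hα
  set β := (α + 1) * (1 / p).toReal with hβ
  have hσ : ∑' k : ℕ, pw (-(k * (s - β))) ≠ ∞ := tsum_pw_ne_top (by linarith)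
  refine ⟨C₂ + C₁ * (∑' k : ℕ, pw (-(k * (s - β)))).toNNReal, fun u hu => ?_⟩
  rw [ENNReal.coe_add, ENNReal.coe_mul, ENNReal.coe_toNNReal hσ]
  set μ := muAlpha d α with hμ
  set Ω := upperHalf d with hΩ
  set N := besovNorm Ω μ s p q u with hN
  -- The norm alone does not provide measurability; it comes from integrability on the balls.
  have hum : AEMeasurable (fun y => ‖u y‖ₑ) μ := by
    have : AEStronglyMeasurable u (μ.restrict Ω) := by
      have h1 : Ω = ⋃ r : ℕ, Metric.ball (0 : E (d + 1)) r ∩ Ω := by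
        rw [← Set.iUnion_inter, Metric.iUnion_ball_nat, Set.univ_inter]
      rw [h1, aestronglyMeasurable_iUnion_iff]
      exact fun r => (hu.1 _ Metric.isBounded_ball).aestronglyMeasurable
    rw [hμ, hΩ, muAlpha_restrict_upperHalf] at this
    exact this.enorm
  have h0 : eLpNorm (fun x => ‖bdryAvg α u (0 : ℕ) x‖ₑ) p volume ≤ C₂ * N := by
    have h1 := hC₂ 0 (fun y => ‖u y‖ₑ) hum
    rw [eLpNorm_enorm_eq, show pw (((0 : ℕ) : ℝ) * β) = 1 by simp [pw_zero], mul_one] at h1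
    refine le_trans (eLpNorm_mono_ennreal fun x => ?_) (h1.trans ?_)
    · refine le_trans ?_ (le_nbrSup (DyadicCube.Neighbor.refl _) (boundaryCube_subset _))
      have h2 := enorm_setAverage_sub_le (hD.measure_ne_zero _ (boundaryCube_subset
        (cubeAt (0 : ℕ) x))) (hD.measure_ne_top _) (g := u) ?_ 0
      · simpa [bdryAvg] using h2
      · have := hu.1 _ (isBounded_toSet (boundaryCube (cubeAt (0 : ℕ) x)))
        rwa [Set.inter_eq_left.2 (boundaryCube_subset _)] at this
    · gcongr
      exact le_self_add
  have h1 : eLpNorm (bdryTail α u 0) p volume ≤ C₁ * (∑' k : ℕ, pw (-(k * (s - β)))) * N := by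
    refine (hC₁ u 0).trans ?_
    rw [mul_assoc, ← ENNReal.tsum_mul_right]
    refine mul_le_mul_right (ENNReal.tsum_le_tsum fun i => ?_) _
    rw [zero_add]
    calc _ ≤ pw (i * β) * (pw (-(i * s)) * N) := by gcongr; exact levelEnergy_le_pw_mul hq u i
      _ = _ := by rw [← mul_assoc, ← pw_add]; congr 2; ring
  calc eLpNorm (trace μ u) p volume
      ≤ eLpNorm (fun x => ‖bdryAvg α u (0 : ℕ) x‖ₑ + bdryTail α u 0 x) p volume := by
        refine eLpNorm_mono_enorm_ae ?_
        filter_upwards [trace_spec hα hp hq hs hu] with x hx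
        rw [enorm_eq_self]
        have h2 := hx.2.2 0
        rw [enorm_sub_rev] at h2
        refine le_trans ?_ (add_le_add le_rfl h2)
        calc ‖trace μ u x‖ₑ = ‖bdryAvg α u (0 : ℕ) x + (trace μ u x - bdryAvg α u (0 : ℕ) x)‖ₑ := by
              congr 1; ring
          _ ≤ _ := enorm_add_le _ _
    _ ≤ _ := eLpNorm_add_le_ennreal (measurable_bdryAvg α u _).enorm.aemeasurable
        (measurable_bdryTail α u 0).aemeasurable hp
    _ ≤ C₂ * N + C₁ * (∑' k : ℕ, pw (-(k * (s - β)))) * N := add_le_add h0 h1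
    _ = _ := by ring

lemma locallyIntegrable_trace {α : ℝ} (hα : -1 < α) {p q : ℝ≥0∞} (hp : 1 ≤ p) (hq : 0 < q) {s : ℝ}
    (hs : (α + 1) * (1 / p).toReal < s) {u : E (d + 1) → ℂ}
    (hu : u ∈ besovSpace (upperHalf d) (muAlpha d α) s p q) :
    LocallyIntegrable (trace (muAlpha d α) u) := by
  obtain ⟨C, hC⟩ := exists_eLpNorm_trace_le (d := d) hα hp hq hs
  have hspec := trace_spec hα hp hq hs hu
  have hm : AEStronglyMeasurable (trace (muAlpha d α) u) volume :=
    aestronglyMeasurable_of_tendsto_ae atTop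
      (fun k : ℕ => (measurable_bdryAvg α u k).aestronglyMeasurable) (hspec.mono fun x hx => hx.2.1)
  exact MemLp.locallyIntegrable ⟨hm, (hC u hu).trans_lt
    (ENNReal.mul_lt_top (by simp) hu.2)⟩ hp

/-- The dyadic energies of the trace are controlled by those of the function at finer levels. -/
lemma exists_levelEnergy_trace_le {α : ℝ} (hα : -1 < α) {p q : ℝ≥0∞} (hp : 1 ≤ p) (hq : 0 < q)
    {s : ℝ} (hs : (α + 1) * (1 / p).toReal < s) :
    ∃ C : ℝ≥0, ∀ u ∈ besovSpace (upperHalf d) (muAlpha d α) s p q, ∀ k : ℕ,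
      levelEnergy Set.univ volume p (trace (muAlpha d α) u) k ≤
        C * ∑' i : ℕ, pw ((k + i : ℕ) * ((α + 1) * (1 / p).toReal)) *
          levelEnergy (upperHalf d) (muAlpha d α) p u (k + i) := by
  obtain ⟨C₁, hC₁⟩ := exists_eLpNorm_bdryTail_le (d := d) hα hp
  refine ⟨nbrCount d * (4 * (3 * (5 ^ d + 1)) + 1) * C₁, fun u hu k => ?_⟩
  set μ := muAlpha d α with hμ
  set Ω := upperHalf d with hΩ
  have hV := dyadicDoubling_volume d
  have hspec := trace_spec hα hp hq hs hu
  have hloc := locallyIntegrable_trace hα hp hq hs hu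
  set τ := bdryTail α u k with hτ
  have hτm : Measurable τ := measurable_bdryTail α u k
  -- On a cube of level `k` or `k ± 1`, the trace is close to the average over the boundary cube.
  have hclose : ∀ (x z : E d) (k' : ℤ), (cubeAt k x).Neighbor (cubeAt k' z) →
      ‖(⨍ y in (cubeAt k' z).toSet, trace μ u y) - bdryAvg α u k' z‖ₑ ≤
        2 * nbrSup Set.univ volume τ (cubeAt k x) := by
    intro x z k' hn
    have hlev := (neighbor_cubeAt_iff.1 hn).1
    set Q := cubeAt k' z with hQ
    refine (enorm_setAverage_sub_le (volume_toSet_ne_zero Q) (volume_toSet_ne_top Q)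
      (integrableOn_of_isBounded hloc (isBounded_toSet Q)) _).trans ?_
    refine le_trans ?_ (mul_le_mul_right (le_nbrSup hn (Set.subset_univ _)) 2)
    rw [setLAverage_eq, setLAverage_eq, ← mul_div_assoc, ← lintegral_const_mul _ hτm]
    gcongr 1
    refine lintegral_mono_ae ?_
    filter_upwards [ae_restrict_of_ae hspec, ae_restrict_mem Q.measurableSet_toSet] with y hy hyQ
    have h1 : bdryAvg α u k' z = bdryAvg α u k' y := by
      have := mem_cubeAt_iff.1 hyQ
      unfold bdryAvg
      rw [this]
    have h2 := enorm_bdryAvg_sub_le α u (k := k) (k' := k') (by omega) (by omega) y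
    have h3 := hy.2.2 k
    rw [h1, two_mul]
    refine le_trans ?_ (add_le_add h3 (h2.trans (bdryOsc_le_bdryTail α u k y)))
    rw [enorm_sub_rev (bdryAvg α u k y)]
    rw [← edist_eq_enorm_sub, ← edist_eq_enorm_sub, ← edist_eq_enorm_sub]
    exact edist_triangle _ _ _
  have hE := levelEnergy_le hV hp (u := trace μ u) (k := k)
    (g := fun x => (4 : ℝ≥0) * nbrSup Set.univ volume τ (cubeAt k x) + τ x) ?_
  · refine hE.trans ?_
    rw [Measure.restrict_univ]
    have hm1 := measurable_comp_cubeAt (nbrSup (Set.univ : Set (E d)) volume τ) k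
    have h1 := eLpNorm_nbrSup_le hV hp (h := τ) hτm.aemeasurable k
    rw [Measure.restrict_univ] at h1
    calc _ ≤ nbrCount d * (((4 : ℝ≥0) : ℝ≥0∞) *
          ((3 * (5 ^ d + 1) : ℝ≥0) * eLpNorm τ p volume) + eLpNorm τ p volume) := by
          gcongr
          refine (eLpNorm_add_le_ennreal (hm1.const_mul _).aemeasurable
            hτm.aemeasurable hp).trans ?_
          gcongr
          refine (eLpNorm_const_mul_le _ _ hp).trans ?_
          gcongr
      _ = nbrCount d * (4 * (3 * (5 ^ d + 1)) + 1) * eLpNorm τ p volume := by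
          push_cast; ring
      _ ≤ _ := by
          rw [ENNReal.coe_mul, mul_assoc _ (C₁ : ℝ≥0∞)]
          exact mul_le_mul' (le_of_eq (by push_cast; ring)) (hC₁ u k)
  · intro x _ Q' hn _
    have hQ' : Q' = cubeAt Q'.level Q'.corner := Q'.cubeAt_corner.symm
    have h1 := hclose x x k (DyadicCube.Neighbor.refl _)
    have h2 := hclose x Q'.corner Q'.level (by rwa [← hQ'])
    rw [← hQ'] at h2
    have h3 : ‖bdryAvg α u k x - bdryAvg α u Q'.level Q'.corner‖ₑ ≤ τ x := by
      refine le_trans ?_ (bdryOsc_le_bdryTail α u k x)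
      unfold bdryAvg
      rw [← hQ']
      exact le_osc (boundaryCube_neighbor hn) (boundaryCube_subset _)
    rw [enorm_sub_rev] at h2
    rw [← edist_eq_enorm_sub] at *
    refine (edist_triangle4 _ _ _ _).trans ((add_le_add (add_le_add h1 h3) h2).trans
      (le_of_eq ?_))
    push_cast; ring

/-- Boundedness of the trace operator. -/
lemma exists_besovNorm_trace_le {α : ℝ} (hα : -1 < α) {p q : ℝ≥0∞} (hp : 1 ≤ p) (hq : 0 < q)
    {s : ℝ} (hs : (α + 1) * (1 / p).toReal < s) :
    ∃ C : ℝ≥0, ∀ u ∈ besovSpace (upperHalf d) (muAlpha d α) s p q,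
      besovNorm Set.univ volume (s - (α + 1) * (1 / p).toReal) p q (trace (muAlpha d α) u) ≤
        C * besovNorm (upperHalf d) (muAlpha d α) s p q u := by
  obtain ⟨C₁, hC₁⟩ := exists_eLpNorm_trace_le (d := d) hα hp hq hs
  obtain ⟨C₂, hC₂⟩ := exists_levelEnergy_trace_le (d := d) hα hp hq hs
  set β := (α + 1) * (1 / p).toReal with hβ
  obtain ⟨C₃, hC₃⟩ := exists_ellNorm_conv_le hq (r := pw (-(s - β))) (pw_lt_one (by linarith))
  refine ⟨C₁ + C₃ * C₂, fun u hu => ?_⟩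
  set μ := muAlpha d α with hμ
  set Ω := upperHalf d with hΩ
  have h1 : ellNorm q (fun k : ℕ => pw (k * (s - β)) *
      levelEnergy Set.univ volume p (trace μ u) k) ≤
      C₃ * ellNorm q (fun k : ℕ => C₂ * (pw (k * s) * levelEnergy Ω μ p u k)) := by
    refine hC₃ _ _ fun k => ?_
    have hinj : Function.Injective fun i : ℕ => k + i := fun a b h => by simpa using h
    refine le_trans ?_ (ENNReal.tsum_comp_le_tsum_of_injective hinj _)
    calc pw (k * (s - β)) * levelEnergy Set.univ volume p (trace μ u) k
        ≤ pw (k * (s - β)) * (C₂ * ∑' i : ℕ, pw ((k + i : ℕ) * β) *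
            levelEnergy Ω μ p u (k + i)) := by gcongr; exact hC₂ u hu k
      _ = ∑' i : ℕ, pw (k * (s - β)) * (C₂ * (pw ((k + i : ℕ) * β) *
            levelEnergy Ω μ p u (k + i))) := by rw [ENNReal.tsum_mul_left, ENNReal.tsum_mul_left]
      _ ≤ _ := by
        refine ENNReal.tsum_le_tsum fun i => le_of_eq ?_
        rw [show (k + i - k) + (k - (k + i)) = i by omega, ← pw_mul_natCast]
        have : pw (-(s - β) * i) * pw ((k + i : ℕ) * s) =
            pw (k * (s - β)) * pw ((k + i : ℕ) * β) := by
          rw [← pw_add, ← pw_add]; congr 1; push_cast; ring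
        calc _ = C₂ * (pw (k * (s - β)) * pw ((k + i : ℕ) * β)) *
              levelEnergy Ω μ p u (k + i) := by ring
          _ = _ := by rw [← this]; ring
  rw [ellNorm_const_mul hq] at h1
  unfold besovNorm
  rw [Measure.restrict_univ, ENNReal.coe_add, add_mul]
  refine add_le_add (hC₁ u hu) (h1.trans ?_)
  rw [← mul_assoc, ENNReal.coe_mul]
  gcongr
  exact le_add_self

end

section
/-! ### Pointwise estimates for the Whitney extension -/

variable {d : ℕ}

/-- The height `t` belongs to the `j`-th dyadic layer `(2^{-j}, 2^{1-j}]`; the zeroth layer is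
unbounded above. -/
def InLayer (j : ℕ) (t : ℝ) : Prop :=
  (2 : ℝ) ^ (-(j : ℤ)) < t ∧ (t ≤ 2 * (2 : ℝ) ^ (-(j : ℤ)) ∨ j = 0)

lemma exists_inLayer {t : ℝ} (ht : 0 < t) : ∃ j, InLayer j t := by
  rcases le_or_gt t 1 with h | h
  · obtain ⟨n, hn1, hn2⟩ := exists_nat_pow_near_of_lt_one ht h (y := (1 / 2 : ℝ))
      (by norm_num) (by norm_num)
    have e : (2 : ℝ) ^ (-((n + 1 : ℕ) : ℤ)) = (1 / 2 : ℝ) ^ (n + 1) := by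
      rw [zpow_neg, zpow_natCast, one_div, inv_pow]
    refine ⟨n + 1, ?_, Or.inl ?_⟩
    · rw [e]; exact hn1
    · rw [e, pow_succ]; linarith
  · exact ⟨0, by simpa using h, Or.inr rfl⟩

lemma InLayer.pos {j : ℕ} {t : ℝ} (h : InLayer j t) : 0 < t :=
  lt_trans (by positivity) h.1

lemma two_zpow_neg_eq {a b : ℤ} (m : ℕ) (hm : a + m = b) :
    (2 : ℝ) ^ (-a) = 2 ^ m * (2 : ℝ) ^ (-b) := by
  rw [← zpow_natCast, ← zpow_add₀ two_ne_zero]; congr 1; omega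

/-- Heights that differ at most by a factor two belong to layers that differ at most by one. -/
lemma InLayer.le_add_one {j j' : ℕ} {t t' : ℝ} (h : InLayer j t) (h' : InLayer j' t')
    (htt : t < 2 * t') : j' ≤ j + 1 := by
  by_contra hlt
  have h0 : t' ≤ 2 * (2 : ℝ) ^ (-(j' : ℤ)) := h'.2.resolve_right (by omega)
  have h1 : (2 : ℝ) ^ (-(j' : ℤ)) ≤ (2 : ℝ) ^ (-((j : ℤ) + 2)) :=
    zpow_le_zpow_right₀ one_le_two (by omega)
  have h2 := two_zpow_neg_eq (a := j) (b := (j : ℤ) + 2) 2 (by omega)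
  have h3 := h.1
  rw [h2] at h3
  linarith

/-- The average of `f` over a cube of `ℝ^d`. -/
noncomputable def cavg (f : E d → ℂ) (Q : DyadicCube d) : ℂ := ⨍ y in Q.toSet, f y

variable {ψ : SmallCube d → E (d + 1) → ℝ}

lemma exists_mem_whitneyBox (hψ : IsWhitneyPartition d ψ) {R : SmallCube d} {x : E (d + 1)}
    (h : ψ R x ≠ 0) : ∃ w ∈ whitneyBox R.1, dist x w < R.1.len / 4 :=
  Metric.mem_thickening_iff.1 (hψ.support R (subset_tsupport _ h))

/-- The support of `ψ_R` stays within `ℓ(R)/4` of the heights `(ℓ(R), 2ℓ(R)]`. -/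
lemma psi_ht_bounds (hψ : IsWhitneyPartition d ψ) {R : SmallCube d} {x : E (d + 1)}
    (h : ψ R x ≠ 0) : 3 / 4 * R.1.len < ht x ∧ ht x < 9 / 4 * R.1.len := by
  obtain ⟨w, hw, hd⟩ := exists_mem_whitneyBox hψ h
  have h1 := (abs_sub_le_dist x w (Fin.last d)).trans_lt hd
  have h2 := hw.2.1
  have h3 := hw.2.2
  rw [abs_lt] at h1
  unfold ht
  constructor <;> linarith

/-- Above a point only bump functions of cubes near its projection are active. -/
lemma psi_neighbor (hψ : IsWhitneyPartition d ψ) {R : SmallCube d} {x : E (d + 1)} {j : ℕ}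
    (hj : InLayer j (ht x)) (h : ψ R x ≠ 0) : (cubeAt j (proj x)).Neighbor R.1 := by
  obtain ⟨w, hw, hd⟩ := exists_mem_whitneyBox hψ h
  obtain ⟨hb1, hb2⟩ := psi_ht_bounds hψ h
  have hR : cubeAt R.1.level (proj w) = R.1 := DyadicCube.mem_toSet_iff.1 (fun i => hw.1 i)
  set l := R.1.level with hl
  have hlen : R.1.len = (2 : ℝ) ^ (-l) := rfl
  have hl0 : 0 ≤ l := R.2
  rw [hlen] at hb1 hb2 hd
  have e1 : (j : ℤ) ≤ l + 1 := by
    by_contra hlt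
    have h0 : ht x ≤ 2 * (2 : ℝ) ^ (-(j : ℤ)) := hj.2.resolve_right (by omega)
    have h1 : (2 : ℝ) ^ (-(j : ℤ)) ≤ (2 : ℝ) ^ (-(l + 2)) :=
      zpow_le_zpow_right₀ one_le_two (by omega)
    have h2 := two_zpow_neg_eq (a := l) (b := l + 2) 2 (by omega)
    have h3 : (0 : ℝ) < (2 : ℝ) ^ (-(l + 2)) := by positivity
    rw [h2] at hb1
    linarith
  have e2 : l ≤ (j : ℤ) + 1 := by
    by_contra hlt
    have h1 : (2 : ℝ) ^ (-l) ≤ (2 : ℝ) ^ (-((j : ℤ) + 2)) :=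
      zpow_le_zpow_right₀ one_le_two (by omega)
    have h2 := two_zpow_neg_eq (a := j) (b := (j : ℤ) + 2) 2 (by omega)
    have h3 : (0 : ℝ) < (2 : ℝ) ^ (-((j : ℤ) + 2)) := by positivity
    have h4 := hj.1
    rw [h2] at h4
    linarith
  rw [← hR, neighbor_cubeAt_iff]
  refine ⟨⟨e1, e2⟩, fun i => ?_⟩
  have h1 := (abs_sub_le_dist x w i.castSucc).trans_lt hd
  rw [← proj_apply, ← proj_apply, abs_lt] at h1
  have a1 := lo_lt j (proj x i)
  have a2 := le_hi j (proj x i)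
  have b1 := lo_lt l (proj w i)
  have b2 := le_hi l (proj w i)
  -- The radius `ℓ(R)/4` is smaller than the grid scale of both cubes, so that cubes at this
  -- distance already touch.
  have h5 : (2 : ℝ) ^ (-l) / 4 ≤ (2 : ℝ) ^ (-max (j : ℤ) l) := by
    have h6 : (2 : ℝ) ^ (-(l + 1)) ≤ (2 : ℝ) ^ (-max (j : ℤ) l) :=
      zpow_le_zpow_right₀ one_le_two (by omega)
    have h7 := two_zpow_neg_eq (a := l) (b := l + 1) 1 (by omega)
    have h8 : (0 : ℝ) < (2 : ℝ) ^ (-(l + 1)) := by positivity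
    rw [h7]
    linarith
  exact ⟨lo_le_hi_of_lt (le_max_left _ _) (le_max_right _ _) (by linarith),
    lo_le_hi_of_lt (le_max_right _ _) (le_max_left _ _) (by linarith)⟩

lemma psi_support_finite (hψ : IsWhitneyPartition d ψ) (x : E (d + 1)) :
    (Function.support fun R => ψ R x).Finite := by
  rcases le_or_gt (ht x) 0 with h | h
  · convert Set.finite_empty
    refine Set.eq_empty_of_forall_notMem fun R hR => ?_
    have := (psi_ht_bounds hψ hR).1
    have := R.1.len_pos
    linarith
  · obtain ⟨j, hj⟩ := exists_inLayer h
    obtain ⟨s, -, hs⟩ := exists_finset_neighbor (cubeAt j (proj x))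
    refine (s.finite_toSet.preimage (Subtype.val_injective (p := fun Q : DyadicCube d =>
      0 ≤ Q.level)).injOn).subset fun R hR => hs _ (psi_neighbor hψ hj hR)

lemma hasSum_whitneyExt (hψ : IsWhitneyPartition d ψ) (f : E d → ℂ) (x : E (d + 1)) :
    HasSum (fun R : SmallCube d => cavg f R.1 * (ψ R x : ℂ)) (whitneyExt ψ f x) := by
  refine Summable.hasSum (summable_of_hasFiniteSupport ?_)
  refine (psi_support_finite hψ x).subset fun R hR => ?_
  rw [Function.mem_support] at *
  intro h
  simp [h] at hR

lemma hasSum_psi (hψ : IsWhitneyPartition d ψ) (x : E (d + 1)) :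
    HasSum (fun R : SmallCube d => (ψ R x : ℂ)) ((∑' R, ψ R x : ℝ) : ℂ) := by
  rw [Complex.hasSum_ofReal]
  exact (summable_of_hasFiniteSupport (psi_support_finite hψ x)).hasSum

/-- The Whitney boxes of the cubes of edge length at most one exhaust the heights in `(0, 2]`. -/
lemma tsum_psi_eq_one (hψ : IsWhitneyPartition d ψ) {x : E (d + 1)} (h0 : 0 < ht x)
    (h2 : ht x ≤ 2) : ∑' R, ψ R x = 1 := by
  obtain ⟨j, hj⟩ := exists_inLayer h0
  refine hψ.sum_eq_one x (Set.mem_iUnion.2 ⟨⟨cubeAt j (proj x), by simp⟩, fun i => ?_, ?_⟩)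
  · exact mem_cubeAt j (proj x) i
  · refine ⟨hj.1, ?_⟩
    rcases hj.2 with h | rfl
    · exact h
    · refine h2.trans (le_of_eq ?_)
      change (2 : ℝ) = 2 * (2 : ℝ) ^ (-((0 : ℕ) : ℤ))
      simp

lemma enorm_psi_le_one (hψ : IsWhitneyPartition d ψ) (R : SmallCube d) (x : E (d + 1)) :
    ‖(ψ R x : ℂ)‖ₑ ≤ 1 := by
  have h := hψ.mem_Icc R x
  rw [← ofReal_norm, Complex.norm_real, Real.norm_of_nonneg h.1]
  simpa using h.2

lemma measurable_whitneyExt (hψ : IsWhitneyPartition d ψ) (f : E d → ℂ) :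
    Measurable (whitneyExt ψ f) := by
  unfold whitneyExt
  exact Measurable.tsum fun R => (Complex.measurable_ofReal.comp
    (hψ.smooth R).continuous.measurable).const_mul _

/-- The bump functions of the largest cubes, of edge length one, vanish above the height `9/4`. -/
lemma whitneyExt_eq_zero (hψ : IsWhitneyPartition d ψ) (f : E d → ℂ) {x : E (d + 1)}
    (h : 9 / 4 ≤ ht x) : whitneyExt ψ f x = 0 := by
  have : ∀ R, ψ R x = 0 := by
    intro R
    by_contra hne
    have h1 := (psi_ht_bounds hψ hne).2
    have h2 : R.1.len ≤ 1 := zpow_le_one_of_nonpos₀ one_le_two (by simpa using R.2)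
    linarith
  simp [whitneyExt, this]

/-- The oscillation of `f` on `ℝ^d`. -/
noncomputable abbrev osc₀ (f : E d → ℂ) (Q : DyadicCube d) : ℝ≥0∞ := osc Set.univ volume f Q

/-- The largest average over a neighboring cube of `ℝ^d`. -/
noncomputable abbrev nbrSup₀ (h : E d → ℝ≥0∞) (Q : DyadicCube d) : ℝ≥0∞ :=
  nbrSup Set.univ volume h Q

lemma enorm_cavg_sub_le (f : E d → ℂ) {Q R : DyadicCube d} (h : Q.Neighbor R) :
    ‖cavg f R - cavg f Q‖ₑ ≤ osc₀ f Q := by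
  rw [enorm_sub_rev]
  exact le_osc h (Set.subset_univ _)

lemma enorm_cavg_le {f : E d → ℂ} (hf : LocallyIntegrable f) {Q R : DyadicCube d}
    (h : Q.Neighbor R) : ‖cavg f R‖ₑ ≤ nbrSup₀ (fun y => ‖f y‖ₑ) Q := by
  refine le_trans ?_ (le_nbrSup h (Set.subset_univ _))
  simpa [cavg] using enorm_setAverage_sub_le (volume_toSet_ne_zero R) (volume_toSet_ne_top R)
    (integrableOn_of_isBounded hf (isBounded_toSet R)) 0

/-- Up to the height `2`, the extension is a convex combination of averages over the neighbors of
the cube of its own scale below the point. -/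
lemma enorm_whitneyExt_sub_le (hψ : IsWhitneyPartition d ψ) (f : E d → ℂ) {x : E (d + 1)} {j : ℕ}
    (hj : InLayer j (ht x)) (h2 : ht x ≤ 2) :
    ‖whitneyExt ψ f x - cavg f (cubeAt j (proj x))‖ₑ ≤
      nbrCount d * osc₀ f (cubeAt j (proj x)) := by
  set c := cavg f (cubeAt j (proj x)) with hc
  have h1 := (hasSum_whitneyExt hψ f x).sub ((hasSum_psi hψ x).mul_left c)
  rw [tsum_psi_eq_one hψ hj.pos h2, Complex.ofReal_one, mul_one] at h1
  rw [← h1.tsum_eq]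
  refine enorm_tsum_le_tsum_enorm.trans (tsum_neighbor_le (fun R : SmallCube d => R.1)
    Subtype.val_injective (cubeAt j (proj x)) _ _ (fun R => ?_) (fun R hR => ?_))
  · rw [← sub_mul, enorm_mul]
    by_cases h0 : ψ R x = 0
    · simp [h0]
    · calc _ ≤ osc₀ f (cubeAt j (proj x)) * 1 := by
            gcongr
            · exact enorm_cavg_sub_le f (psi_neighbor hψ hj h0)
            · exact enorm_psi_le_one hψ R x
        _ = _ := mul_one _
  · refine psi_neighbor hψ hj fun h0 => ?_
    simp [h0] at hR

lemma enorm_whitneyExt_le (hψ : IsWhitneyPartition d ψ) {f : E d → ℂ} (hf : LocallyIntegrable f)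
    {x : E (d + 1)} {j : ℕ} (hj : InLayer j (ht x)) :
    ‖whitneyExt ψ f x‖ₑ ≤ nbrCount d * nbrSup₀ (fun y => ‖f y‖ₑ) (cubeAt j (proj x)) := by
  rw [← (hasSum_whitneyExt hψ f x).tsum_eq]
  refine enorm_tsum_le_tsum_enorm.trans (tsum_neighbor_le (fun R : SmallCube d => R.1)
    Subtype.val_injective (cubeAt j (proj x)) _ _ (fun R => ?_) (fun R hR => ?_))
  · rw [enorm_mul]
    by_cases h0 : ψ R x = 0
    · simp [h0]
    · calc _ ≤ nbrSup₀ (fun y => ‖f y‖ₑ) (cubeAt j (proj x)) * 1 := by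
            gcongr
            · exact enorm_cavg_le hf (psi_neighbor hψ hj h0)
            · exact enorm_psi_le_one hψ R x
        _ = _ := mul_one _
  · refine psi_neighbor hψ hj fun h0 => ?_
    simp [h0] at hR

/-- The differences of the bump functions at two points in neighboring Whitney boxes. -/
lemma exists_psi_sub_le (hψ : IsWhitneyPartition d ψ) :
    ∃ K : ℝ≥0, ∀ (x z : E (d + 1)) (j j' : ℕ), InLayer j (ht x) → InLayer j' (ht z) →
      (cubeAt j (proj x)).Neighbor (cubeAt j' (proj z)) → ∀ (g : SmallCube d → ℂ) (M : ℝ≥0∞),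
      (∀ R, (cubeAt j (proj x)).Neighbor R.1 ∨ (cubeAt j' (proj z)).Neighbor R.1 → ‖g R‖ₑ ≤ M) →
      ∑' R, ‖g R * ((ψ R x : ℂ) - ψ R z)‖ₑ ≤
        K * ENNReal.ofReal ((2 : ℝ) ^ (j : ℤ) * dist x z) * M := by
  obtain ⟨C, hC⟩ := hψ.lipschitz
  refine ⟨2 * nbrCount d * (4 * C), fun x z j j' hj hj' hn g M hg => ?_⟩
  classical
  set Qx := cubeAt j (proj x) with hQx
  set Qz := cubeAt j' (proj z) with hQz
  set L : ℝ≥0∞ := M * ENNReal.ofReal (4 * C * ((2 : ℝ) ^ (j : ℤ) * dist x z)) with hL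
  have hlev := (neighbor_cubeAt_iff.1 hn).1
  have hterm : ∀ R, (Qx.Neighbor R.1 ∨ Qz.Neighbor R.1) →
      ‖g R * ((ψ R x : ℂ) - ψ R z)‖ₑ ≤ L := by
    intro R hR
    rw [enorm_mul, hL]
    gcongr
    · exact hg R hR
    · have hR2 : R.1.level ≤ j + 2 := by
        rcases hR with h | h
        · have := (DyadicCube.neighbor_iff.1 h).1.2
          rw [hQx, cubeAt_level] at this; omega
        · have := (DyadicCube.neighbor_iff.1 h).1.2
          rw [hQz, cubeAt_level] at this; omega
      have h1 := (hC R).dist_le_mul x z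
      rw [← Complex.ofReal_sub, ← ofReal_norm, Complex.norm_real, ← dist_eq_norm]
      refine ENNReal.ofReal_le_ofReal ?_
      refine h1.trans ?_
      rw [NNReal.coe_div, Real.coe_toNNReal _ R.1.len_pos.le]
      have h2 : (1 : ℝ) / R.1.len ≤ 4 * (2 : ℝ) ^ (j : ℤ) := by
        have : (1 : ℝ) / R.1.len = (2 : ℝ) ^ R.1.level := by
          unfold DyadicCube.len; rw [zpow_neg, one_div, inv_inv]
        rw [this]
        calc (2 : ℝ) ^ R.1.level ≤ (2 : ℝ) ^ ((j : ℤ) + 2) :=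
              zpow_le_zpow_right₀ one_le_two hR2
          _ = _ := by rw [zpow_add₀ two_ne_zero]; norm_num; ring
      calc (C : ℝ) / R.1.len * dist x z = C * (1 / R.1.len) * dist x z := by ring
        _ ≤ C * (4 * (2 : ℝ) ^ (j : ℤ)) * dist x z := by gcongr
        _ = _ := by ring
  have h0 : ∀ R, ‖g R * ((ψ R x : ℂ) - ψ R z)‖ₑ ≤
      (if Qx.Neighbor R.1 then L else 0) + (if Qz.Neighbor R.1 then L else 0) := by
    intro R
    by_cases h1 : Qx.Neighbor R.1
    · rw [if_pos h1]
      exact (hterm R (Or.inl h1)).trans le_self_add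
    · by_cases h2 : Qz.Neighbor R.1
      · rw [if_pos h2]
        exact (hterm R (Or.inr h2)).trans le_add_self
      · have e1 : ψ R x = 0 := by
          by_contra h; exact h1 (psi_neighbor hψ hj h)
        have e2 : ψ R z = 0 := by
          by_contra h; exact h2 (psi_neighbor hψ hj' h)
        simp [e1, e2]
  have hsum : ∀ Q : DyadicCube d,
      ∑' R : SmallCube d, (if Q.Neighbor R.1 then L else 0) ≤ nbrCount d * L := fun Q =>
    tsum_neighbor_le (fun R : SmallCube d => R.1) Subtype.val_injective Q _ L
      (fun R => by split_ifs <;> simp) (fun R hR => by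
        by_contra h; simp [h] at hR)
  calc _ ≤ ∑' R : SmallCube d, ((if Qx.Neighbor R.1 then L else 0) +
        (if Qz.Neighbor R.1 then L else 0)) := ENNReal.tsum_le_tsum h0
    _ ≤ nbrCount d * L + nbrCount d * L := by
        rw [ENNReal.tsum_add]; exact add_le_add (hsum _) (hsum _)
    _ = _ := by
        rw [hL, ENNReal.ofReal_mul (by positivity), ENNReal.ofReal_mul (by positivity)]
        push_cast
        rw [ENNReal.ofReal_coe_nnreal]
        simp
        ring

/-- Lipschitz estimate for the Whitney extension at points of neighboring Whitney boxes. The last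
term accounts for the region above the boxes, where the bump functions do not add up to one. -/
lemma exists_enorm_whitneyExt_sub_le (hψ : IsWhitneyPartition d ψ) :
    ∃ K : ℝ≥0, ∀ (f : E d → ℂ) (x z : E (d + 1)) (j j' : ℕ), InLayer j (ht x) →
      InLayer j' (ht z) → (cubeAt j (proj x)).Neighbor (cubeAt j' (proj z)) →
      ‖whitneyExt ψ f x - whitneyExt ψ f z‖ₑ ≤
        K * ENNReal.ofReal ((2 : ℝ) ^ (j : ℤ) * dist x z) *
          (osc₀ f (cubeAt j (proj x)) + osc₀ f (cubeAt j' (proj z)) +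
            if ht x ≤ 2 ∧ ht z ≤ 2 then 0 else ‖cavg f (cubeAt j (proj x))‖ₑ) := by
  obtain ⟨K, hK⟩ := exists_psi_sub_le hψ
  refine ⟨K, fun f x z j j' hj hj' hn => ?_⟩
  -- Subtracting a constant from `f` changes the extension by a multiple of the sum of the bump
  -- functions, which is constant as long as both points are at height at most `2`.
  set c := cavg f (cubeAt j (proj x)) with hc
  have hx := (hasSum_whitneyExt hψ f x).sub ((hasSum_psi hψ x).mul_left c)
  have hz := (hasSum_whitneyExt hψ f z).sub ((hasSum_psi hψ z).mul_left c)
  have h1 := hx.sub hz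
  have h2 := ((hasSum_psi hψ x).sub (hasSum_psi hψ z)).mul_left c
  have e : whitneyExt ψ f x - whitneyExt ψ f z =
      (∑' R : SmallCube d, (cavg f R.1 - c) * ((ψ R x : ℂ) - ψ R z)) +
        if ht x ≤ 2 ∧ ht z ≤ 2 then 0 else ∑' R : SmallCube d, c * ((ψ R x : ℂ) - ψ R z) := by
    have h3 := h1.tsum_eq
    simp_rw [show ∀ R : SmallCube d, cavg f R.1 * (ψ R x : ℂ) - c * ψ R x -
      (cavg f R.1 * ψ R z - c * ψ R z) = (cavg f R.1 - c) * ((ψ R x : ℂ) - ψ R z) from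
      fun R => by ring] at h3
    split_ifs with hh
    · rw [tsum_psi_eq_one hψ hj.pos hh.1, tsum_psi_eq_one hψ hj'.pos hh.2] at h3
      rw [h3]; push_cast; ring
    · rw [h3, h2.tsum_eq]; ring
  have hA := hK x z j j' hj hj' hn (fun R => cavg f R.1 - c)
    (osc₀ f (cubeAt j (proj x)) + osc₀ f (cubeAt j' (proj z))) (fun R hR => by
      rcases hR with h | h
      · exact (enorm_cavg_sub_le f h).trans le_self_add
      · have a1 := enorm_cavg_sub_le f h
        have a2 := enorm_cavg_sub_le f hn
        rw [← edist_eq_enorm_sub] at *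
        rw [add_comm]
        exact (edist_triangle _ _ _).trans (add_le_add a1 a2))
  rw [e, mul_add]
  refine (enorm_add_le _ _).trans (add_le_add (enorm_tsum_le_tsum_enorm.trans hA) ?_)
  split_ifs
  · simp
  · exact enorm_tsum_le_tsum_enorm.trans (hK x z j j' hj hj' hn (fun _ => c) ‖c‖ₑ
      (fun _ _ => le_rfl))

end

section
/-! ### The extension near the boundary and its `L^p` norm -/

variable {d : ℕ} {ψ : SmallCube d → E (d + 1) → ℝ}

lemma eLpNorm_const_mul_le_of_ne_top {γ : Type*} [MeasurableSpace γ] {μ : Measure γ} {p : ℝ≥0∞}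
    {c : ℝ≥0∞} (hc : c ≠ ∞) (g : γ → ℝ≥0∞) (hp : 1 ≤ p) :
    eLpNorm (fun x => c * g x) p μ ≤ c * eLpNorm g p μ := by
  lift c to ℝ≥0 using hc
  exact eLpNorm_const_mul_le c g hp

/-- The distance of the extension from the average of `f` over the cube of level `k` below, at
heights at most `2^{-k}`. -/
noncomputable def extDev (ψ : SmallCube d → E (d + 1) → ℝ) (f : E d → ℂ) (k : ℕ)
    (x : E (d + 1)) : ℝ≥0∞ :=
  (layer d ((2 : ℝ) ^ (-(k : ℤ)))).indicator
    (fun x => ‖whitneyExt ψ f x - cavg f (cubeAt k (proj x))‖ₑ) x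

lemma measurable_extDev (hψ : IsWhitneyPartition d ψ) (f : E d → ℂ) (k : ℕ) :
    Measurable (extDev ψ f k) :=
  ((measurable_whitneyExt hψ f).sub
    ((measurable_comp_cubeAt (cavg f) k).comp measurable_proj)).enorm.indicator
      (measurableSet_layer _)

/-- Telescoping over the levels between `k` and that of the height of `x`. -/
lemma extDev_le (hψ : IsWhitneyPartition d ψ) (f : E d → ℂ) (k : ℕ) (x : E (d + 1)) :
    extDev ψ f k x ≤ ∑' i : ℕ, (layer d (4 * (2 : ℝ) ^ (-((k + i : ℕ) : ℤ)))).indicator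
      (fun x => nbrCount d * osc₀ f (cubeAt ((k + i : ℕ) : ℤ) (proj x))) x := by
  unfold extDev
  by_cases hx : x ∈ layer d ((2 : ℝ) ^ (-(k : ℤ)))
  swap
  · rw [Set.indicator_of_notMem hx]; exact zero_le
  rw [Set.indicator_of_mem hx]
  have ht0 := (mem_layer.1 hx).1
  have ht1 := (mem_layer.1 hx).2
  obtain ⟨j, hj⟩ := exists_inLayer ht0
  have hkj : k < j := by
    have := (zpow_lt_zpow_iff_right₀ (one_lt_two (α := ℝ))).1 (hj.1.trans_le ht1)
    omega
  have htj : ht x ≤ 2 * (2 : ℝ) ^ (-(j : ℤ)) := hj.2.resolve_right (by omega)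
  have ht2 : ht x ≤ 2 := by
    have : (2 : ℝ) ^ (-(k : ℤ)) ≤ 1 := zpow_le_one_of_nonpos₀ one_le_two (by omega)
    linarith
  obtain ⟨i, rfl⟩ := Nat.exists_eq_add_of_le hkj.le
  have hN : (1 : ℝ≥0∞) ≤ nbrCount d := by exact_mod_cast nbrCount_pos d
  have h1 := edist_le_range_sum_of_edist_le
    (f := fun i => cavg f (cubeAt ((k + i : ℕ) : ℤ) (proj x)))
    (d := fun i => nbrCount d * osc₀ f (cubeAt ((k + i : ℕ) : ℤ) (proj x))) i (fun {m} _ => by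
      rw [edist_eq_enorm_sub, enorm_sub_rev]
      exact (enorm_cavg_sub_le f (neighbor_cubeAt_self (by push_cast; omega)
        (by push_cast; omega) _)).trans (le_mul_of_one_le_left' hN))
  have h2 := enorm_whitneyExt_sub_le hψ f hj ht2
  calc _ ≤ ∑ m ∈ Finset.range i, nbrCount d * osc₀ f (cubeAt ((k + m : ℕ) : ℤ) (proj x)) +
        nbrCount d * osc₀ f (cubeAt ((k + i : ℕ) : ℤ) (proj x)) := by
        rw [add_comm]
        refine le_trans ?_ (add_le_add h2 h1)
        rw [← edist_eq_enorm_sub, ← edist_eq_enorm_sub, add_zero]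
        rw [edist_comm (cavg f (cubeAt (k : ℤ) (proj x)))]
        exact edist_triangle _ _ _
    _ = ∑ m ∈ Finset.range (i + 1), nbrCount d *
          osc₀ f (cubeAt ((k + m : ℕ) : ℤ) (proj x)) := (Finset.sum_range_succ _ _).symm
    _ = ∑ m ∈ Finset.range (i + 1), (layer d (4 * (2 : ℝ) ^ (-((k + m : ℕ) : ℤ)))).indicator
          (fun x => nbrCount d * osc₀ f (cubeAt ((k + m : ℕ) : ℤ) (proj x))) x := by
        refine Finset.sum_congr rfl fun m hm => ?_
        rw [Set.indicator_of_mem]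
        rw [Finset.mem_range] at hm
        have h3 : (2 : ℝ) ^ (-((k + i : ℕ) : ℤ)) ≤ (2 : ℝ) ^ (-((k + m : ℕ) : ℤ)) :=
          zpow_le_zpow_right₀ one_le_two (by omega)
        have h4 : (0 : ℝ) < (2 : ℝ) ^ (-((k + m : ℕ) : ℤ)) := by positivity
        exact mem_layer.2 ⟨ht0, by linarith⟩
    _ ≤ _ := ENNReal.sum_le_tsum _

lemma eLpNorm_osc₀_le {p : ℝ≥0∞} (hp : 1 ≤ p) (f : E d → ℂ) (k : ℕ) :
    eLpNorm (fun x => osc₀ f (cubeAt k x)) p ≤ levelEnergy Set.univ volume p f k := by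
  simpa using eLpNorm_osc_le (dyadicDoubling_volume d) hp f k

lemma eLpNorm_nbrSup₀_le {p : ℝ≥0∞} (hp : 1 ≤ p) {h : E d → ℝ≥0∞} (hh : AEMeasurable h)
    (k : ℤ) :
    eLpNorm (fun x => nbrSup₀ h (cubeAt k x)) p ≤ (3 * (5 ^ d + 1) : ℝ≥0) * eLpNorm h p := by
  simpa using eLpNorm_nbrSup_le (dyadicDoubling_volume d) hp (h := h) (by simpa using hh) k

lemma exists_eLpNorm_extDev_le {α : ℝ} (hα : -1 < α) {p : ℝ≥0∞} (hp : 1 ≤ p)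
    (hψ : IsWhitneyPartition d ψ) :
    ∃ C : ℝ≥0, ∀ (f : E d → ℂ) (k : ℕ),
      eLpNorm (extDev ψ f k) p ((muAlpha d α).restrict (upperHalf d)) ≤
        C * ∑' i : ℕ, pw (-((k + i : ℕ) * ((α + 1) * (1 / p).toReal))) *
          levelEnergy Set.univ volume p f (k + i) := by
  obtain ⟨C, hC⟩ := exists_eLpNorm_layer_le d hα p
  refine ⟨C * nbrCount d, fun f k => ?_⟩
  have hm : ∀ i : ℕ, Measurable fun y : E d => nbrCount d * osc₀ f (cubeAt ((k + i : ℕ) : ℤ) y) :=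
    fun i => (measurable_comp_cubeAt (osc₀ f) _).const_mul _
  refine (eLpNorm_mono_ennreal (extDev_le hψ f k)).trans ((eLpNorm_tsum_le (fun i =>
    (((hm i).comp measurable_proj).indicator (measurableSet_layer _)).aemeasurable) hp).trans ?_)
  rw [← ENNReal.tsum_mul_left]
  refine ENNReal.tsum_le_tsum fun i => (hC (k + i) _ (hm i).aemeasurable).trans ?_
  calc _ ≤ C * pw (-((k + i : ℕ) * ((α + 1) * (1 / p).toReal))) *
        (nbrCount d * levelEnergy Set.univ volume p f (k + i)) := by
        gcongr
        refine (eLpNorm_const_mul_le_of_ne_top (by simp) _ hp).trans ?_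
        gcongr
        exact eLpNorm_osc₀_le hp f (k + i)
    _ = _ := by push_cast; ring

lemma LocInt.locallyIntegrable {n : ℕ} {f : E n → ℂ} (hf : LocInt Set.univ volume f) :
    LocallyIntegrable f := fun x =>
  ⟨Metric.ball x 1, Metric.ball_mem_nhds x one_pos, by
    simpa using hf _ (Metric.isBounded_ball (x := x) (r := 1))⟩

/-- Below the height `1` the extension is close to an average of `f` at level zero; above it, it is
bounded by such averages, and it vanishes from the height `9/4` on. -/
lemma enorm_whitneyExt_le_extDev_add (hψ : IsWhitneyPartition d ψ) {f : E d → ℂ}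
    (hf : LocallyIntegrable f) {x : E (d + 1)} (hx : 0 < ht x) :
    ‖whitneyExt ψ f x‖ₑ ≤ extDev ψ f 0 x + (layer d (4 * (2 : ℝ) ^ (-((0 : ℕ) : ℤ)))).indicator
      (fun x => nbrCount d * nbrSup₀ (fun y => ‖f y‖ₑ) (cubeAt ((0 : ℕ) : ℤ) (proj x))) x := by
  have hN : (1 : ℝ≥0∞) ≤ nbrCount d := by exact_mod_cast nbrCount_pos d
  have e0 : (2 : ℝ) ^ (-((0 : ℕ) : ℤ)) = 1 := by simp
  rcases le_or_gt (ht x) 1 with h1 | h1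
  · have hl : x ∈ layer d ((2 : ℝ) ^ (-((0 : ℕ) : ℤ))) := mem_layer.2 ⟨hx, by rwa [e0]⟩
    rw [extDev, Set.indicator_of_mem hl, Set.indicator_of_mem (mem_layer.2 ⟨hx, by
      rw [e0]; linarith⟩)]
    have h2 : ‖cavg f (cubeAt ((0 : ℕ) : ℤ) (proj x))‖ₑ ≤
        nbrCount d * nbrSup₀ (fun y => ‖f y‖ₑ) (cubeAt ((0 : ℕ) : ℤ) (proj x)) :=
      (enorm_cavg_le hf (DyadicCube.Neighbor.refl _)).trans (le_mul_of_one_le_left' hN)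
    refine le_trans ?_ (add_le_add le_rfl h2)
    refine le_trans (le_of_eq ?_) (enorm_add_le _ _)
    congr 1; ring
  · rcases le_or_gt (ht x) 4 with h4 | h4
    · rw [Set.indicator_of_mem (mem_layer.2 ⟨hx, by rw [e0]; linarith⟩)]
      exact (enorm_whitneyExt_le hψ hf (j := 0) ⟨by rw [e0]; exact h1, Or.inr rfl⟩).trans
        le_add_self
    · rw [whitneyExt_eq_zero hψ f (by linarith)]
      simp

lemma exists_eLpNorm_whitneyExt_le {α : ℝ} (hα : -1 < α) {p q : ℝ≥0∞} (hp : 1 ≤ p) (hq : 0 < q)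
    {s : ℝ} (hs : 0 < s) (hψ : IsWhitneyPartition d ψ) :
    ∃ C : ℝ≥0, ∀ f ∈ besovSpace Set.univ volume (s - (α + 1) * (1 / p).toReal) p q,
      eLpNorm (whitneyExt ψ f) p ((muAlpha d α).restrict (upperHalf d)) ≤
        C * besovNorm Set.univ volume (s - (α + 1) * (1 / p).toReal) p q f := by
  obtain ⟨C₁, hC₁⟩ := exists_eLpNorm_extDev_le hα hp hψ
  obtain ⟨C₂, hC₂⟩ := exists_eLpNorm_layer_le d hα p
  set β := (α + 1) * (1 / p).toReal with hβ
  have hsum : ∑' k : ℕ, pw (-(k * s)) ≠ ∞ := tsum_pw_ne_top hs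
  refine ⟨C₁ * (∑' k : ℕ, pw (-(k * s))).toNNReal + C₂ * (nbrCount d * (3 * (5 ^ d + 1))),
    fun f hf => ?_⟩
  rw [ENNReal.coe_add, ENNReal.coe_mul, ENNReal.coe_toNNReal hsum]
  set X := besovNorm Set.univ volume (s - β) p q f with hX
  have hfl := hf.1.locallyIntegrable
  have hfm : AEMeasurable fun y => ‖f y‖ₑ := hfl.aestronglyMeasurable.enorm
  have hm : Measurable fun y : E d =>
      nbrCount d * nbrSup₀ (fun y => ‖f y‖ₑ) (cubeAt ((0 : ℕ) : ℤ) y) :=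
    (measurable_comp_cubeAt (nbrSup₀ fun y => ‖f y‖ₑ) _).const_mul _
  have h1 : eLpNorm (extDev ψ f 0) p ((muAlpha d α).restrict (upperHalf d)) ≤
      C₁ * (∑' k : ℕ, pw (-(k * s))) * X := by
    refine (hC₁ f 0).trans ?_
    rw [mul_assoc, ← ENNReal.tsum_mul_right]
    refine mul_le_mul_right (ENNReal.tsum_le_tsum fun i => ?_) _
    rw [zero_add]
    calc _ ≤ pw (-(i * β)) * (pw (-(i * (s - β))) * X) := by
          gcongr; exact levelEnergy_le_pw_mul hq f i
      _ = _ := by rw [← mul_assoc, ← pw_add]; congr 2; ring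
  have h2 := hC₂ 0 _ hm.aemeasurable
  calc eLpNorm (whitneyExt ψ f) p ((muAlpha d α).restrict (upperHalf d))
      ≤ eLpNorm (fun x => extDev ψ f 0 x +
          (layer d (4 * (2 : ℝ) ^ (-((0 : ℕ) : ℤ)))).indicator (fun x => nbrCount d *
            nbrSup₀ (fun y => ‖f y‖ₑ) (cubeAt ((0 : ℕ) : ℤ) (proj x))) x) p
          ((muAlpha d α).restrict (upperHalf d)) := by
        refine eLpNorm_mono_enorm_ae ?_
        filter_upwards [ae_restrict_mem (measurableSet_upperHalf d)] with x hx
        rw [enorm_eq_self]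
        exact enorm_whitneyExt_le_extDev_add hψ hfl hx
    _ ≤ _ := eLpNorm_add_le_ennreal (measurable_extDev hψ f 0).aemeasurable
        ((hm.comp measurable_proj).indicator (measurableSet_layer _)).aemeasurable hp
    _ ≤ C₁ * (∑' k : ℕ, pw (-(k * s))) * X +
        C₂ * (nbrCount d * ((3 * (5 ^ d + 1) : ℝ≥0) * X)) := by
        refine add_le_add h1 (h2.trans ?_)
        rw [show pw (-(((0 : ℕ) : ℝ) * β)) = 1 by simp [pw_zero], mul_one]
        gcongr
        refine (eLpNorm_const_mul_le_of_ne_top (by simp) _ hp).trans ?_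
        gcongr
        refine (eLpNorm_nbrSup₀_le hp hfm _).trans ?_
        gcongr
        rw [eLpNorm_enorm_eq, hX, besovNorm, Measure.restrict_univ]
        exact le_self_add
    _ = _ := by push_cast; ring

lemma muAlpha_inter_upperHalf_ne_top {α : ℝ} (hα : -1 < α) {B : Set (E (d + 1))}
    (hB : Bornology.IsBounded B) : muAlpha d α (B ∩ upperHalf d) ≠ ∞ := by
  obtain ⟨R, hR⟩ := hB.subset_closedBall 0
  have hsub : B ∩ upperHalf d ⊆
      proj ⁻¹' (Metric.closedBall (0 : E d) (d * R)) ∩ ht ⁻¹' Set.Ioc 0 R := by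
    rintro x ⟨hxB, hx0⟩
    have hx := Metric.mem_closedBall.1 (hR hxB)
    have hR0 : 0 ≤ R := dist_nonneg.trans hx
    have h1 : ∀ i, |x i| ≤ R := fun i => by
      have := (abs_sub_le_dist x 0 i).trans hx
      simpa using this
    refine ⟨Metric.mem_closedBall.2 (dist_le_of_forall_abs_le hR0 fun i => ?_), hx0,
      (le_abs_self _).trans (h1 _)⟩
    simpa using h1 i.castSucc
  refine ne_top_of_le_ne_top ?_ (measure_mono hsub)
  rw [muAlpha_cylinder d α Metric.isClosed_closedBall.measurableSet measurableSet_Ioc]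
  exact ENNReal.mul_ne_top measure_closedBall_lt_top.ne (nuAlpha_Ioc_ne_top hα _ _)

lemma locInt_whitneyExt {α : ℝ} (hα : -1 < α) {p q : ℝ≥0∞} (hp : 1 ≤ p) (hq : 0 < q)
    {s : ℝ} (hs : 0 < s) (hψ : IsWhitneyPartition d ψ) {f : E d → ℂ}
    (hf : f ∈ besovSpace Set.univ volume (s - (α + 1) * (1 / p).toReal) p q) :
    LocInt (upperHalf d) (muAlpha d α) (whitneyExt ψ f) := by
  intro B hB
  obtain ⟨C, hC⟩ := exists_eLpNorm_whitneyExt_le (d := d) hα hp hq hs hψ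
  have h1 : MemLp (whitneyExt ψ f) p ((muAlpha d α).restrict (upperHalf d)) :=
    ⟨(measurable_whitneyExt hψ f).aestronglyMeasurable,
      (hC f hf).trans_lt (ENNReal.mul_lt_top (by simp) hf.2)⟩
  have h2 : MemLp (whitneyExt ψ f) p ((muAlpha d α).restrict (B ∩ upperHalf d)) :=
    h1.mono_measure (Measure.restrict_mono Set.inter_subset_right le_rfl)
  have : IsFiniteMeasure ((muAlpha d α).restrict (B ∩ upperHalf d)) :=
    ⟨by rw [Measure.restrict_apply_univ]
        exact (muAlpha_inter_upperHalf_ne_top hα hB).lt_top⟩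
  exact h2.integrable hp

lemma integrableOn_toSet_of_locInt {n : ℕ} {Ω : Set (E n)} {μ : Measure (E n)} {u : E n → ℂ}
    (hu : LocInt Ω μ u) {Q : DyadicCube n} (hQ : Q.toSet ⊆ Ω) : IntegrableOn u Q.toSet μ := by
  have := hu _ (isBounded_toSet Q)
  rwa [Set.inter_eq_left.2 hQ] at this

/-- Every dyadic energy is controlled by the `L^p` norm. -/
lemma levelEnergy_le_eLpNorm {n : ℕ} {Ω : Set (E n)} {μ : Measure (E n)} {C : ℝ≥0}
    (hD : DyadicDoubling Ω μ C) {p : ℝ≥0∞} (hp : 1 ≤ p) {u : E n → ℂ} (hu : LocInt Ω μ u)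
    (hm : AEStronglyMeasurable u (μ.restrict Ω)) (k : ℕ) :
    levelEnergy Ω μ p u k ≤ (nbrCount n * (2 * (3 * (C + 1))) : ℝ≥0) *
      eLpNorm u p (μ.restrict Ω) := by
  have h1 : ∀ (Q Q' : DyadicCube n), Q.Neighbor Q' → Q'.toSet ⊆ Ω →
      ‖⨍ y in Q'.toSet, u y ∂μ‖ₑ ≤ nbrSup Ω μ (fun y => ‖u y‖ₑ) Q := by
    intro Q Q' hn hQ'
    refine le_trans ?_ (le_nbrSup hn hQ')
    simpa using enorm_setAverage_sub_le (hD.measure_ne_zero _ hQ') (hD.measure_ne_top _)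
      (integrableOn_toSet_of_locInt hu hQ') 0
  refine (levelEnergy_le hD hp (g := fun x => ((2 : ℝ≥0) : ℝ≥0∞) *
    nbrSup Ω μ (fun y => ‖u y‖ₑ) (cubeAt k x)) fun x hx Q' hn hQ' => ?_).trans ?_
  · refine (enorm_sub_le).trans ((add_le_add (h1 _ _ (DyadicCube.Neighbor.refl _)
      (hD.cube_subset x hx k)) (h1 _ _ hn hQ')).trans (le_of_eq ?_))
    push_cast; ring
  · calc _ ≤ nbrCount n * (((2 : ℝ≥0) : ℝ≥0∞) * ((3 * (C + 1) : ℝ≥0) *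
          eLpNorm (fun y => ‖u y‖ₑ) p (μ.restrict Ω))) := by
          gcongr
          refine (eLpNorm_const_mul_le _ _ hp).trans ?_
          gcongr
          exact eLpNorm_nbrSup_le hD hp hm.enorm k
      _ = _ := by rw [eLpNorm_enorm_eq]; push_cast; ring

end

section
/-! ### Oscillations of the extension -/

variable {d : ℕ} {ψ : SmallCube d → E (d + 1) → ℝ}

/-- The largest average, over the neighbors of the cube of level `j` at `y`, of the oscillation of
`f` at level `j'`. -/
noncomputable def nbrOsc (f : E d → ℂ) (j' j : ℕ) (y : E d) : ℝ≥0∞ :=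
  nbrSup₀ (fun z => osc₀ f (cubeAt j' z)) (cubeAt j y)

lemma measurable_nbrOsc (f : E d → ℂ) (j' j : ℕ) : Measurable (nbrOsc f j' j) :=
  measurable_comp_cubeAt (nbrSup₀ fun z => osc₀ f (cubeAt j' z)) j

lemma osc₀_le_nbrOsc (f : E d → ℂ) {j j' : ℕ} {y z : E d}
    (h : (cubeAt j y).Neighbor (cubeAt j' z)) : osc₀ f (cubeAt j' z) ≤ nbrOsc f j' j y := by
  refine le_trans (le_of_eq ?_) (le_nbrSup h (Set.subset_univ _))
  rw [setLAverage_eq, setLIntegral_congr_fun (DyadicCube.measurableSet_toSet _)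
    (g := fun _ => osc₀ f (cubeAt j' z)) (fun w hw => by rw [mem_cubeAt_iff.1 hw])]
  rw [lintegral_const, Measure.restrict_apply_univ, ENNReal.mul_div_cancel_right
    (volume_toSet_ne_zero _) (volume_toSet_ne_top _)]

/-- The sum of `nbrOsc` over the levels `j - 1`, `j`, `j + 1`. -/
noncomputable def nbrOscSum (f : E d → ℂ) (j : ℕ) (y : E d) : ℝ≥0∞ :=
  nbrOsc f (j - 1) j y + nbrOsc f j j y + nbrOsc f (j + 1) j y

lemma measurable_nbrOscSum (f : E d → ℂ) (j : ℕ) : Measurable (nbrOscSum f j) :=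
  ((measurable_nbrOsc f _ j).add (measurable_nbrOsc f _ j)).add (measurable_nbrOsc f _ j)

lemma osc₀_le_nbrOscSum (f : E d → ℂ) {j j' : ℕ} {y z : E d}
    (h : (cubeAt j y).Neighbor (cubeAt j' z)) : osc₀ f (cubeAt j' z) ≤ nbrOscSum f j y := by
  have h1 := (neighbor_cubeAt_iff.1 h).1
  have h2 := osc₀_le_nbrOsc f h
  unfold nbrOscSum
  have h3 : j' = j - 1 ∨ j' = j ∨ j' = j + 1 := by omega
  rcases h3 with rfl | rfl | rfl
  · exact h2.trans (le_self_add.trans le_self_add)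
  · exact h2.trans (le_add_self.trans le_self_add)
  · exact h2.trans le_add_self

lemma eLpNorm_nbrOscSum_le {p : ℝ≥0∞} (hp : 1 ≤ p) (f : E d → ℂ) (j : ℕ) :
    eLpNorm (nbrOscSum f j) p ≤ (3 * (5 ^ d + 1) : ℝ≥0) *
      (levelEnergy Set.univ volume p f (j - 1) + levelEnergy Set.univ volume p f j +
        levelEnergy Set.univ volume p f (j + 1)) := by
  have h : ∀ j', eLpNorm (nbrOsc f j' j) p ≤
      (3 * (5 ^ d + 1) : ℝ≥0) * levelEnergy Set.univ volume p f j' := fun j' =>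
    (eLpNorm_nbrSup₀_le hp (measurable_comp_cubeAt (osc₀ f) j').aemeasurable j).trans
      (mul_le_mul_right (eLpNorm_osc₀_le hp f j') _)
  have m := fun j' => (measurable_nbrOsc f j' j).aemeasurable (μ := volume)
  rw [mul_add, mul_add]
  exact (eLpNorm_add_le_ennreal ((m _).add (m _)) (m _) hp).trans (add_le_add
    ((eLpNorm_add_le_ennreal (m _) (m _) hp).trans (add_le_add (h _) (h _))) (h _))

/-- A majorant of the oscillations of the extension at level `κ + 4`. The first two terms control
them near the boundary, the others far from it, layer by layer. -/
noncomputable def extMajorant (α : ℝ) (ψ : SmallCube d → E (d + 1) → ℝ) (f : E d → ℂ) (κ : ℕ)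
    (x : E (d + 1)) : ℝ≥0∞ :=
  nbrSup (upperHalf d) (muAlpha d α) (extDev ψ f κ) (cubeAt ((κ + 4 : ℕ) : ℤ) x) +
    (layer d (4 * (2 : ℝ) ^ (-(κ : ℤ)))).indicator
      (fun x => osc₀ f (cubeAt κ (proj x))) x +
    (∑ j ∈ Finset.range (κ + 2), (layer d (4 * (2 : ℝ) ^ (-(j : ℤ)))).indicator
      (fun x => pw ((j : ℝ) - κ) * nbrOscSum f j (proj x)) x) +
    (layer d (4 * (2 : ℝ) ^ (-((0 : ℕ) : ℤ)))).indicator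
      (fun x => pw (-κ) * nbrSup₀ (fun y => ‖f y‖ₑ) (cubeAt ((0 : ℕ) : ℤ) (proj x))) x

lemma neighbor_proj {k k' : ℤ} {x z : E (d + 1)} (h : (cubeAt k x).Neighbor (cubeAt k' z)) :
    (cubeAt k (proj x)).Neighbor (cubeAt k' (proj z)) := by
  rw [neighbor_cubeAt_iff] at *
  exact ⟨h.1, fun i => h.2 i.castSucc⟩

/-- Near the boundary, averages of the extension are compared with averages of `f`. -/
lemma enorm_avg_whitneyExt_sub_cavg_le {α : ℝ} (hα : -1 < α) {f : E d → ℂ}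
    (hF : LocInt (upperHalf d) (muAlpha d α) (whitneyExt ψ f)) (κ : ℕ) {x : E (d + 1)}
    (hx : 0 < ht x) (hx8 : ht x ≤ 8 * (2 : ℝ) ^ (-((κ + 4 : ℕ) : ℤ))) {P : DyadicCube (d + 1)}
    (hn : (cubeAt ((κ + 4 : ℕ) : ℤ) x).Neighbor P) (hP : P.toSet ⊆ upperHalf d) :
    ‖(⨍ y in P.toSet, whitneyExt ψ f y ∂(muAlpha d α)) - cavg f (cubeAt κ (proj x))‖ₑ ≤
      extMajorant α ψ f κ x := by
  obtain ⟨D, hD⟩ := dyadicDoubling_muAlpha d hα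
  have h16 : (2 : ℝ) ^ (-(κ : ℤ)) = 2 ^ 4 * (2 : ℝ) ^ (-((κ + 4 : ℕ) : ℤ)) :=
    two_zpow_neg_eq 4 (by push_cast; ring)
  have hpos : (0 : ℝ) < (2 : ℝ) ^ (-((κ + 4 : ℕ) : ℤ)) := by positivity
  set z := P.corner with hz
  have hPz : P = cubeAt P.level z := P.cubeAt_corner.symm
  set k' := P.level with hk'
  have hn' := hn
  rw [hPz] at hn'
  have hlev := (neighbor_cubeAt_iff.1 hn').1
  -- All points of `P` lie at heights at most `(8 + 3) 2^{-κ-4} ≤ 2^{-κ}`, in the range covered by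
  -- `extDev ψ f κ`.
  have hκ : (κ : ℤ) ≤ k' := by push_cast at hlev; omega
  have hnκ : (cubeAt κ (proj x)).Neighbor (cubeAt κ (proj z)) :=
    neighbor_ancestor (neighbor_proj hn') (by push_cast; omega) hκ (by omega) (by omega)
  have h1 : ‖(⨍ y in P.toSet, whitneyExt ψ f y ∂(muAlpha d α)) - cavg f (cubeAt κ (proj z))‖ₑ ≤
      nbrSup (upperHalf d) (muAlpha d α) (extDev ψ f κ) (cubeAt ((κ + 4 : ℕ) : ℤ) x) := by
    refine le_trans ?_ (le_nbrSup hn hP)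
    refine (enorm_setAverage_sub_le (hD.measure_ne_zero _ hP) (hD.measure_ne_top _)
      (integrableOn_toSet_of_locInt hF hP) _).trans (le_of_eq ?_)
    rw [setLAverage_eq, setLAverage_eq]
    congr 1
    refine setLIntegral_congr_fun P.measurableSet_toSet fun y hy => ?_
    have hy0 : 0 < ht y := hP hy
    have hyz : cubeAt k' y = P := DyadicCube.mem_toSet_iff.1 hy
    have hyκ : cubeAt κ (proj y) = cubeAt κ (proj z) := by
      have h2 : cubeAt k' (proj y) = cubeAt k' (proj z) := by
        rw [← baseCube_cubeAt, ← baseCube_cubeAt, hyz, ← hPz]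
      exact cubeAt_eq_of_le hκ h2
    have h3 := abs_sub_le_of_neighbor (k := ((κ + 4 : ℕ) : ℤ)) (k' := k') (x := x) (y := y)
      (by rw [hyz]; exact hn) (Fin.last d)
    rw [abs_le] at h3
    have h4 : y ∈ layer d ((2 : ℝ) ^ (-(κ : ℤ))) := by
      refine mem_layer.2 ⟨hy0, ?_⟩
      rw [h16]
      unfold ht at *
      linarith [h3.1]
    unfold extDev
    rw [Set.indicator_of_mem h4, hyκ]
  have h2 := enorm_cavg_sub_le f hnκ
  have h5 : x ∈ layer d (4 * (2 : ℝ) ^ (-(κ : ℤ))) :=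
    mem_layer.2 ⟨hx, by rw [h16]; linarith⟩
  unfold extMajorant
  rw [Set.indicator_of_mem h5]
  refine le_trans ?_ ((add_le_add h1 h2).trans (le_self_add.trans le_self_add))
  rw [← edist_eq_enorm_sub, ← edist_eq_enorm_sub, ← edist_eq_enorm_sub]
  exact edist_triangle _ _ _

/-- Far from the boundary, the extension varies slowly on the scale of the cubes. -/
lemma exists_enorm_whitneyExt_sub_le_extMajorant (α : ℝ) (hψ : IsWhitneyPartition d ψ) :
    ∃ K : ℝ≥0, ∀ (f : E d → ℂ), LocallyIntegrable f → ∀ (κ : ℕ) (x z : E (d + 1)) (k' : ℤ),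
      8 * (2 : ℝ) ^ (-((κ + 4 : ℕ) : ℤ)) < ht x →
      (cubeAt ((κ + 4 : ℕ) : ℤ) x).Neighbor (cubeAt k' z) →
      ‖whitneyExt ψ f z - whitneyExt ψ f x‖ₑ ≤ K * extMajorant α ψ f κ x := by
  obtain ⟨K, hK⟩ := exists_enorm_whitneyExt_sub_le hψ
  refine ⟨K * (3 * (d + 1)) * 2, fun f hf κ x z k' hx8 hn => ?_⟩
  have hpos : (0 : ℝ) < (2 : ℝ) ^ (-((κ + 4 : ℕ) : ℤ)) := by positivity
  have hx0 : 0 < ht x := by linarith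
  have hclose := abs_sub_le_of_neighbor hn (Fin.last d)
  change |ht x - ht z| ≤ _ at hclose
  rw [abs_le] at hclose
  -- The heights of `x` and `z` differ by at most `3 * 2^{-κ-4} ≤ 3/16`, so above the height `4` the
  -- extension vanishes at both points.
  rcases lt_or_ge 4 (ht x) with h4 | h4
  · rw [whitneyExt_eq_zero hψ f (by linarith), whitneyExt_eq_zero hψ f (by linarith)]
    simp
  have hz0 : 0 < ht z := by linarith
  obtain ⟨j, hj⟩ := exists_inLayer hx0
  obtain ⟨j', hj'⟩ := exists_inLayer hz0
  have hjj' : j' ≤ j + 1 := hj.le_add_one hj' (by linarith)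
  have hj'j : j ≤ j' + 1 := hj'.le_add_one hj (by linarith)
  -- Heights above `8 * 2^{-κ-4} = 2^{-κ-1}` belong to layers of index at most `κ + 1`.
  have hjκ : j ≤ κ + 1 := by
    by_contra hlt
    have h0 : ht x ≤ 2 * (2 : ℝ) ^ (-(j : ℤ)) := hj.2.resolve_right (by omega)
    have h1 : (2 : ℝ) ^ (-(j : ℤ)) ≤ (2 : ℝ) ^ (-((κ + 2 : ℕ) : ℤ)) :=
      zpow_le_zpow_right₀ one_le_two (by push_cast; omega)
    have h2 : (2 : ℝ) ^ (-((κ + 2 : ℕ) : ℤ)) = 2 ^ 2 * (2 : ℝ) ^ (-((κ + 4 : ℕ) : ℤ)) :=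
      two_zpow_neg_eq 2 (by push_cast; ring)
    linarith
  have hlev := (neighbor_cubeAt_iff.1 hn).1
  have hnj : (cubeAt j (proj x)).Neighbor (cubeAt j' (proj z)) :=
    neighbor_ancestor (neighbor_proj hn) (by push_cast; omega) (by push_cast at hlev; omega)
      (by omega) (by omega)
  -- The Lipschitz constant in the layer is of order `2^j`, and the distance of order `2^{-κ}`.
  have hdist : (2 : ℝ) ^ (j : ℤ) * dist x z ≤ (3 * (d + 1)) * (2 : ℝ) ^ ((j : ℝ) - κ) := by
    have h1 : dist x z ≤ ((d + 1 : ℕ) : ℝ) * (3 * (2 : ℝ) ^ (-((κ + 4 : ℕ) : ℤ))) :=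
      dist_le_of_forall_abs_le (by positivity) fun i => abs_sub_le_of_neighbor hn i
    have h2 : (2 : ℝ) ^ (-((κ + 4 : ℕ) : ℤ)) ≤ (2 : ℝ) ^ (-(κ : ℤ)) :=
      zpow_le_zpow_right₀ one_le_two (by push_cast; omega)
    have h3 : (2 : ℝ) ^ (j : ℤ) * (2 : ℝ) ^ (-(κ : ℤ)) = (2 : ℝ) ^ ((j : ℝ) - κ) := by
      rw [← zpow_add₀ two_ne_zero, ← Real.rpow_intCast]; push_cast; rfl
    calc (2 : ℝ) ^ (j : ℤ) * dist x z
        ≤ (2 : ℝ) ^ (j : ℤ) * (((d + 1 : ℕ) : ℝ) * (3 * (2 : ℝ) ^ (-(κ : ℤ)))) := by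
          gcongr; exact h1.trans (by gcongr)
      _ = _ := by rw [← h3]; push_cast; ring
  have hdist' : ENNReal.ofReal ((2 : ℝ) ^ (j : ℤ) * dist x z) ≤
      ((3 * (d + 1) : ℝ≥0) : ℝ≥0∞) * pw ((j : ℝ) - κ) := by
    refine (ENNReal.ofReal_le_ofReal hdist).trans (le_of_eq ?_)
    rw [ENNReal.ofReal_mul (by positivity), pw]
    congr 1
    rw [← ENNReal.ofReal_coe_nnreal]; push_cast; rfl
  have hlay : x ∈ layer d (4 * (2 : ℝ) ^ (-(j : ℤ))) := by
    refine mem_layer.2 ⟨hx0, ?_⟩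
    rcases hj.2 with h | rfl
    · have : (0 : ℝ) < (2 : ℝ) ^ (-(j : ℤ)) := by positivity
      linarith
    · simpa using h4
  have hlay0 : x ∈ layer d (4 * (2 : ℝ) ^ (-((0 : ℕ) : ℤ))) :=
    mem_layer.2 ⟨hx0, by simpa using h4⟩
  have hosc1 : osc₀ f (cubeAt j (proj x)) ≤ nbrOscSum f j (proj x) :=
    osc₀_le_nbrOscSum f (DyadicCube.Neighbor.refl _)
  have hosc2 : osc₀ f (cubeAt j' (proj z)) ≤ nbrOscSum f j (proj x) := osc₀_le_nbrOscSum f hnj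
  -- The exceptional term occurs only if one of the points is above the height `2`, that is, in the
  -- layer of index zero.
  have htop : pw ((j : ℝ) - κ) *
      (if ht x ≤ 2 ∧ ht z ≤ 2 then 0 else ‖cavg f (cubeAt j (proj x))‖ₑ) ≤
      pw (-κ) * nbrSup₀ (fun y => ‖f y‖ₑ) (cubeAt ((0 : ℕ) : ℤ) (proj x)) := by
    split_ifs with hh
    · simp
    · have hj0 : j = 0 := by
        by_contra hne
        have h0 : ht x ≤ 2 * (2 : ℝ) ^ (-(j : ℤ)) := hj.2.resolve_right hne
        have h1 : (2 : ℝ) ^ (-(j : ℤ)) ≤ (2 : ℝ) ^ (-(1 : ℤ)) :=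
          zpow_le_zpow_right₀ one_le_two (by omega)
        rw [show (2 : ℝ) ^ (-(1 : ℤ)) = 1 / 2 by norm_num] at h1
        exact hh ⟨by linarith, by linarith⟩
      subst hj0
      rw [Nat.cast_zero, zero_sub]
      gcongr
      exact enorm_cavg_le hf (DyadicCube.Neighbor.refl _)
  have hmaj : pw ((j : ℝ) - κ) * nbrOscSum f j (proj x) +
      pw (-κ) * nbrSup₀ (fun y => ‖f y‖ₑ) (cubeAt ((0 : ℕ) : ℤ) (proj x)) ≤
      extMajorant α ψ f κ x := by
    unfold extMajorant
    rw [Set.indicator_of_mem hlay0]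
    gcongr
    refine le_trans (le_of_eq ?_) ((Finset.single_le_sum (f := fun j : ℕ =>
      (layer d (4 * (2 : ℝ) ^ (-(j : ℤ)))).indicator
      (fun x => pw ((j : ℝ) - κ) * nbrOscSum f j (proj x)) x) (fun _ _ => zero_le)
      (Finset.mem_range.2 (show j < κ + 2 by omega))).trans le_add_self)
    rw [Set.indicator_of_mem hlay]
  rw [enorm_sub_rev]
  refine (hK f x z j j' hj hj' hnj).trans ?_
  calc _ ≤ K * (((3 * (d + 1) : ℝ≥0) : ℝ≥0∞) * pw ((j : ℝ) - κ)) *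
        (nbrOscSum f j (proj x) + nbrOscSum f j (proj x) +
          if ht x ≤ 2 ∧ ht z ≤ 2 then 0 else ‖cavg f (cubeAt j (proj x))‖ₑ) := by gcongr
    _ = K * ((3 * (d + 1) : ℝ≥0) : ℝ≥0∞) * (2 * (pw ((j : ℝ) - κ) * nbrOscSum f j (proj x)) +
          pw ((j : ℝ) - κ) *
            (if ht x ≤ 2 ∧ ht z ≤ 2 then 0 else ‖cavg f (cubeAt j (proj x))‖ₑ)) := by ring
    _ ≤ K * ((3 * (d + 1) : ℝ≥0) : ℝ≥0∞) * (2 * (pw ((j : ℝ) - κ) * nbrOscSum f j (proj x)) +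
          2 * (pw (-κ) * nbrSup₀ (fun y => ‖f y‖ₑ) (cubeAt ((0 : ℕ) : ℤ) (proj x)))) := by
        exact mul_le_mul_right (add_le_add le_rfl
          (htop.trans (le_mul_of_one_le_left' one_le_two))) _
    _ ≤ K * ((3 * (d + 1) : ℝ≥0) : ℝ≥0∞) * (2 * extMajorant α ψ f κ x) := by
        rw [← mul_add]; gcongr
    _ = _ := by push_cast; ring

/-- Both near and far from the boundary the averages over the cube at `x` and over its neighbors are
close to a common number: an average of `f`, or the value of the extension at `x`. -/
lemma exists_enorm_avg_sub_le_extMajorant {α : ℝ} (hα : -1 < α) (hψ : IsWhitneyPartition d ψ) :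
    ∃ K : ℝ≥0, ∀ (f : E d → ℂ), LocallyIntegrable f →
      LocInt (upperHalf d) (muAlpha d α) (whitneyExt ψ f) →
      ∀ (κ : ℕ), ∀ x ∈ upperHalf d, ∀ P : DyadicCube (d + 1),
      (cubeAt ((κ + 4 : ℕ) : ℤ) x).Neighbor P → P.toSet ⊆ upperHalf d →
      ‖(⨍ y in (cubeAt ((κ + 4 : ℕ) : ℤ) x).toSet, whitneyExt ψ f y ∂(muAlpha d α)) -
        ⨍ y in P.toSet, whitneyExt ψ f y ∂(muAlpha d α)‖ₑ ≤ K * extMajorant α ψ f κ x := by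
  obtain ⟨K, hK⟩ := exists_enorm_whitneyExt_sub_le_extMajorant (d := d) α hψ
  obtain ⟨D, hD⟩ := dyadicDoubling_muAlpha d hα
  refine ⟨2 * (1 + K), fun f hf hF κ x hx P hn hP => ?_⟩
  -- Above the threshold, the neighbors of the cube stay at heights comparable with that of `x`.
  obtain ⟨c, hc⟩ : ∃ c : ℂ, ∀ P : DyadicCube (d + 1),
      (cubeAt ((κ + 4 : ℕ) : ℤ) x).Neighbor P → P.toSet ⊆ upperHalf d →
      ‖(⨍ y in P.toSet, whitneyExt ψ f y ∂(muAlpha d α)) - c‖ₑ ≤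
        (1 + K) * extMajorant α ψ f κ x := by
    rcases le_or_gt (ht x) (8 * (2 : ℝ) ^ (-((κ + 4 : ℕ) : ℤ))) with h8 | h8
    · refine ⟨_, fun P hn hP => (enorm_avg_whitneyExt_sub_cavg_le hα hF κ hx h8 hn hP).trans ?_⟩
      exact le_mul_of_one_le_left' le_self_add
    · refine ⟨whitneyExt ψ f x, fun P hn hP => ?_⟩
      refine enorm_setAverage_sub_le_of_forall P.measurableSet_toSet (hD.measure_ne_zero _ hP)
        (hD.measure_ne_top _) (integrableOn_toSet_of_locInt hF hP) fun z hz => ?_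
      rw [← DyadicCube.mem_toSet_iff.1 hz] at hn
      refine (hK f hf κ x z _ h8 hn).trans ?_
      gcongr
      exact le_add_self
  have h1 := hc _ (DyadicCube.Neighbor.refl _) (hD.cube_subset x hx _)
  have h2 := hc P hn hP
  rw [enorm_sub_rev] at h2
  rw [← edist_eq_enorm_sub] at *
  refine (edist_triangle _ c _).trans ((add_le_add h1 h2).trans (le_of_eq ?_))
  push_cast; ring

end

section
/-! ### Boundedness of the extension -/

variable {d : ℕ} {ψ : SmallCube d → E (d + 1) → ℝ}

/-- The sum of the energies at the levels `j - 1`, `j`, `j + 1`. -/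
noncomputable def energySum (p : ℝ≥0∞) (f : E d → ℂ) (j : ℕ) : ℝ≥0∞ :=
  levelEnergy Set.univ volume p f (j - 1) + levelEnergy Set.univ volume p f j +
    levelEnergy Set.univ volume p f (j + 1)

lemma exists_eLpNorm_extMajorant_le {α : ℝ} (hα : -1 < α) {p : ℝ≥0∞} (hp : 1 ≤ p)
    (hψ : IsWhitneyPartition d ψ) :
    ∃ C : ℝ≥0, ∀ (f : E d → ℂ), LocallyIntegrable f → ∀ κ : ℕ,
      eLpNorm (extMajorant α ψ f κ) p ((muAlpha d α).restrict (upperHalf d)) ≤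
        C * ((∑' i : ℕ, pw (-((κ + i : ℕ) * ((α + 1) * (1 / p).toReal))) *
            levelEnergy Set.univ volume p f (κ + i)) +
          (∑ j ∈ Finset.range (κ + 2), pw ((j : ℝ) - κ) *
            pw (-(j * ((α + 1) * (1 / p).toReal))) * energySum p f j) +
          pw (-κ) * eLpNorm f p) := by
  obtain ⟨C₁, hC₁⟩ := exists_eLpNorm_extDev_le hα hp hψ
  obtain ⟨C₂, hC₂⟩ := exists_eLpNorm_layer_le d hα p
  obtain ⟨D, hD⟩ := dyadicDoubling_muAlpha d hα
  set β := (α + 1) * (1 / p).toReal with hβ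
  set M : ℝ≥0 := 3 * (5 ^ d + 1) with hM
  refine ⟨3 * (D + 1) * C₁ + C₂ + C₂ * M, fun f hf κ => ?_⟩
  set ν := (muAlpha d α).restrict (upperHalf d) with hν
  set S₁ := ∑' i : ℕ, pw (-((κ + i : ℕ) * β)) * levelEnergy Set.univ volume p f (κ + i) with hS₁
  set S₂ := ∑ j ∈ Finset.range (κ + 2), pw ((j : ℝ) - κ) * pw (-(j * β)) * energySum p f j with hS₂
  have m1 := measurable_comp_cubeAt
    (nbrSup (upperHalf d) (muAlpha d α) (extDev ψ f κ)) ((κ + 4 : ℕ) : ℤ)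
  have m2 : Measurable fun y : E d => osc₀ f (cubeAt κ y) := measurable_comp_cubeAt (osc₀ f) _
  have m3 : ∀ j : ℕ, Measurable fun y : E d => pw ((j : ℝ) - κ) * nbrOscSum f j y := fun j =>
    (measurable_nbrOscSum f j).const_mul _
  have m4 : Measurable fun y : E d =>
      pw (-κ) * nbrSup₀ (fun y => ‖f y‖ₑ) (cubeAt ((0 : ℕ) : ℤ) y) :=
    (measurable_comp_cubeAt (nbrSup₀ fun y => ‖f y‖ₑ) _).const_mul _
  have ml : ∀ {g : E d → ℝ≥0∞} {b : ℝ}, Measurable g →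
      Measurable ((layer d b).indicator fun x => g (proj x)) := fun hg =>
    (hg.comp measurable_proj).indicator (measurableSet_layer _)
  have h1 : eLpNorm (fun x => nbrSup (upperHalf d) (muAlpha d α) (extDev ψ f κ)
      (cubeAt ((κ + 4 : ℕ) : ℤ) x)) p ν ≤ ((3 * (D + 1) : ℝ≥0) : ℝ≥0∞) * (C₁ * S₁) :=
    (eLpNorm_nbrSup_le hD hp (measurable_extDev hψ f κ).aemeasurable _).trans
      (mul_le_mul_right (hC₁ f κ) _)
  have h2 : eLpNorm ((layer d (4 * (2 : ℝ) ^ (-(κ : ℤ)))).indicator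
      fun x => osc₀ f (cubeAt κ (proj x))) p ν ≤ C₂ * S₁ := by
    refine (hC₂ κ _ m2.aemeasurable).trans ?_
    rw [mul_assoc]
    refine mul_le_mul_right ((mul_le_mul_right (eLpNorm_osc₀_le hp f κ) _).trans ?_) _
    exact ENNReal.le_tsum (f := fun i : ℕ => pw (-((κ + i : ℕ) * β)) *
      levelEnergy Set.univ volume p f (κ + i)) 0
  have h3 : eLpNorm (fun x => ∑ j ∈ Finset.range (κ + 2),
      (layer d (4 * (2 : ℝ) ^ (-(j : ℤ)))).indicator
      (fun x => pw ((j : ℝ) - κ) * nbrOscSum f j (proj x)) x) p ν ≤ C₂ * M * S₂ := by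
    have := eLpNorm_sum_le (s := Finset.range (κ + 2)) (f := fun j : ℕ =>
      (layer d (4 * (2 : ℝ) ^ (-(j : ℤ)))).indicator
      (fun x => pw ((j : ℝ) - κ) * nbrOscSum f j (proj x))) (p := p) (μ := ν)
      (fun j _ => (ml (m3 j)).aestronglyMeasurable) hp
    rw [Finset.sum_fn] at this
    refine this.trans ?_
    rw [hS₂, Finset.mul_sum]
    refine Finset.sum_le_sum fun j _ => (hC₂ j _ (m3 j).aemeasurable).trans ?_
    calc _ ≤ C₂ * pw (-(j * β)) * (pw ((j : ℝ) - κ) * (M * energySum p f j)) := by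
          refine mul_le_mul_right ((eLpNorm_const_mul_le_of_ne_top (pw_ne_top _) _ hp).trans
            (mul_le_mul_right (eLpNorm_nbrOscSum_le hp f j) _)) _
      _ = _ := by ring
  have h4 : eLpNorm ((layer d (4 * (2 : ℝ) ^ (-((0 : ℕ) : ℤ)))).indicator
      fun x => pw (-κ) * nbrSup₀ (fun y => ‖f y‖ₑ) (cubeAt ((0 : ℕ) : ℤ) (proj x))) p ν ≤
      C₂ * M * (pw (-κ) * eLpNorm f p) := by
    refine (hC₂ 0 _ m4.aemeasurable).trans ?_
    rw [show pw (-(((0 : ℕ) : ℝ) * β)) = 1 by simp [pw_zero], mul_one]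
    calc _ ≤ C₂ * (pw (-κ) * (M * eLpNorm f p)) := by
          refine mul_le_mul_right ((eLpNorm_const_mul_le_of_ne_top (pw_ne_top _) _ hp).trans
            (mul_le_mul_right ((eLpNorm_nbrSup₀_le hp
              hf.aestronglyMeasurable.enorm _).trans ?_) _)) _
          rw [eLpNorm_enorm_eq]
      _ = _ := by ring
  have m3' : Measurable fun x => ∑ j ∈ Finset.range (κ + 2),
      (layer d (4 * (2 : ℝ) ^ (-(j : ℤ)))).indicator
      (fun x => pw ((j : ℝ) - κ) * nbrOscSum f j (proj x)) x :=
    Finset.measurable_sum _ fun j _ => ml (m3 j)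
  calc eLpNorm (extMajorant α ψ f κ) p ν
      ≤ ((3 * (D + 1) : ℝ≥0) : ℝ≥0∞) * (C₁ * S₁) + C₂ * S₁ + C₂ * M * S₂ +
        C₂ * M * (pw (-κ) * eLpNorm f p) := by
        refine (eLpNorm_add_le_ennreal ((m1.add (ml m2)).add m3').aemeasurable
          (ml m4).aemeasurable hp).trans (add_le_add ?_ h4)
        refine (eLpNorm_add_le_ennreal (m1.add (ml m2)).aemeasurable
          m3'.aemeasurable hp).trans (add_le_add ?_ h3)
        exact (eLpNorm_add_le_ennreal m1.aemeasurable
          (ml m2).aemeasurable hp).trans (add_le_add h1 h2)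
    _ = ((3 * (D + 1) * C₁ + C₂ : ℝ≥0) : ℝ≥0∞) * S₁ + ((C₂ * M : ℝ≥0) : ℝ≥0∞) * S₂ +
        ((C₂ * M : ℝ≥0) : ℝ≥0∞) * (pw (-κ) * eLpNorm f p) := by push_cast; ring
    _ ≤ _ := by
        have e1 : 3 * (D + 1) * C₁ + C₂ ≤ 3 * (D + 1) * C₁ + C₂ + C₂ * M := le_self_add
        have e2 : C₂ * M ≤ 3 * (D + 1) * C₁ + C₂ + C₂ * M := le_add_self
        generalize 3 * (D + 1) * C₁ + C₂ + C₂ * M = T at e1 e2 ⊢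
        generalize 3 * (D + 1) * C₁ + C₂ = T₁ at e1 e2 ⊢
        generalize C₂ * M = T₂ at e1 e2 ⊢
        rw [mul_add, mul_add]
        gcongr

/-- Exponents may be increased by `6`; this absorbs all bounded shifts of levels below. -/
lemma pw_le_mul_pow {ε e : ℝ} {n : ℕ} (h : e ≤ 6 - n * ε) : pw e ≤ pw 6 * pw (-ε) ^ n := by
  rw [← pw_mul_natCast, ← pw_add]
  exact pw_mono (by linarith)

/-- Shifts by one level are convolutions with a geometric sequence, up to a constant. -/
lemma exists_ellNorm_energySum_le {q : ℝ≥0∞} (hq : 0 < q) {σ : ℝ} (hσ : 0 < σ) (p : ℝ≥0∞) :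
    ∃ C : ℝ≥0, ∀ f : E d → ℂ, ellNorm q (fun j : ℕ => pw (j * σ) * energySum p f j) ≤
      C * ellNorm q fun j : ℕ => pw (j * σ) * levelEnergy Set.univ volume p f j := by
  obtain ⟨C, hC⟩ := exists_ellNorm_conv_le hq (r := pw (-1)) (pw_lt_one (by norm_num))
  refine ⟨C * (3 * (pw 6 * pw σ)).toNNReal, fun f => ?_⟩
  have hfin : 3 * (pw 6 * pw σ) ≠ ∞ :=
    ENNReal.mul_ne_top (by simp) (ENNReal.mul_ne_top (pw_ne_top _) (pw_ne_top _))
  rw [ENNReal.coe_mul, ENNReal.coe_toNNReal hfin, mul_assoc, ← ellNorm_const_mul hq]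
  refine hC _ _ fun j => ?_
  set T := ∑' i : ℕ, pw (-1) ^ ((i - j) + (j - i)) *
    (pw 6 * pw σ * (pw (i * σ) * levelEnergy Set.univ volume p f i)) with hT
  have h : ∀ i : ℕ, j ≤ i + 1 → i ≤ j + 1 →
      pw (j * σ) * levelEnergy Set.univ volume p f i ≤ T := by
    intro i h1 h2
    refine le_trans ?_ (ENNReal.le_tsum i)
    have h3 : pw (j * σ) ≤ pw σ * pw (i * σ) := by
      rw [← pw_add]
      refine pw_mono ?_
      have : (j : ℝ) ≤ i + 1 := by exact_mod_cast h1
      nlinarith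
    have h4 : pw 0 ≤ pw 6 * pw (-1) ^ ((i - j) + (j - i)) := by
      refine pw_le_mul_pow ?_
      have : (((i - j) + (j - i) : ℕ) : ℝ) ≤ ((1 : ℕ) : ℝ) := Nat.cast_le.2 (by omega)
      push_cast at this ⊢
      linarith
    rw [pw_zero] at h4
    calc _ ≤ 1 * (pw σ * pw (i * σ) * levelEnergy Set.univ volume p f i) := by
          rw [one_mul]; gcongr
      _ ≤ pw 6 * pw (-1) ^ ((i - j) + (j - i)) *
          (pw σ * pw (i * σ) * levelEnergy Set.univ volume p f i) := by gcongr
      _ = _ := by ring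
  calc pw (j * σ) * energySum p f j ≤ T + T + T := by
        unfold energySum
        rw [mul_add, mul_add]
        exact add_le_add (add_le_add (h _ (by omega) (by omega)) (h _ (by omega) (by omega)))
          (h _ (by omega) (by omega))
    _ = 3 * T := by ring
    _ = _ := by
        rw [hT, ← ENNReal.tsum_mul_left]
        refine tsum_congr fun i => ?_
        ring

/-- The dyadic energies of the extension are obtained from those of `f` by discrete convolution
with a geometric sequence; a term at level zero accounts for the `L^p` norm. -/
lemma exists_levelEnergy_whitneyExt_le {α : ℝ} (hα : -1 < α) {p q : ℝ≥0∞} (hp : 1 ≤ p)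
    (hq : 0 < q) {s : ℝ} (hs0 : 0 < s) (hs1 : s < 1) (hψ : IsWhitneyPartition d ψ) :
    ∃ C : ℝ≥0∞, C ≠ ∞ ∧ ∀ f ∈ besovSpace Set.univ volume (s - (α + 1) * (1 / p).toReal) p q,
      ∀ k : ℕ, pw (k * s) * levelEnergy (upperHalf d) (muAlpha d α) p (whitneyExt ψ f) k ≤
        ∑' j : ℕ, pw (-min s (1 - s)) ^ ((j - k) + (k - j)) *
          (C * (pw (j * (s - (α + 1) * (1 / p).toReal)) * energySum p f j +
            if j = 0 then besovNorm Set.univ volume (s - (α + 1) * (1 / p).toReal) p q f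
              else 0)) := by
  obtain ⟨C₁, hC₁⟩ := exists_eLpNorm_extMajorant_le hα hp hψ
  obtain ⟨C₂, hC₂⟩ := exists_eLpNorm_whitneyExt_le hα hp hq hs0 hψ
  obtain ⟨K, hK⟩ := exists_enorm_avg_sub_le_extMajorant hα hψ
  obtain ⟨D, hD⟩ := dyadicDoubling_muAlpha d hα
  set β := (α + 1) * (1 / p).toReal with hβ
  set ε := min s (1 - s) with hε
  have hε0 : 0 < ε := lt_min hs0 (by linarith)
  have hεs : ε ≤ s := min_le_left _ _
  have hεs' : ε ≤ 1 - s := min_le_right _ _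
  set N : ℝ≥0∞ := ((nbrCount (d + 1) : ℕ) : ℝ≥0∞) with hN
  set C₃ : ℝ≥0∞ := ((nbrCount (d + 1) * (2 * (3 * (D + 1))) : ℝ≥0) : ℝ≥0∞) with hC₃
  set C₀ : ℝ≥0∞ := pw (4 * s) * (N * K * C₁ * 3 + C₃ * C₂) with hC₀
  have hC₀top : C₀ ≠ ∞ := by
    have := pw_ne_top (4 * s)
    rw [hC₀, hN, hC₃]
    finiteness
  refine ⟨C₀ * pw 6, ENNReal.mul_ne_top hC₀top (pw_ne_top _), fun f hf k => ?_⟩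
  set X := besovNorm Set.univ volume (s - β) p q f with hX
  set F := whitneyExt ψ f with hF
  set A : ℕ → ℝ≥0∞ := levelEnergy Set.univ volume p f with hA
  have hfl := hf.1.locallyIntegrable
  have hFl := locInt_whitneyExt hα hp hq hs0 hψ hf
  clear_value β
  set B : ℕ → ℝ≥0∞ := fun j => pw (j * (s - β)) * energySum p f j + if j = 0 then X else 0 with hB
  set W : ℕ → ℝ≥0∞ := fun j => pw 6 * pw (-ε) ^ ((j - k) + (k - j)) * B j with hW
  have hWsum : ∑' j : ℕ, pw (-ε) ^ ((j - k) + (k - j)) * (C₀ * pw 6 * B j) = C₀ * ∑' j, W j := by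
    rw [← ENNReal.tsum_mul_left]
    exact tsum_congr fun j => by rw [hW]; ring
  change _ ≤ ∑' j : ℕ, pw (-ε) ^ ((j - k) + (k - j)) * (C₀ * pw 6 * B j)
  rw [hWsum]
  -- It suffices to bound every contribution by `pw e * B j` with `e` at most `-ε |j - k|`, up to a
  -- constant.
  have hW' : ∀ (j : ℕ) (e : ℝ), e ≤ 6 - ((j - k) + (k - j) : ℕ) * ε → pw e * B j ≤ W j := by
    intro j e he
    exact mul_le_mul' (pw_le_mul_pow he) le_rfl
  have hXB : X ≤ B 0 := by rw [hB]; simp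
  -- For the first four levels the `L^p` norm of the extension suffices; at the other levels the
  -- majorant of level `κ = k - 4` is available.
  rcases lt_or_ge k 4 with hk | hk
  · have h1 : levelEnergy (upperHalf d) (muAlpha d α) p F k ≤ C₃ * (C₂ * X) :=
      (levelEnergy_le_eLpNorm hD hp hFl (measurable_whitneyExt hψ f).aestronglyMeasurable k).trans
        (mul_le_mul_right (hC₂ f hf) _)
    have hk' : (k : ℝ) ≤ 4 := by exact_mod_cast hk.le
    have h2 : X ≤ ∑' j, W j := by
      refine le_trans ?_ ((hW' 0 0 ?_).trans (ENNReal.le_tsum 0))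
      · rwa [pw_zero, one_mul]
      · rw [show 0 - k + (k - 0) = k by omega]
        nlinarith
    calc pw (k * s) * levelEnergy (upperHalf d) (muAlpha d α) p F k
        ≤ pw (4 * s) * (C₃ * (C₂ * ∑' j, W j)) := by
          gcongr
          · exact pw_mono (by gcongr)
          · exact h1.trans (by gcongr)
      _ = pw (4 * s) * (C₃ * C₂) * ∑' j, W j := by ring
      _ ≤ _ := by
          rw [hC₀]; gcongr; exact le_add_self
  · obtain ⟨κ, rfl⟩ := Nat.exists_eq_add_of_le' hk
    have h1 := levelEnergy_le hD hp (k := κ + 4) (u := F)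
      (g := fun x => K * extMajorant α ψ f κ x) fun x hx P hn hP =>
        hK f hfl hFl κ x hx P hn hP
    have h2 := h1.trans (mul_le_mul_right ((eLpNorm_const_mul_le K _ hp).trans
      (mul_le_mul_right (hC₁ f hfl κ) _)) _)
    -- Near the boundary: the exponent `-(j - κ) s` is at most `-(j - κ) ε`.
    have t1 : pw (κ * s) * (∑' i : ℕ, pw (-((κ + i : ℕ) * β)) * A (κ + i)) ≤ ∑' j, W j := by
      rw [← ENNReal.tsum_mul_left]
      have hinj : Function.Injective fun i : ℕ => κ + i := fun a b h => by simpa using h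
      refine le_trans (ENNReal.tsum_le_tsum fun i => ?_)
        (ENNReal.tsum_comp_le_tsum_of_injective hinj W)
      refine le_trans ?_ (hW' (κ + i) (-(i * s)) ?_)
      · rw [← mul_assoc, ← pw_add]
        calc _ = pw (-(i * s)) * (pw ((κ + i : ℕ) * (s - β)) * A (κ + i)) := by
              rw [← mul_assoc, ← pw_add]; congr 2; push_cast; ring
          _ ≤ _ := by
              gcongr
              refine le_trans ?_ le_self_add
              gcongr
              exact le_add_self.trans le_self_add
      · have h3 : ((κ + i - (κ + 4) + (κ + 4 - (κ + i)) : ℕ) : ℝ) ≤ ((i + 4 : ℕ) : ℝ) :=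
          Nat.cast_le.2 (by omega)
        have h4 := mul_le_mul_of_nonneg_right h3 hε0.le
        push_cast at h4 ⊢
        have h5 := mul_le_mul_of_nonneg_left hεs (Nat.cast_nonneg (α := ℝ) i)
        linarith
    -- Far from the boundary: the exponent `(j - κ)(1 - s)` is, up to a constant, at most
    -- `-(κ - j) ε`. This is where `s < 1` enters.
    have t2 : pw (κ * s) * (∑ j ∈ Finset.range (κ + 2), pw ((j : ℝ) - κ) * pw (-(j * β)) *
        energySum p f j) ≤ ∑' j, W j := by
      rw [Finset.mul_sum]
      refine le_trans (Finset.sum_le_sum fun j hj => ?_) (ENNReal.sum_le_tsum (Finset.range (κ + 2)))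
      rw [Finset.mem_range] at hj
      refine le_trans ?_ (hW' j (((j : ℝ) - κ) * (1 - s)) ?_)
      · calc _ = pw (((j : ℝ) - κ) * (1 - s)) * (pw (j * (s - β)) * energySum p f j) := by
              rw [← mul_assoc, ← mul_assoc, ← mul_assoc, ← pw_add, ← pw_add, ← pw_add]
              congr 2; ring
          _ ≤ _ := by gcongr; exact le_self_add
      · rw [show j - (κ + 4) + (κ + 4 - j) = κ + 4 - j by omega,
          Nat.cast_sub (by omega)]
        push_cast
        have hj' : (j : ℝ) ≤ κ + 1 := by
          have : j ≤ κ + 1 := by omega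
          exact_mod_cast this
        have h5 : ((κ : ℝ) + 1 - j) * ε ≤ ((κ : ℝ) + 1 - j) * (1 - s) :=
          mul_le_mul_of_nonneg_left hεs' (by linarith)
        nlinarith
    -- The top layer, where `F` descends to zero, contributes the `L^p` norm of `f`.
    have t3 : pw (κ * s) * (pw (-κ) * eLpNorm f p) ≤ ∑' j, W j := by
      refine le_trans ?_ ((hW' 0 (-(κ * (1 - s))) ?_).trans (ENNReal.le_tsum 0))
      · rw [← mul_assoc, ← pw_add]
        refine mul_le_mul' (pw_mono (by linarith)) (le_trans ?_ hXB)
        rw [hX, besovNorm, Measure.restrict_univ]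
        exact le_self_add
      · rw [show 0 - (κ + 4) + (κ + 4 - 0) = κ + 4 by omega]
        push_cast
        have h5 := mul_le_mul_of_nonneg_left hεs' (Nat.cast_nonneg (α := ℝ) κ)
        linarith
    calc pw ((κ + 4 : ℕ) * s) * levelEnergy (upperHalf d) (muAlpha d α) p F (κ + 4)
        ≤ pw ((κ + 4 : ℕ) * s) * _ := mul_le_mul_right h2 _
      _ = pw (4 * s) * (N * K * C₁) * (pw (κ * s) * (∑' i : ℕ, pw (-((κ + i : ℕ) * β)) *
            A (κ + i)) + pw (κ * s) * (∑ j ∈ Finset.range (κ + 2), pw ((j : ℝ) - κ) *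
            pw (-(j * β)) * energySum p f j) + pw (κ * s) * (pw (-κ) * eLpNorm f p)) := by
          rw [show ((κ + 4 : ℕ) : ℝ) * s = 4 * s + κ * s by push_cast; ring, pw_add]
          ring
      _ ≤ pw (4 * s) * (N * K * C₁) * (∑' j, W j + ∑' j, W j + ∑' j, W j) := by
          gcongr
      _ = pw (4 * s) * (N * K * C₁ * 3) * ∑' j, W j := by ring
      _ ≤ _ := by
          rw [hC₀]; gcongr; exact le_self_add

/-- Boundedness of the extension operator. -/
lemma exists_besovNorm_whitneyExt_le {α : ℝ} (hα : -1 < α) {p q : ℝ≥0∞} (hp : 1 ≤ p)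
    (hq : 0 < q) {s : ℝ} (hs0 : 0 < s) (hs1 : s < 1) (hs : (α + 1) * (1 / p).toReal < s)
    (hψ : IsWhitneyPartition d ψ) :
    ∃ C : ℝ≥0, ∀ f ∈ besovSpace Set.univ volume (s - (α + 1) * (1 / p).toReal) p q,
      besovNorm (upperHalf d) (muAlpha d α) s p q (whitneyExt ψ f) ≤
        C * besovNorm Set.univ volume (s - (α + 1) * (1 / p).toReal) p q f := by
  obtain ⟨C₁, hC₁⟩ := exists_eLpNorm_whitneyExt_le (d := d) hα hp hq hs0 hψ
  obtain ⟨C₂, hC₂top, hC₂⟩ := exists_levelEnergy_whitneyExt_le (d := d) hα hp hq hs0 hs1 hψ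
  obtain ⟨C₃, hC₃⟩ := exists_ellNorm_energySum_le (d := d) hq
    (σ := s - (α + 1) * (1 / p).toReal) (by linarith) p
  obtain ⟨C₄, hC₄⟩ := exists_ellNorm_conv_le hq (r := pw (-min s (1 - s)))
    (pw_lt_one (by simp [hs0, hs1]))
  obtain ⟨C₅, hC₅⟩ := exists_ellNorm_add_le hq
  refine ⟨C₁ + C₄ * C₂.toNNReal * (C₅ * (C₃ + 1)), fun f hf => ?_⟩
  set X := besovNorm Set.univ volume (s - (α + 1) * (1 / p).toReal) p q f with hX
  set σ := s - (α + 1) * (1 / p).toReal with hσ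
  have h1 : ellNorm q (fun j : ℕ => pw (j * σ) * levelEnergy Set.univ volume p f j) ≤ X :=
    le_add_self
  have h2 := hC₅ (fun j : ℕ => pw (j * σ) * energySum p f j) (fun j => if j = 0 then X else 0)
  have h3 := hC₄ _ _ (hC₂ f hf)
  rw [ellNorm_const_mul hq] at h3
  unfold besovNorm
  refine (add_le_add (hC₁ f hf) (h3.trans (mul_le_mul_right (mul_le_mul_right (h2.trans
    (mul_le_mul_right (add_le_add ((hC₃ f).trans (mul_le_mul_right h1 _))
      (ellNorm_single hq X)) _)) _) _))).trans (le_of_eq ?_)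
  push_cast
  rw [ENNReal.coe_toNNReal hC₂top]
  ring

end

section
/-! ### The trace of the extension -/

variable {d : ℕ} {ψ : SmallCube d → E (d + 1) → ℝ}

/-- Lebesgue's differentiation theorem along the dyadic cubes containing a point. -/
lemma ae_tendsto_cavg {f : E d → ℂ} (hf : LocallyIntegrable f) :
    ∀ᵐ x, Tendsto (fun k : ℕ => ‖cavg f (cubeAt k x) - f x‖ₑ) atTop (𝓝 0) := by
  -- The ratio of the volumes of a ball of radius `(d + 1) 2^{-k}` and of a cube of level `k`.
  set K : ℝ≥0∞ := ENNReal.ofReal (d + 1) ^ d * volume (Metric.ball (0 : E d) 1) with hK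
  have hKtop : K ≠ ∞ := ENNReal.mul_ne_top (by finiteness) measure_ball_lt_top.ne
  filter_upwards [IsUnifLocDoublingMeasure.ae_tendsto_average_norm_sub volume hf 1] with x hx
  set δ : ℕ → ℝ := fun k => (d + 1) * (2 : ℝ) ^ (-(k : ℤ)) with hδ
  have hδ0 : ∀ k, 0 < δ k := fun k => by positivity
  have hδlim : Tendsto δ atTop (𝓝[>] 0) := by
    refine tendsto_nhdsWithin_iff.2 ⟨?_, Eventually.of_forall hδ0⟩
    have h1 : Tendsto (fun k : ℕ => (d + 1 : ℝ) * (1 / 2 : ℝ) ^ k) atTop (𝓝 ((d + 1 : ℝ) * 0)) :=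
      (tendsto_pow_atTop_nhds_zero_of_lt_one (by norm_num) (by norm_num)).const_mul _
    rw [mul_zero] at h1
    refine h1.congr fun k => ?_
    simp [hδ]
  have h1 := hx (fun _ => x) δ hδlim (Eventually.of_forall fun k =>
    Metric.mem_closedBall_self (by have := hδ0 k; linarith))
  have h2 := ENNReal.Tendsto.const_mul (a := K) (ENNReal.tendsto_ofReal h1) (Or.inr hKtop)
  rw [ENNReal.ofReal_zero, mul_zero] at h2
  refine tendsto_of_tendsto_of_tendsto_of_le_of_le tendsto_const_nhds h2 (fun _ => zero_le)
    fun k => ?_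
  set Q := cubeAt k x with hQ
  have hsub : Q.toSet ⊆ Metric.closedBall x (δ k) := fun y hy => by
    refine Metric.mem_closedBall.2 ((dist_le_of_mem_cubeAt hy).trans ?_)
    change _ ≤ (d + 1 : ℝ) * (2 : ℝ) ^ (-(k : ℤ))
    gcongr
    linarith
  have hvol : volume (Metric.closedBall x (δ k)) = K * volume Q.toSet := by
    rw [Measure.addHaar_closedBall _ _ (hδ0 k).le, Q.volume_toSet, hK, finrank_euclideanSpace_fin,
      ← ENNReal.ofReal_pow (by positivity), ← ENNReal.ofReal_pow Q.len_pos.le,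
      mul_right_comm, ← ENNReal.ofReal_mul (by positivity), hδ, mul_pow]
    rfl
  have hfB : IntegrableOn f (Metric.closedBall x (δ k)) :=
    integrableOn_of_isBounded hf Metric.isBounded_closedBall
  have hint : IntegrableOn (fun y => ‖f y - f x‖) (Metric.closedBall x (δ k)) :=
    (hfB.sub (integrableOn_const measure_closedBall_lt_top.ne)).norm
  refine (enorm_setAverage_sub_le (volume_toSet_ne_zero Q) (volume_toSet_ne_top Q)
    (hfB.mono_set hsub) _).trans ?_
  rw [ofReal_setAverage hint (Eventually.of_forall fun _ => norm_nonneg _), setLAverage_eq, hvol,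
    ← mul_div_assoc]
  simp_rw [ofReal_norm]
  have hK0 : K ≠ 0 := by
    intro h0
    rw [h0, zero_mul] at hvol
    exact (Metric.measure_closedBall_pos volume x (hδ0 k)).ne' hvol
  rw [ENNReal.mul_div_mul_left _ _ hK0 hKtop]
  gcongr

/-- Over the boundary cubes, the averages of the extension and of `f` are close. -/
lemma enorm_bdryAvg_whitneyExt_sub_le {α : ℝ} (hα : -1 < α) {f : E d → ℂ}
    (hF : LocInt (upperHalf d) (muAlpha d α) (whitneyExt ψ f)) (k : ℕ) (x : E d) :
    ‖bdryAvg α (whitneyExt ψ f) k x - cavg f (cubeAt k x)‖ₑ ≤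
      nbrSup (upperHalf d) (muAlpha d α) (extDev ψ f k) (boundaryCube (cubeAt k x)) := by
  obtain ⟨D, hD⟩ := dyadicDoubling_muAlpha d hα
  have hs := boundaryCube_subset (cubeAt k x)
  refine le_trans ?_ (le_nbrSup (DyadicCube.Neighbor.refl _) hs)
  refine (enorm_setAverage_sub_le (hD.measure_ne_zero _ hs) (hD.measure_ne_top _)
    (integrableOn_toSet_of_locInt hF hs) _).trans (le_of_eq ?_)
  rw [setLAverage_eq, setLAverage_eq]
  congr 1
  refine setLIntegral_congr_fun (DyadicCube.measurableSet_toSet _) fun y hy => ?_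
  obtain ⟨h1, h2, h3⟩ := mem_boundaryCube.1 hy
  unfold extDev
  rw [cubeAt_len] at h3
  rw [Set.indicator_of_mem (mem_layer.2 ⟨h2, h3⟩), mem_cubeAt_iff.1 h1]

/-- The trace is a left inverse of the extension. -/
lemma trace_whitneyExt {α : ℝ} (hα : -1 < α) {p q : ℝ≥0∞} (hp : 1 ≤ p) (hq : 0 < q) {s : ℝ}
    (hs0 : 0 < s) (hs : (α + 1) * (1 / p).toReal < s) (hψ : IsWhitneyPartition d ψ) {f : E d → ℂ}
    (hf : f ∈ besovSpace Set.univ volume (s - (α + 1) * (1 / p).toReal) p q)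
    (hF : whitneyExt ψ f ∈ besovSpace (upperHalf d) (muAlpha d α) s p q) :
    trace (muAlpha d α) (whitneyExt ψ f) =ᵐ[volume] f := by
  obtain ⟨C₁, hC₁⟩ := exists_eLpNorm_extDev_le hα hp hψ
  obtain ⟨C₂, hC₂⟩ := exists_eLpNorm_bdry_nbrSup_le (d := d) hα hp
  have hspec := trace_spec hα hp hq hs hF
  have hleb := ae_tendsto_cavg hf.1.locallyIntegrable
  set β := (α + 1) * (1 / p).toReal with hβ
  set X := besovNorm Set.univ volume (s - β) p q f with hX
  have hXtop : X ≠ ∞ := hf.2.ne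
  have hσ : ∑' k : ℕ, pw (-(k * (s - β))) ≠ ∞ := tsum_pw_ne_top (by linarith)
  have hs' : ∑' k : ℕ, pw (-(k * s)) ≠ ∞ := tsum_pw_ne_top hs0
  have hE : ∀ k, levelEnergy Set.univ volume p f k ≤ pw (-(k * (s - β))) * X :=
    levelEnergy_le_pw_mul hq f
  clear_value β
  -- The deviation of the extension from `f` on boundary cubes of level `k` is of order
  -- `2^{-k(s-β)}`, hence summable.
  have hnorm : ∀ k : ℕ, eLpNorm (fun x : E d => nbrSup (upperHalf d) (muAlpha d α)
      (extDev ψ f k) (boundaryCube (cubeAt k x))) p ≤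
      C₂ * C₁ * X * (∑' i : ℕ, pw (-(i * s))) * pw (-(k * (s - β))) := by
    intro k
    refine (hC₂ k _ (measurable_extDev hψ f k).aemeasurable).trans ?_
    calc _ ≤ C₂ * pw (k * β) * (C₁ * ∑' i : ℕ, pw (-((k + i : ℕ) * β)) *
          (pw (-((k + i : ℕ) * (s - β))) * X)) := by
          refine mul_le_mul_right ((hC₁ f k).trans (mul_le_mul_right
            (ENNReal.tsum_le_tsum fun i => mul_le_mul_right (hE _) _) _)) _
      _ = C₂ * pw (k * β) * (C₁ * ((pw (-(k * s)) * X) * ∑' i : ℕ, pw (-(i * s)))) := by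
          rw [← ENNReal.tsum_mul_left (a := pw (-(k * s)) * X)]
          refine congrArg _ (congrArg _ (tsum_congr fun i => ?_))
          rw [← mul_assoc, ← pw_add, show -(((k + i : ℕ) : ℝ) * β) + -((k + i : ℕ) * (s - β)) =
            -(k * s) + -(i * s) by push_cast; ring, pw_add]
          ring
      _ = _ := by
          rw [show -((k : ℝ) * (s - β)) = k * β + -(k * s) by ring, pw_add]
          ring
  have hsum : ∑' k : ℕ, eLpNorm (fun x : E d => nbrSup (upperHalf d) (muAlpha d α)
      (extDev ψ f k) (boundaryCube (cubeAt k x))) p ≠ ∞ := by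
    refine ne_top_of_le_ne_top ?_ (ENNReal.tsum_le_tsum hnorm)
    rw [ENNReal.tsum_mul_left]
    finiteness
  have hdev := ae_tendsto_zero_of_tsum_eLpNorm (fun k : ℕ => (measurable_comp_cubeAt
    (fun Q => nbrSup (upperHalf d) (muAlpha d α) (extDev ψ f k) (boundaryCube Q))
    k).aemeasurable) hp hsum
  filter_upwards [hspec, hleb, hdev] with x hx1 hx2 hx3
  refine tendsto_nhds_unique hx1.2.1 (tendsto_iff_edist_tendsto_0.2 ?_)
  have h := hx3.add hx2
  rw [add_zero] at h
  refine tendsto_of_tendsto_of_tendsto_of_le_of_le tendsto_const_nhds h (fun _ => zero_le)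
    fun k => (edist_triangle _ (cavg f (cubeAt k x)) _).trans ?_
  rw [edist_eq_enorm_sub, edist_eq_enorm_sub]
  exact add_le_add (enorm_bdryAvg_whitneyExt_sub_le hα hF.1 k x) le_rfl

end

section
/-! ### Existence of Whitney partitions -/

variable {d : ℕ}

/-- A smooth step from `0` to `1`, which increases on `(-δ, δ)`. -/
noncomputable def smoothStep (δ x : ℝ) : ℝ := Real.smoothTransition ((x + δ) / (2 * δ))

section smoothStep

variable {δ x u v : ℝ}

lemma contDiff_smoothStep (δ : ℝ) : ContDiff ℝ ((⊤ : ℕ∞) : WithTop ℕ∞) (smoothStep δ) := by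
  unfold smoothStep
  exact Real.smoothTransition.contDiff.comp (by fun_prop)

lemma smoothStep_eq_zero (hδ : 0 < δ) (h : x ≤ -δ) : smoothStep δ x = 0 :=
  Real.smoothTransition.zero_of_nonpos (div_nonpos_of_nonpos_of_nonneg (by linarith) (by linarith))

lemma smoothStep_eq_one (hδ : 0 < δ) (h : δ ≤ x) : smoothStep δ x = 1 :=
  Real.smoothTransition.one_of_one_le ((one_le_div (by linarith)).2 (by linarith))

lemma smoothStep_nonneg : 0 ≤ smoothStep δ x := Real.smoothTransition.nonneg _

lemma smoothStep_le_one : smoothStep δ x ≤ 1 := Real.smoothTransition.le_one _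

lemma smoothStep_pos (hδ : 0 < δ) (h : -δ < x) : 0 < smoothStep δ x :=
  Real.smoothTransition.pos_of_pos (div_pos (by linarith) (by linarith))

lemma smoothStep_lt_one (hδ : 0 < δ) (h : x < δ) : smoothStep δ x < 1 :=
  Real.smoothTransition.lt_one_of_lt_one ((div_lt_one (by linarith)).2 (by linarith))

/-- A difference of two steps lies in `[0, 1]` if the first step is complete as soon as the
second one begins. -/
lemma smoothStep_sub_mem_Icc (hδ : 0 < δ) (h : -δ < v → δ ≤ u) :
    smoothStep δ u - smoothStep δ v ∈ Set.Icc (0 : ℝ) 1 := by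
  refine ⟨?_, by linarith [smoothStep_le_one (δ := δ) (x := u), smoothStep_nonneg (δ := δ) (x := v)]⟩
  rcases le_or_gt v (-δ) with hv | hv
  · rw [smoothStep_eq_zero hδ hv, sub_zero]; exact smoothStep_nonneg
  · rw [smoothStep_eq_one hδ (h hv)]; linarith [smoothStep_le_one (δ := δ) (x := v)]

lemma smoothStep_sub_pos (hδ : 0 < δ) (h : -δ < v → δ ≤ u) (hu : 0 ≤ u) (hv : v ≤ 0) :
    0 < smoothStep δ u - smoothStep δ v := by
  rcases le_or_gt v (-δ) with hv' | hv'
  · rw [smoothStep_eq_zero hδ hv', sub_zero]; exact smoothStep_pos hδ (by linarith)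
  · rw [smoothStep_eq_one hδ (h hv')]; linarith [smoothStep_lt_one hδ (show v < δ by linarith)]

lemma lt_of_smoothStep_sub_ne_zero (hδ : 0 < δ) (h : -δ < v → δ ≤ u)
    (hne : smoothStep δ u - smoothStep δ v ≠ 0) : -δ < u ∧ v < δ := by
  constructor
  · by_contra hu
    refine hne ?_
    rw [smoothStep_eq_zero hδ (not_lt.1 hu), smoothStep_eq_zero hδ, sub_zero]
    by_contra hv
    linarith [h (not_le.1 hv)]
  · by_contra hv
    refine hne ?_
    rw [smoothStep_eq_one hδ (not_lt.1 hv), smoothStep_eq_one hδ (h (by linarith)), sub_self]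

end smoothStep

/-- The horizontal profile: a smooth bump equal to one on most of `[0, 1]`, whose integer
translates add up to one. -/
noncomputable def baseProfile (δ u : ℝ) : ℝ := smoothStep δ u - smoothStep δ (u - 1)

/-- The vertical profile of the bumps of level `j`, for the interval `[1, 2]`. Rescaled by `2^j`,
these telescope; the choice for `j = 0` makes the sum equal to one up to the height `2`. -/
noncomputable def heightProfile (δ : ℝ) (j : ℤ) (t : ℝ) : ℝ :=
  smoothStep δ (t - 1) - smoothStep δ (if j = 0 then t - 2 - δ else (t - 2) / 2)

/-- The bump associated with `(0,1]^d × (1,2]`. -/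
noncomputable def modelBump (δ : ℝ) (j : ℤ) (y : E (d + 1)) : ℝ :=
  heightProfile δ j (ht y) * ∏ i : Fin d, baseProfile δ (y i.castSucc)

/-- The integer vector `(m, 0)`. -/
noncomputable def bdryShift (m : Fin d → ℤ) : E (d + 1) :=
  WithLp.toLp 2 (Fin.snoc (α := fun _ => ℝ) (fun i => (m i : ℝ)) 0)

@[simp] lemma bdryShift_castSucc (m : Fin d → ℤ) (i : Fin d) :
    bdryShift m i.castSucc = m i := by simp [bdryShift]

@[simp] lemma bdryShift_last (m : Fin d → ℤ) : bdryShift m (Fin.last d) = 0 := by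
  simp [bdryShift]

/-- The width of the smooth steps, so small that moving every coordinate by twice this width is a
displacement by at most `1/8`. -/
noncomputable def stepWidth (d : ℕ) : ℝ := 1 / (16 * (d + 1))

/-- The standard Whitney bumps: rescaled and translated copies of two model bumps. -/
noncomputable def whitneyBump (Q : SmallCube d) (x : E (d + 1)) : ℝ :=
  modelBump (stepWidth d) Q.1.level ((2 : ℝ) ^ Q.1.level • x - bdryShift Q.1.pos)

lemma stepWidth_pos (d : ℕ) : 0 < stepWidth d := by unfold stepWidth; positivity

lemma stepWidth_le (d : ℕ) : stepWidth d ≤ 1 / 16 := by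
  unfold stepWidth
  gcongr
  have : (0 : ℝ) ≤ d := d.cast_nonneg
  linarith

section profiles

variable {δ : ℝ}

lemma height_step (hδ : 0 < δ) (hδ' : δ ≤ 1 / 16) (j : ℤ) (t : ℝ) :
    -δ < (if j = 0 then t - 2 - δ else (t - 2) / 2) → δ ≤ t - 1 := by
  split_ifs <;> intro h <;> linarith

lemma contDiff_baseProfile (δ : ℝ) :
    ContDiff ℝ ((⊤ : ℕ∞) : WithTop ℕ∞) (baseProfile δ) := by
  unfold baseProfile
  exact (contDiff_smoothStep δ).sub ((contDiff_smoothStep δ).comp (by fun_prop))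

lemma contDiff_heightProfile (δ : ℝ) (j : ℤ) :
    ContDiff ℝ ((⊤ : ℕ∞) : WithTop ℕ∞) (heightProfile δ j) := by
  unfold heightProfile
  split_ifs <;> exact ((contDiff_smoothStep δ).comp (by fun_prop)).sub
    ((contDiff_smoothStep δ).comp (by fun_prop))

lemma contDiff_modelBump (δ : ℝ) (j : ℤ) :
    ContDiff ℝ ((⊤ : ℕ∞) : WithTop ℕ∞) (modelBump (d := d) δ j) := by
  unfold modelBump ht
  exact ((contDiff_heightProfile δ j).comp (by fun_prop)).mul
    (contDiff_prod fun i _ => (contDiff_baseProfile δ).comp (by fun_prop))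

lemma baseProfile_mem_Icc (hδ : 0 < δ) (hδ' : δ ≤ 1 / 16) (u : ℝ) :
    baseProfile δ u ∈ Set.Icc (0 : ℝ) 1 :=
  smoothStep_sub_mem_Icc hδ fun h => by linarith

lemma heightProfile_mem_Icc (hδ : 0 < δ) (hδ' : δ ≤ 1 / 16) (j : ℤ) (t : ℝ) :
    heightProfile δ j t ∈ Set.Icc (0 : ℝ) 1 :=
  smoothStep_sub_mem_Icc hδ (height_step hδ hδ' j t)

lemma modelBump_mem_Icc (hδ : 0 < δ) (hδ' : δ ≤ 1 / 16) (j : ℤ) (y : E (d + 1)) :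
    modelBump δ j y ∈ Set.Icc (0 : ℝ) 1 := by
  have h1 := heightProfile_mem_Icc hδ hδ' j (ht y)
  have h2 := fun i : Fin d => baseProfile_mem_Icc hδ hδ' (y i.castSucc)
  have h3 : 0 ≤ ∏ i : Fin d, baseProfile δ (y i.castSucc) :=
    Finset.prod_nonneg fun i _ => (h2 i).1
  have h4 : ∏ i : Fin d, baseProfile δ (y i.castSucc) ≤ 1 :=
    Finset.prod_le_one (fun i _ => (h2 i).1) fun i _ => (h2 i).2
  exact ⟨mul_nonneg h1.1 h3, mul_le_one₀ h1.2 h3 h4⟩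

lemma baseProfile_ne_zero (hδ : 0 < δ) (hδ' : δ ≤ 1 / 16) {u : ℝ} (h : baseProfile δ u ≠ 0) :
    -δ < u ∧ u < 1 + δ := by
  have := lt_of_smoothStep_sub_ne_zero hδ (fun h => by linarith) h
  exact ⟨this.1, by linarith [this.2]⟩

lemma heightProfile_ne_zero (hδ : 0 < δ) (hδ' : δ ≤ 1 / 16) {j : ℤ} {t : ℝ}
    (h : heightProfile δ j t ≠ 0) : 1 - δ < t ∧ t < 2 + 2 * δ := by
  have := lt_of_smoothStep_sub_ne_zero hδ (height_step hδ hδ' j t) h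
  refine ⟨by linarith [this.1], ?_⟩
  have h2 := this.2
  split_ifs at h2 <;> linarith

lemma modelBump_ne_zero (hδ : 0 < δ) (hδ' : δ ≤ 1 / 16) {j : ℤ} {y : E (d + 1)}
    (h : modelBump δ j y ≠ 0) : (1 - δ < ht y ∧ ht y < 2 + 2 * δ) ∧
      ∀ i : Fin d, -δ < y i.castSucc ∧ y i.castSucc < 1 + δ := by
  refine ⟨heightProfile_ne_zero hδ hδ' (left_ne_zero_of_mul h), fun i => ?_⟩
  exact baseProfile_ne_zero hδ hδ' (Finset.prod_ne_zero_iff.1 (right_ne_zero_of_mul h) i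
    (Finset.mem_univ i))

lemma hasCompactSupport_modelBump (hδ : 0 < δ) (hδ' : δ ≤ 1 / 16) (j : ℤ) :
    HasCompactSupport (modelBump (d := d) δ j) := by
  refine HasCompactSupport.of_support_subset_isCompact
    (isCompact_closedBall (0 : E (d + 1)) ((d + 1 : ℕ) * 3)) fun y hy => ?_
  obtain ⟨h1, h2⟩ := modelBump_ne_zero hδ hδ' hy
  refine Metric.mem_closedBall.2 (dist_le_of_forall_abs_le (by norm_num) fun i => ?_)
  rw [PiLp.zero_apply, sub_zero, abs_le]
  induction i using Fin.lastCases with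
  | last => exact ⟨by unfold ht at h1; linarith, by unfold ht at h1; linarith⟩
  | cast i => exact ⟨by linarith [(h2 i).1], by linarith [(h2 i).2]⟩

lemma exists_lipschitzWith_modelBump (hδ : 0 < δ) (hδ' : δ ≤ 1 / 16) :
    ∃ K : ℝ≥0, ∀ j, LipschitzWith K (modelBump (d := d) δ j) := by
  have h := fun j => ContDiff.lipschitzWith_of_hasCompactSupport
    (hasCompactSupport_modelBump (d := d) hδ hδ' j) (contDiff_modelBump δ j) (by simp)
  obtain ⟨K₀, h₀⟩ := h 0
  obtain ⟨K₁, h₁⟩ := h 1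
  refine ⟨max K₀ K₁, fun j => ?_⟩
  by_cases hj : j = 0
  · subst hj
    exact h₀.weaken (le_max_left _ _)
  · have : modelBump (d := d) δ j = modelBump δ 1 := by
      ext y; simp [modelBump, heightProfile, hj]
    rw [this]
    exact h₁.weaken (le_max_right _ _)

lemma exists_le_baseProfile (hδ : 0 < δ) (hδ' : δ ≤ 1 / 16) :
    ∃ c : ℝ, 0 < c ∧ ∀ u ∈ Set.Icc (0 : ℝ) 1, c ≤ baseProfile δ u := by
  obtain ⟨u, hu, hmin⟩ := (isCompact_Icc (a := (0 : ℝ)) (b := 1)).exists_isMinOn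
    (Set.nonempty_Icc.2 zero_le_one) (contDiff_baseProfile δ).continuous.continuousOn
  exact ⟨_, smoothStep_sub_pos hδ (fun h => by linarith) hu.1 (by linarith [hu.2]),
    fun v hv => hmin hv⟩

lemma exists_le_heightProfile (hδ : 0 < δ) (hδ' : δ ≤ 1 / 16) (j : ℤ) :
    ∃ c : ℝ, 0 < c ∧ ∀ t ∈ Set.Icc (1 : ℝ) 2, c ≤ heightProfile δ j t := by
  obtain ⟨t, ht, hmin⟩ := (isCompact_Icc (a := (1 : ℝ)) (b := 2)).exists_isMinOn
    (Set.nonempty_Icc.2 one_le_two) (contDiff_heightProfile δ j).continuous.continuousOn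
  refine ⟨_, smoothStep_sub_pos hδ (height_step hδ hδ' j t) (by linarith [ht.1]) ?_,
    fun v hv => hmin hv⟩
  split_ifs <;> linarith [ht.2]

lemma exists_le_modelBump (d : ℕ) (hδ : 0 < δ) (hδ' : δ ≤ 1 / 16) :
    ∃ c : ℝ, 0 < c ∧ ∀ (j : ℤ) (y : E (d + 1)), ht y ∈ Set.Icc (1 : ℝ) 2 →
      (∀ i : Fin d, y i.castSucc ∈ Set.Icc (0 : ℝ) 1) → c ≤ modelBump δ j y := by
  obtain ⟨c, hc, hb⟩ := exists_le_baseProfile hδ hδ'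
  obtain ⟨c₀, hc₀, h₀⟩ := exists_le_heightProfile hδ hδ' 0
  obtain ⟨c₁, hc₁, h₁⟩ := exists_le_heightProfile hδ hδ' 1
  refine ⟨min c₀ c₁ * c ^ d, by positivity, fun j y hy hy' => ?_⟩
  have hh : min c₀ c₁ ≤ heightProfile δ j (ht y) := by
    by_cases hj : j = 0
    · subst hj
      exact (min_le_left _ _).trans (h₀ _ hy)
    · have : heightProfile δ j = heightProfile δ 1 := by
        ext t; simp [heightProfile, hj]
      rw [this]
      exact (min_le_right _ _).trans (h₁ _ hy)
  refine mul_le_mul hh ?_ (by positivity) (le_trans (by positivity) hh)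
  calc c ^ d = ∏ _i : Fin d, c := by simp
    _ ≤ _ := Finset.prod_le_prod (fun _ _ => hc.le) fun i _ => hb _ (hy' i)

/-- The integer translates of the horizontal profile add up to one. -/
lemma sum_baseProfile (hδ : 0 < δ) (hδ' : δ ≤ 1 / 16) (u : ℝ) :
    ∑ m ∈ Finset.Icc (⌊u⌋ - 1) (⌊u⌋ + 1), baseProfile δ (u - m) = 1 := by
  have h1 := Int.floor_le u
  have h2 := Int.lt_floor_add_one u
  have e : Finset.Icc (⌊u⌋ - 1) (⌊u⌋ + 1) = {⌊u⌋ - 1, ⌊u⌋, ⌊u⌋ + 1} := by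
    ext m; simp; omega
  rw [e, Finset.sum_insert (by simp; omega), Finset.sum_insert (by simp), Finset.sum_singleton]
  unfold baseProfile
  push_cast
  rw [smoothStep_eq_one (x := u - (⌊u⌋ - 1)) hδ (by linarith),
    smoothStep_eq_zero (x := u - (⌊u⌋ + 1) - 1) hδ (by linarith),
    show u - ((⌊u⌋ : ℝ) - 1) - 1 = u - ⌊u⌋ by ring,
    show u - (⌊u⌋ : ℝ) - 1 = u - (⌊u⌋ + 1) by ring]
  ring

lemma baseProfile_eq_zero (hδ : 0 < δ) (hδ' : δ ≤ 1 / 16) {u : ℝ} {m : ℤ}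
    (hm : m ∉ Finset.Icc (⌊u⌋ - 1) (⌊u⌋ + 1)) : baseProfile δ (u - m) = 0 := by
  by_contra h
  obtain ⟨h1, h2⟩ := baseProfile_ne_zero hδ hδ' h
  have h3 := Int.floor_le u
  have h4 := Int.lt_floor_add_one u
  refine hm (Finset.mem_Icc.2 ⟨?_, ?_⟩)
  · have : (⌊u⌋ : ℝ) < m + 2 := by linarith
    have : ⌊u⌋ < m + 2 := by exact_mod_cast this
    omega
  · have : (m : ℝ) < ⌊u⌋ + 2 := by linarith
    have : m < ⌊u⌋ + 2 := by exact_mod_cast this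
    omega

/-- The rescaled vertical profiles telescope. -/
lemma sum_heightProfile (δ t : ℝ) (J : ℕ) :
    ∑ j ∈ Finset.range (J + 1), heightProfile δ j ((2 : ℝ) ^ (j : ℤ) * t) =
      smoothStep δ ((2 : ℝ) ^ (J : ℤ) * t - 1) - smoothStep δ (t - 2 - δ) := by
  induction J with
  | zero => simp [heightProfile]
  | succ J ih =>
    rw [Finset.sum_range_succ, ih, heightProfile, if_neg (by omega)]
    have : ((2 : ℝ) ^ ((J + 1 : ℕ) : ℤ) * t - 2) / 2 = (2 : ℝ) ^ (J : ℤ) * t - 1 := by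
      push_cast
      rw [zpow_add₀ two_ne_zero]; ring
    rw [this]
    ring

end profiles

/-- The cubes of edge length at most one are indexed by level and position. -/
def smallCubeEquiv (d : ℕ) : SmallCube d ≃ Σ _ : ℕ, Fin d → ℤ where
  toFun Q := ⟨Q.1.level.toNat, Q.1.pos⟩
  invFun a := ⟨⟨a.1, a.2⟩, Int.natCast_nonneg _⟩
  left_inv Q := Subtype.ext (DyadicCube.ext (Int.toNat_of_nonneg Q.2) rfl)
  right_inv a := by simp

/-- The horizontal profiles add up to one on every level; then the vertical profiles telescope, and
only the first and the last step remain. -/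
lemma tsum_whitneyBump {x : E (d + 1)} (h0 : 0 < ht x) (h2 : ht x ≤ 2) :
    ∑' Q : SmallCube d, whitneyBump Q x = 1 := by
  have hδ := stepWidth_pos d
  have hδ' := stepWidth_le d
  set δ := stepWidth d with hδdef
  rw [← (smallCubeEquiv d).symm.tsum_eq]
  obtain ⟨J, hJ⟩ : ∃ J : ℕ, 2 ≤ (2 : ℝ) ^ (J : ℤ) * ht x := by
    obtain ⟨J, hJ⟩ := pow_unbounded_of_one_lt (2 / ht x) (one_lt_two (α := ℝ))
    exact ⟨J, by rw [zpow_natCast]; rw [div_lt_iff₀ h0] at hJ; exact hJ.le⟩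
  have hval : ∀ (j : ℕ) (m : Fin d → ℤ),
      whitneyBump ((smallCubeEquiv d).symm ⟨j, m⟩) x =
        heightProfile δ j ((2 : ℝ) ^ (j : ℤ) * ht x) *
          ∏ i : Fin d, baseProfile δ ((2 : ℝ) ^ (j : ℤ) * x i.castSucc - m i) := by
    intro j m
    simp [whitneyBump, modelBump, smallCubeEquiv, ht, hδdef]
  let t : ℕ → Fin d → Finset ℤ := fun j i =>
    Finset.Icc (⌊(2 : ℝ) ^ (j : ℤ) * x i.castSucc⌋ - 1) (⌊(2 : ℝ) ^ (j : ℤ) * x i.castSucc⌋ + 1)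
  rw [tsum_eq_sum (s := (Finset.range (J + 1)).sigma fun j => Fintype.piFinset (t j))]
  · rw [Finset.sum_sigma]
    have : ∀ j ∈ Finset.range (J + 1), ∑ m ∈ Fintype.piFinset (t j),
        whitneyBump ((smallCubeEquiv d).symm ⟨j, m⟩) x =
          heightProfile δ j ((2 : ℝ) ^ (j : ℤ) * ht x) := by
      intro j _
      simp_rw [hval]
      rw [← Finset.mul_sum, ← Finset.prod_univ_sum (t j)
        fun i (m : ℤ) => baseProfile δ ((2 : ℝ) ^ (j : ℤ) * x i.castSucc - m)]
      simp [t, sum_baseProfile hδ hδ']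
    rw [Finset.sum_congr rfl this, sum_heightProfile, smoothStep_eq_one hδ (by linarith),
      smoothStep_eq_zero hδ (by linarith), sub_zero]
  · rintro ⟨j, m⟩ hjm
    rw [hval]
    rw [Finset.mem_sigma, not_and_or] at hjm
    rcases hjm with hj | hm
    · have hj' : J + 1 ≤ j := by simpa using hj
      have h4 : (2 : ℝ) ^ ((J + 1 : ℕ) : ℤ) * ht x ≤ (2 : ℝ) ^ (j : ℤ) * ht x := by
        gcongr
        · exact one_le_two
      have h5 : (2 : ℝ) ^ ((J + 1 : ℕ) : ℤ) = 2 * (2 : ℝ) ^ (J : ℤ) := by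
        push_cast
        rw [zpow_add₀ two_ne_zero]; ring
      have : heightProfile δ j ((2 : ℝ) ^ (j : ℤ) * ht x) = 0 := by
        by_contra hne
        have := (heightProfile_ne_zero hδ hδ' hne).2
        rw [h5] at h4
        linarith
      rw [this, zero_mul]
    · rw [Fintype.mem_piFinset, not_forall] at hm
      obtain ⟨i, hi⟩ := hm
      rw [Finset.prod_eq_zero (Finset.mem_univ i) (baseProfile_eq_zero hδ hδ' hi), mul_zero]

/-- Membership in a Whitney box in terms of the rescaled point. -/
lemma mem_whitneyBox_iff {Q : DyadicCube d} {x : E (d + 1)} : x ∈ whitneyBox Q ↔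
    (∀ i : Fin d, ((2 : ℝ) ^ Q.level • x - bdryShift Q.pos) i.castSucc ∈ Set.Ioc (0 : ℝ) 1) ∧
      ((2 : ℝ) ^ Q.level • x - bdryShift Q.pos) (Fin.last d) ∈ Set.Ioc (1 : ℝ) 2 := by
  have hpos : (0 : ℝ) < (2 : ℝ) ^ Q.level := by positivity
  have hlen : Q.len = ((2 : ℝ) ^ Q.level)⁻¹ := by unfold DyadicCube.len; rw [zpow_neg]
  simp only [whitneyBox, Set.mem_ofPred_eq, PiLp.sub_apply, PiLp.smul_apply, bdryShift_castSucc,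
    bdryShift_last, smul_eq_mul, Set.mem_Ioc, hlen]
  refine and_congr (forall_congr' fun i => and_congr ?_ ?_) (and_congr ?_ ?_)
  · rw [inv_mul_lt_iff₀ hpos, sub_pos]
  · rw [le_inv_mul_iff₀ hpos, sub_le_iff_le_add, add_comm (1 : ℝ)]
  · rw [sub_zero, inv_lt_iff_one_lt_mul₀ hpos, mul_comm]
  · rw [sub_zero, ← div_eq_mul_inv, le_div_iff₀ hpos, mul_comm]

/-- The points where a bump does not vanish are close to the Whitney box. -/
lemma exists_whitneyBox_dist_le {Q : SmallCube d} {x : E (d + 1)} (h : whitneyBump Q x ≠ 0) :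
    ∃ w ∈ whitneyBox Q.1, dist x w ≤ Q.1.len / 8 := by
  have hδ := stepWidth_pos d
  have hδ' := stepWidth_le d
  obtain ⟨h1, h2⟩ := modelBump_ne_zero hδ hδ' h
  set δ := stepWidth d with hδdef
  set y := (2 : ℝ) ^ Q.1.level • x - bdryShift Q.1.pos with hy
  have hpos : (0 : ℝ) < (2 : ℝ) ^ Q.1.level := by positivity
  have hlen : Q.1.len = ((2 : ℝ) ^ Q.1.level)⁻¹ := by unfold DyadicCube.len; rw [zpow_neg]
  -- The rescaled point is moved into the model box coordinate by coordinate.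
  set y' : E (d + 1) := WithLp.toLp 2 (Fin.snoc (α := fun _ => ℝ)
    (fun i : Fin d => max δ (min (y i.castSucc) 1)) (max (1 + δ) (min (ht y) 2))) with hy'
  have e1 : ∀ i : Fin d, y' i.castSucc = max δ (min (y i.castSucc) 1) := fun i => by simp [hy']
  have e2 : y' (Fin.last d) = max (1 + δ) (min (ht y) 2) := by simp [hy']
  have hdist : ∀ i, |y i - y' i| ≤ 2 * δ := by
    intro i
    induction i using Fin.lastCases with
    | last =>
      rw [e2, abs_le]
      change -(2 * δ) ≤ ht y - _ ∧ ht y - _ ≤ _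
      rcases max_cases (1 + δ) (min (ht y) 2) with h | h <;>
        rcases min_cases (ht y) 2 with h' | h' <;> constructor <;> linarith
    | cast i =>
      have := h2 i
      rw [e1, abs_le]
      rcases max_cases δ (min (y i.castSucc) 1) with h | h <;>
        rcases min_cases (y i.castSucc) 1 with h' | h' <;> constructor <;> linarith
  set w : E (d + 1) := ((2 : ℝ) ^ Q.1.level)⁻¹ • (y' + bdryShift Q.1.pos) with hw
  have hwy : (2 : ℝ) ^ Q.1.level • w - bdryShift Q.1.pos = y' := by
    rw [hw, smul_inv_smul₀ hpos.ne', add_sub_cancel_right]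
  have hxy : x = ((2 : ℝ) ^ Q.1.level)⁻¹ • (y + bdryShift Q.1.pos) := by
    rw [hy, sub_add_cancel, inv_smul_smul₀ hpos.ne']
  refine ⟨w, mem_whitneyBox_iff.2 ?_, ?_⟩
  · rw [hwy]
    refine ⟨fun i => ?_, ?_⟩
    · rw [e1]
      exact ⟨lt_max_of_lt_left hδ, max_le (by linarith) (min_le_right _ _)⟩
    · rw [e2]
      exact ⟨lt_max_of_lt_left (by linarith), max_le (by linarith) (min_le_right _ _)⟩
  · have h3 := dist_le_of_forall_abs_le (by positivity) hdist
    have h4 : ((d + 1 : ℕ) : ℝ) * (2 * δ) = 1 / 8 := by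
      rw [hδdef, stepWidth]; push_cast; field_simp; norm_num
    rw [h4] at h3
    rw [hxy, hw, dist_smul₀, dist_add_right, norm_inv, Real.norm_of_nonneg hpos.le, hlen]
    have : (0 : ℝ) < ((2 : ℝ) ^ Q.1.level)⁻¹ := by positivity
    nlinarith

/-- The standard Whitney bumps form an admissible family. -/
lemma isWhitneyPartition_whitneyBump (d : ℕ) : IsWhitneyPartition d (whitneyBump (d := d)) := by
  have hδ := stepWidth_pos d
  have hδ' := stepWidth_le d
  refine ⟨fun Q => ?_, fun Q x => modelBump_mem_Icc hδ hδ' _ _, ?_, ?_, fun Q => ?_, ?_⟩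
  · unfold whitneyBump
    exact (contDiff_modelBump _ _).comp (by fun_prop)
  · obtain ⟨K, hK⟩ := exists_lipschitzWith_modelBump (d := d) hδ hδ'
    refine ⟨K, fun Q => LipschitzWith.of_dist_le_mul fun x y => ?_⟩
    refine ((hK Q.1.level).dist_le_mul _ _).trans (le_of_eq ?_)
    have hpos : (0 : ℝ) < (2 : ℝ) ^ Q.1.level := by positivity
    rw [dist_sub_right, dist_smul₀, Real.norm_of_nonneg hpos.le, NNReal.coe_div,
      Real.coe_toNNReal _ Q.1.len_pos.le, DyadicCube.len, zpow_neg, div_inv_eq_mul]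
    ring
  · obtain ⟨c, hc, h⟩ := exists_le_modelBump d hδ hδ'
    refine ⟨c, hc, fun Q x hx => ?_⟩
    obtain ⟨h1, h2⟩ := mem_whitneyBox_iff.1 hx
    exact h _ _ ⟨h2.1.le, h2.2⟩ fun i => ⟨(h1 i).1.le, (h1 i).2⟩
  · have hl := Q.1.len_pos
    refine (closure_minimal (fun x hx => ?_) Metric.isClosed_cthickening).trans
      (Metric.cthickening_subset_thickening' (δ₁ := Q.1.len / 8) (by positivity) (by linarith) _)
    obtain ⟨w, hw, hd⟩ := exists_whitneyBox_dist_le hx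
    exact Metric.mem_cthickening_of_dist_le x w _ _ hw hd
  · intro x hx
    obtain ⟨Q, hQ⟩ := Set.mem_iUnion.1 hx
    have hl := Q.1.len_pos
    have hl1 : Q.1.len ≤ 1 := zpow_le_one_of_nonpos₀ one_le_two (by simpa using Q.2)
    exact tsum_whitneyBump (hl.trans hQ.2.1) (hQ.2.2.trans (by linarith))

end

end BesovTrace

theorem mainTheorem1 (d : ℕ) (hd : 1 ≤ d) (s : ℝ) (hs0 : 0 < s) (hs1 : s < 1)
    (p : ℝ≥0∞) (hp : 1 ≤ p) (q : ℝ≥0∞) (hq : 0 < q)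
    (α : ℝ) (hα : -1 < α) (hαs : p ≠ ∞ → α < s * p.toReal - 1) :
    (∃ ψ : BesovTrace.SmallCube d → BesovTrace.E (d + 1) → ℝ,
      BesovTrace.IsWhitneyPartition d ψ) ∧
    ∀ ψ : BesovTrace.SmallCube d → BesovTrace.E (d + 1) → ℝ,
      BesovTrace.IsWhitneyPartition d ψ →
      BesovTrace.IsWhitneyTraceExtensionPair ψ (BesovTrace.muAlpha d α)
        (BesovTrace.besovSpace Set.univ volume (s - (α + 1) * (p⁻¹).toReal) p q)
        (BesovTrace.besovNorm Set.univ volume (s - (α + 1) * (p⁻¹).toReal) p q)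
        (BesovTrace.besovSpace (BesovTrace.upperHalf d) (BesovTrace.muAlpha d α) s p q)
        (BesovTrace.besovNorm (BesovTrace.upperHalf d) (BesovTrace.muAlpha d α) s p q) := by
  -- For `p = ∞` the left-hand side is zero, and otherwise this is the upper bound on `α`.
  have hβ : (α + 1) * (p⁻¹).toReal < s := by
    rcases eq_or_ne p ∞ with rfl | hp'
    · simpa using hs0
    · have hp0 : 0 < p.toReal := ENNReal.toReal_pos (zero_lt_one.trans_le hp).ne' hp'
      rw [ENNReal.toReal_inv, ← div_eq_mul_inv, div_lt_iff₀ hp0]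
      linarith [hαs hp']
  refine ⟨⟨_, BesovTrace.isWhitneyPartition_whitneyBump d⟩, fun ψ hψ => ?_⟩
  rw [← one_div] at hβ ⊢
  have hext : ∀ f ∈ BesovTrace.besovSpace Set.univ volume (s - (α + 1) * (1 / p).toReal) p q,
      BesovTrace.whitneyExt ψ f ∈
        BesovTrace.besovSpace (BesovTrace.upperHalf d) (BesovTrace.muAlpha d α) s p q := by
    obtain ⟨C, hC⟩ := BesovTrace.exists_besovNorm_whitneyExt_le hα hp hq hs0 hs1 hβ hψ
    exact fun f hf => ⟨BesovTrace.locInt_whitneyExt hα hp hq hs0 hψ hf,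
      (hC f hf).trans_lt (ENNReal.mul_lt_top ENNReal.coe_lt_top hf.2)⟩
  have htrace := BesovTrace.exists_besovNorm_trace_le (d := d) hα hp hq hβ
  exact
    { ext_mem := hext
      ext_bounded := BesovTrace.exists_besovNorm_whitneyExt_le hα hp hq hs0 hs1 hβ hψ
      trace_exists := fun u hu => (BesovTrace.trace_spec hα hp hq hβ hu).mono
        fun x hx => ⟨_, hx.1⟩
      trace_locInt := fun u hu => BesovTrace.locallyIntegrable_trace hα hp hq hβ hu
      trace_mem := fun u hu => by
        obtain ⟨C, hC⟩ := htrace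
        refine ⟨fun B hB => ?_, (hC u hu).trans_lt (ENNReal.mul_lt_top ENNReal.coe_lt_top hu.2)⟩
        rw [Set.inter_univ]
        exact BesovTrace.integrableOn_of_isBounded
          (BesovTrace.locallyIntegrable_trace hα hp hq hβ hu) hB
      trace_bounded := htrace
      trace_ext := fun f hf => BesovTrace.trace_whitneyExt hα hp hq hs0 hβ hψ hf (hext f hf) }
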